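/- **Setting.** Let $d\in\{2,3\}$, let $\Omega\subset\mathbb R^d$ be a bounded polytopal domain, $f\in L^2(\Omega)$, and let $u\in H^1_0(\Omega)$ be the weak solution of $(\nabla u,\nabla v)_\Omega=(f,v)_\Omega$ for all $v\in H^1_0(\Omega)$. Let $\mathcal T_h$ be a finite polytopal mesh of $\Omega$; $\mathcal F_h(K)$ is the set of flat $(d-1)$-dimensional faces of an element $K$, every face lies on $\partial\Omega$ or is shared by two elements, $\boldsymbol n$ is the unit normal outward to $K$, and $h_D$ is the diameter of $D$, $h=\max_K h_K$. **Discretization.** $V_h(K)=\{v\in H^1(K):\Delta v=0,\ \nabla v\cdot\boldsymbol n|_F\in\mathbb P_0(F)\ \forall F\in\mathcal F_h(K)\}$, and $V_h$ is the set of $v\in L^2(\Omega)$ with $v|_K\in V_h(K)$ for all $K$ and $\int_F[v]_F\,dS=0$ on every face (on boundary faces $[v]_F=v$). For each $K$ let $\omega_K\supseteq K$ be a patch, a polytopal domain that is a union of elements. For a piecewise $H^1$ function $v$ let $\Pi_Kv,\Pi_{\omega_K}v\in\mathbb P_1$ be given by $(\nabla\Pi_Kv,\nabla q)_K=(\nabla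 v,\nabla q)_K$ and $(\nabla\Pi_{\omega_K}v,\nabla q)_{\omega_K}=\sum_{K'\subset\omega_K}(\nabla v,\nabla q)_{K'}$ for all $q\in\mathbb P_1$, and $\int_{\partial\omega_K}\Pi_Kv=\int_{\partial\omega_K}\Pi_{\omega_K}v=\int_{\partial\omega_K}v$. With $Q_Fv$ the average of $v$ over $F$, put $$a_h(w,v)=\sum_{K}\Big\{(\nabla\Pi_Kw,\nabla\Pi_Kv)_K+\sum_{F\in\mathcal F_h(K)}h_{\omega_K}^{-1}\big(Q_F(w-\Pi_{\omega_K}w),Q_F(v-\Pi_{\omega_K}v)\big)_F\Big\},$$ $|||v|||^2=a_h(v,v)$. Let $u_h\in V_h$ satisfy $a_h(u_h,v)=\sum_K(f,\Pi_Kv)_K$ for all $v\in V_h$, and let $u_I\in V_h$ have the same average as $u$ on every face. **Assumptions.** For a subset $G$ of a face and a domain $D$, take a unit normal direction of $G$ pointing into $D$, let $\delta_G=\inf\{\tau>0: D\cap(G\times(\tau,\infty))=\varnothing\}$, and let $l_G$ be the supremum of the heights of pyramids with base $G$ contained in $D\cap(G\times(0,\delta_G])$. A face $F$ satisfies the height and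 hourglass conditions toward $D$ if it can be partitioned (up to null sets) into at most $b$ measurable pieces $F_\beta$ with $l_{F_\beta}\ge\gamma_1h_F$, and for each of them some such pyramid over $F_\beta$ of height at least $\gamma_1h_F$ is contained in a convex set $K_\beta\subseteq D$ with $h_D\le\kappa h_{K_\beta}$. Assume: * (A) every element has at most $N$ faces; * (D) for every element $K$: $\omega_K$ is isotropic, i.e. $\partial\omega_K$ consists of at most $N$ mesh faces, each satisfying the height and hourglass conditions toward $\omega_K$; $h_{\omega_K}\le\gamma_2h$; every $F\in\mathcal F_h(K)$ satisfies the height and hourglass conditions toward $\omega_K$ (for a face interior to $\omega_K$ either normal direction may be used); $\omega_K$ consists of at most $M$ elements. **Claim.** There is a constant $C>0$ depending only on $d,N,b,M,\gamma_1,\kappa,\gamma_2$ such that, whenever the normal derivatives $\nabla u\cdot\boldsymbol n$ on the faces of the elements are in $L^2$, $$\begin{aligned}|||u_h-u_I|||^2\le C\Big(&\sum_{K\in\mathcal T_h}\sum_{F\in\mathcal F_h(K)}h_{\omega_K}\|\nabla(u-\Pi_{\omega_K}u)\cdot\boldsymbol n\|_{0,F}^2+\sum_{K\in\mathcal T_h}\sum_{F\in\mathcal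 F_h(K)}h_{\omega_K}^{-1}\|u-\Pi_{\omega_K}u\|_{0,F}^2\\&+\sum_{K\in\mathcal T_h}\|\nabla(u-\Pi_{\omega_K}u)\|_{0,K}^2+\sum_{K\in\mathcal T_h}h_{\omega_K}^2\|f\|_{0,K}^2\Big).\end{aligned}$$ -/

import Mathlib

open MeasureTheory Filter Topology
open scoped ContDiff Gradient

noncomputable section

namespace VEM

/-- The ambient Euclidean space `ℝ^d`. -/
abbrev Pt (d : ℕ) := EuclideanSpace ℝ (Fin d)

variable {d : ℕ}

/-- Surface measure (`(d-1)`-dimensional area) restricted to `F`. -/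
def surf (F : Set (Pt d)) : Measure (Pt d) := (μHE[d - 1] : Measure (Pt d)).restrict F

/-! ### Polytopes -/

/-- `F` is a relatively open, connected, flat face in a hyperplane with unit normal `ν`, whose
relative boundary is made of finitely many pieces of `(d-2)`-dimensional affine subspaces. -/
structure IsFlatFace (F : Set (Pt d)) (ν : Pt d) : Prop where
  connected : IsConnected F
  bounded : Bornology.IsBounded F
  unit : ‖ν‖ = 1
  flat : ∀ x ∈ F, ∀ y ∈ F, inner ℝ (y - x) ν = 0
  relOpen : ∀ x ∈ F, ∃ r > 0, ∀ y ∈ Metric.ball x r, inner ℝ (y - x) ν = 0 → y ∈ F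
  bdry : ∃ A : Finset (AffineSubspace ℝ (Pt d)),
    (∀ a ∈ A, Module.finrank ℝ a.direction + 2 ≤ d) ∧ closure F \ F ⊆ ⋃ a ∈ A, (a : Set (Pt d))

/-- `K` is a bounded polytopal domain (not necessarily convex) with the open faces `S`, and `n F` is
the outward unit normal on the face `F ∈ S`: near each point of an open face, `K` is a half ball. -/
structure IsPolytopeWith (K : Set (Pt d)) (S : Finset (Set (Pt d))) (n : Set (Pt d) → Pt d) :
    Prop where
  isOpen : IsOpen K
  connected : IsConnected K
  bounded : Bornology.IsBounded K
  flatFace : ∀ F ∈ S, IsFlatFace F (n F)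
  disjoint : ∀ F ∈ S, ∀ F' ∈ S, F ≠ F' → Disjoint F F'
  frontier_eq : frontier K = ⋃ F ∈ S, closure F
  oneSided : ∀ F ∈ S, ∀ x ∈ F, ∃ r > 0, ∀ y ∈ Metric.ball x r, (y ∈ K ↔ inner ℝ (y - x) (n F) < 0)

/-- A bounded polytopal domain. -/
def IsPolytope (K : Set (Pt d)) : Prop := ∃ S n, IsPolytopeWith K S n

/-- A polytopal mesh of `Ω`. Elements are open polytopes, faces are relatively open, and every face
either lies on `∂Ω` or is a common face of two different elements (hanging nodes are permitted:
several faces of one element may lie in one hyperplane). -/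
structure Mesh (Ω : Set (Pt d)) where
  /-- the elements -/
  cells : Finset (Set (Pt d))
  /-- the faces of an element -/
  faces : Set (Pt d) → Finset (Set (Pt d))
  /-- `normal K F` is the unit normal of the face `F` of `K` that is outward with respect to `K` -/
  normal : Set (Pt d) → Set (Pt d) → Pt d
  polytope : ∀ K ∈ cells, IsPolytopeWith K (faces K) (normal K)
  subset : ∀ K ∈ cells, K ⊆ Ω
  disjoint : ∀ K ∈ cells, ∀ K' ∈ cells, K ≠ K' → Disjoint K K'
  cover : closure Ω = ⋃ K ∈ cells, closure K
  faces_disjoint : ∀ K ∈ cells, ∀ K' ∈ cells, ∀ F ∈ faces K, ∀ F' ∈ faces K',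
    F ≠ F' → Disjoint F F'
  conforming : ∀ K ∈ cells, ∀ F ∈ faces K,
    F ⊆ frontier Ω ∨ ∃ K' ∈ cells, K' ≠ K ∧ F ∈ faces K'

/-- The mesh size `h`, the largest diameter of an element. -/
def Mesh.size {Ω : Set (Pt d)} (T : Mesh Ω) : ℝ :=
  sSup (Metric.diam '' (T.cells : Set (Set (Pt d))))

/-- The domain that is the union of the elements in `A` (and of the faces between them). -/
def patch (A : Finset (Set (Pt d))) : Set (Pt d) := interior (⋃ K ∈ A, closure K)

open Classical in
/-- The faces of `K` that lie on the boundary of the patch `A`. -/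
def Mesh.outerFaces {Ω : Set (Pt d)} (T : Mesh Ω) (A : Finset (Set (Pt d))) (K : Set (Pt d)) :
    Finset (Set (Pt d)) :=
  (T.faces K).filter fun F => F ⊆ frontier (patch A)

open Classical in
/-- The faces of the mesh that lie on the boundary of the patch `A`. -/
def Mesh.patchFaces {Ω : Set (Pt d)} (T : Mesh Ω) (A : Finset (Set (Pt d))) :
    Finset (Set (Pt d)) :=
  A.biUnion fun K => T.outerFaces A K

/-! ### Geometric assumptions -/

/-- The prism `F × I` over `F` in direction `m`. -/
def prism (F : Set (Pt d)) (m : Pt d) (I : Set ℝ) : Set (Pt d) :=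
  {y | ∃ x ∈ F, ∃ τ ∈ I, y = x + τ • m}

/-- `δ_F`, how far the set `D` extends over `F` in direction `m`. -/
def depth (D F : Set (Pt d)) (m : Pt d) : ℝ :=
  sInf {τ : ℝ | 0 < τ ∧ D ∩ prism F m (Set.Ioi τ) = ∅}

/-- The pyramid with base `F` and apex `a`. -/
def pyramid (F : Set (Pt d)) (a : Pt d) : Set (Pt d) :=
  {y | ∃ x ∈ F, ∃ t ∈ Set.Ioo (0 : ℝ) 1, y = (1 - t) • x + t • a}

/-- The pyramid with base `F` and apex `a` lies in `D` and in the prism over `F`. -/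
def IsInscribed (D F : Set (Pt d)) (m a : Pt d) : Prop :=
  pyramid F a ⊆ D ∩ prism F m (Set.Ioc 0 (depth D F m))

/-- The inward height `l_F` of `F` in `D`. -/
def localHeight (D F : Set (Pt d)) (m : Pt d) : ℝ :=
  sSup {l : ℝ | 0 < l ∧ ∃ a, l = Metric.infDist a F ∧ IsInscribed D F m a}

/-- `F = ⋃ F_β` up to sets of zero area, with disjoint pieces. -/
structure IsFacePartition (F : Set (Pt d)) (P : Finset (Set (Pt d))) : Prop where
  subset : ∀ β ∈ P, β ⊆ F
  measurable : ∀ β ∈ P, MeasurableSet β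
  disjoint : ∀ β ∈ P, ∀ β' ∈ P, β ≠ β' → Disjoint β β'
  cover : surf F (⋃ β ∈ P, β)ᶜ = 0

/-- The height condition for a piece `β` of the face `F`. -/
def HeightCondition (γ₁ : ℝ) (D F β : Set (Pt d)) (m : Pt d) : Prop :=
  γ₁ * Metric.diam F ≤ localHeight D β m

/-- The hourglass condition for a piece `β` of the face `F`: a pyramid over `β` that has the height
required by the height condition is contained in a convex subset of `D` of comparable size. -/
def HourglassCondition (γ₁ κ : ℝ) (D F β : Set (Pt d)) (m : Pt d) : Prop :=
  ∃ a, IsInscribed D β m a ∧ γ₁ * Metric.diam F ≤ Metric.infDist a β ∧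
    ∃ Kβ ⊆ D, Convex ℝ Kβ ∧ pyramid β a ⊆ Kβ ∧ Metric.diam D ≤ κ * Metric.diam Kβ

/-- The face `F` satisfies the height and the hourglass condition toward `D` (in direction `m`) with
a common partition into at most `b` pieces. -/
def IsotropicFace (b : ℕ) (γ₁ κ : ℝ) (D F : Set (Pt d)) (m : Pt d) : Prop :=
  ∃ P : Finset (Set (Pt d)), P.card ≤ b ∧ IsFacePartition F P ∧
    ∀ β ∈ P, HeightCondition γ₁ D F β m ∧ HourglassCondition γ₁ κ D F β m

/-- Every element has at most `N` faces. -/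
def AssumptionA {Ω : Set (Pt d)} (T : Mesh Ω) (N : ℕ) : Prop :=
  ∀ K ∈ T.cells, (T.faces K).card ≤ N

/-- The patch `A` is an isotropic polytope: it has at most `N` faces, and each of them satisfies the
height and hourglass conditions. -/
structure IsotropicPatch {Ω : Set (Pt d)} (T : Mesh Ω) (N b : ℕ) (γ₁ κ : ℝ)
    (A : Finset (Set (Pt d))) : Prop where
  polytope : IsPolytope (patch A)
  card_faces : (T.patchFaces A).card ≤ N
  faces : ∀ K ∈ A, ∀ F ∈ T.outerFaces A K, IsotropicFace b γ₁ κ (patch A) F (-T.normal K F)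

/-- Every element `K` has an isotropic extended patch `ω_K`, of elements `Λ K`. A face of `K` in the
interior of `ω_K` may use either of its two normal directions. -/
structure AssumptionD {Ω : Set (Pt d)} (T : Mesh Ω) (N b M : ℕ) (γ₁ κ γ₂ : ℝ)
    (Λ : Set (Pt d) → Finset (Set (Pt d))) : Prop where
  subset : ∀ K ∈ T.cells, Λ K ⊆ T.cells
  isotropic : ∀ K ∈ T.cells, IsotropicPatch T N b γ₁ κ (Λ K)
  mem : ∀ K ∈ T.cells, K ∈ Λ K
  diam_le : ∀ K ∈ T.cells, Metric.diam (patch (Λ K)) ≤ γ₂ * T.size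
  face : ∀ K ∈ T.cells, ∀ F ∈ T.faces K, ∃ m, (m = T.normal K F ∨ m = -T.normal K F) ∧
    IsotropicFace b γ₁ κ (patch (Λ K)) F m
  card_le : ∀ K ∈ T.cells, (Λ K).card ≤ M

/-! ### Sobolev functions, traces, normal derivatives -/

/-- `v ∈ H¹(D)` with weak gradient `G`. -/
structure HasWeakGrad (D : Set (Pt d)) (v : Pt d → ℝ) (G : Pt d → Pt d) : Prop where
  memLp : MemLp v 2 (volume.restrict D)
  memLp_grad : MemLp G 2 (volume.restrict D)
  weak : ∀ φ : Pt d → ℝ, ContDiff ℝ ∞ φ → HasCompactSupport φ → tsupport φ ⊆ D →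
    ∫ x in D, v x • ∇ φ x = -∫ x in D, φ x • G x

/-- `v ∈ H¹(D)`. -/
def MemH1 (D : Set (Pt d)) (v : Pt d → ℝ) : Prop := ∃ G, HasWeakGrad D v G

open Classical in
/-- The weak gradient of `v ∈ H¹(D)`. -/
def weakGrad (D : Set (Pt d)) (v : Pt d → ℝ) : Pt d → Pt d :=
  if h : MemH1 D v then h.choose else 0

/-- `φ i → v` in `H¹(D)`, for smooth functions `φ i`. -/
def TendstoH1 (D : Set (Pt d)) (φ : ℕ → Pt d → ℝ) (v : Pt d → ℝ) : Prop :=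
  Tendsto (fun i => eLpNorm (fun x => v x - φ i x) 2 (volume.restrict D)) atTop (𝓝 0) ∧
  Tendsto (fun i => eLpNorm (fun x => weakGrad D v x - ∇ (φ i) x) 2 (volume.restrict D))
    atTop (𝓝 0)

/-- `u ∈ H¹₀(Ω)`, the closure of the smooth functions with compact support in `Ω`. -/
def MemH10 (Ω : Set (Pt d)) (u : Pt d → ℝ) : Prop :=
  MemH1 Ω u ∧ ∃ φ : ℕ → Pt d → ℝ,
    (∀ i, ContDiff ℝ ∞ (φ i) ∧ HasCompactSupport (φ i) ∧ tsupport (φ i) ⊆ Ω) ∧ TendstoH1 Ω φ u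

/-- `t ∈ L²(F)` is the trace of `v ∈ H¹(K)` on the face `F`: the limit of the restrictions to `F` of
functions smooth up to the boundary that converge to `v` in `H¹(K)`. -/
def HasTrace (K F : Set (Pt d)) (v t : Pt d → ℝ) : Prop :=
  MemH1 K v ∧ MemLp t 2 (surf F) ∧ ∃ φ : ℕ → Pt d → ℝ, (∀ i, ContDiff ℝ ∞ (φ i)) ∧
    TendstoH1 K φ v ∧ Tendsto (fun i => eLpNorm (fun x => t x - φ i x) 2 (surf F)) atTop (𝓝 0)

open Classical in
/-- The trace on the face `F` of `K` of `v ∈ H¹(K)`. -/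
def trace (K F : Set (Pt d)) (v : Pt d → ℝ) : Pt d → ℝ :=
  if h : ∃ t, HasTrace K F v t then h.choose else 0

/-- The average `χ_F(v) = Q_F v` over the face `F` of `K` of the trace of `v`. -/
def faceAvg (K F : Set (Pt d)) (v : Pt d → ℝ) : ℝ := ⨍ x, trace K F v x ∂(surf F)

/-- `v ∈ H¹(K)` has weak Laplacian `L ∈ L²(K)`, and its normal derivative is the function
`g F ∈ L²(F)` on each face `F ∈ S` of `K`, in the sense of the Green formula. -/
structure HasNormalDeriv (K : Set (Pt d)) (S : Finset (Set (Pt d))) (v L : Pt d → ℝ)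
    (g : Set (Pt d) → Pt d → ℝ) : Prop where
  memH1 : MemH1 K v
  memLp : MemLp L 2 (volume.restrict K)
  memLp_face : ∀ F ∈ S, MemLp (g F) 2 (surf F)
  green : ∀ φ : Pt d → ℝ, ContDiff ℝ ∞ φ →
    (∫ x in K, inner ℝ (weakGrad K v x) (∇ φ x)) + (∫ x in K, L x * φ x) =
      ∑ F ∈ S, ∫ x, g F x * φ x ∂(surf F)

/-! ### The nonconforming virtual element method -/

/-- `u` is the weak solution of `-Δu = f` in `Ω`, `u = 0` on `∂Ω`. -/
def IsWeakSolution (Ω : Set (Pt d)) (f u : Pt d → ℝ) : Prop :=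
  MemH10 Ω u ∧ ∀ v, MemH10 Ω v →
    ∫ x in Ω, inner ℝ (weakGrad Ω u x) (weakGrad Ω v x) = ∫ x in Ω, f x * v x

/-- The local space `V_h(K)`: harmonic functions in `H¹(K)` with constant normal derivative on each
face. (That `v` has a trace on the faces, which the degrees of freedom need, holds for all `H¹`
functions on a polytope.) -/
structure MemLocalSpace {Ω : Set (Pt d)} (T : Mesh Ω) (K : Set (Pt d)) (v : Pt d → ℝ) : Prop where
  memH1 : MemH1 K v
  hasTrace : ∀ F ∈ T.faces K, ∃ t, HasTrace K F v t
  neumann : ∃ c : Set (Pt d) → ℝ, HasNormalDeriv K (T.faces K) v 0 (fun F _ => c F)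

/-- The global space `V_h`. -/
structure MemSpace {Ω : Set (Pt d)} (T : Mesh Ω) (v : Pt d → ℝ) : Prop where
  memLp : MemLp v 2 (volume.restrict Ω)
  loc : ∀ K ∈ T.cells, MemLocalSpace T K v
  jump : ∀ K ∈ T.cells, ∀ K' ∈ T.cells, K ≠ K' → ∀ F ∈ T.faces K, F ∈ T.faces K' →
    ∫ x, trace K F v x ∂(surf F) = ∫ x, trace K' F v x ∂(surf F)
  bdry : ∀ K ∈ T.cells, ∀ F ∈ T.faces K, F ⊆ frontier Ω → ∫ x, trace K F v x ∂(surf F) = 0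

/-- Polynomials of degree at most one. -/
def IsP1 (q : Pt d → ℝ) : Prop := ∃ (a : Pt d) (c : ℝ), ∀ x, q x = inner ℝ a x + c

/-- `q` is the (broken) elliptic projection of `v` to the linear polynomials on the union of the
elements in `B`, with the constant fixed by the integral over the boundary of the patch `A`. -/
structure IsProj {Ω : Set (Pt d)} (T : Mesh Ω) (A B : Finset (Set (Pt d))) (v q : Pt d → ℝ) :
    Prop where
  isP1 : IsP1 q
  grad : ∀ p, IsP1 p → ∑ K ∈ B, ∫ x in K, inner ℝ (∇ q x) (∇ p x) =
    ∑ K ∈ B, ∫ x in K, inner ℝ (weakGrad K v x) (∇ p x)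
  bdry : ∑ K ∈ A, ∑ F ∈ T.outerFaces A K, ∫ x, q x ∂(surf F) =
    ∑ K ∈ A, ∑ F ∈ T.outerFaces A K, ∫ x, trace K F v x ∂(surf F)

open Classical in
/-- The projection characterized by `IsProj`. -/
def proj {Ω : Set (Pt d)} (T : Mesh Ω) (A B : Finset (Set (Pt d))) (v : Pt d → ℝ) : Pt d → ℝ :=
  if h : ∃ q, IsProj T A B v q then h.choose else 0

/-- `Π_K v`, with the constraint on `∂ω_K`. -/
def projK {Ω : Set (Pt d)} (T : Mesh Ω) (Λ : Set (Pt d) → Finset (Set (Pt d))) (K : Set (Pt d))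
    (v : Pt d → ℝ) : Pt d → ℝ := proj T (Λ K) {K} v

/-- `Π_{ω_K} v`, with the constraint on `∂ω_K`. -/
def projω {Ω : Set (Pt d)} (T : Mesh Ω) (Λ : Set (Pt d) → Finset (Set (Pt d))) (K : Set (Pt d))
    (v : Pt d → ℝ) : Pt d → ℝ := proj T (Λ K) (Λ K) v

/-- `h_{ω_K}`. -/
def hω (Λ : Set (Pt d) → Finset (Set (Pt d))) (K : Set (Pt d)) : ℝ := Metric.diam (patch (Λ K))

/-- The bilinear form `a_h`. -/
def ah {Ω : Set (Pt d)} (T : Mesh Ω) (Λ : Set (Pt d) → Finset (Set (Pt d)))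
    (w v : Pt d → ℝ) : ℝ :=
  ∑ K ∈ T.cells, ((∫ x in K, inner ℝ (∇ (projK T Λ K w) x) (∇ (projK T Λ K v) x)) +
    ∑ F ∈ T.faces K, (hω Λ K)⁻¹ *
      ∫ _x, faceAvg K F (w - projω T Λ K w) * faceAvg K F (v - projω T Λ K v) ∂(surf F))

/-- `u_h ∈ V_h` solves the discrete problem with data `f`. -/
def IsDiscreteSolution {Ω : Set (Pt d)} (T : Mesh Ω) (Λ : Set (Pt d) → Finset (Set (Pt d)))
    (f uh : Pt d → ℝ) : Prop :=
  MemSpace T uh ∧ ∀ v, MemSpace T v → ah T Λ uh v = ∑ K ∈ T.cells, ∫ x in K, f x * projK T Λ K v x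

/-- `u_I ∈ V_h` is the canonical interpolant of `u`: the face averages agree. -/
def IsInterpolant {Ω : Set (Pt d)} (T : Mesh Ω) (u uI : Pt d → ℝ) : Prop :=
  MemSpace T uI ∧ ∀ K ∈ T.cells, ∀ F ∈ T.faces K, faceAvg K F u = faceAvg K F uI

end VEM

end

noncomputable section

namespace VEM

variable {d : ℕ}

/-! ### Hyperplanes and half spaces -/

/-! Put `e = uh - uI`. The discrete equation gives the energy of `e` as the load tested with the
projections of `e`, minus `a_h(uI, e)`. The form sees its arguments only through their face
averages: by the Gauss formula the integral of a gradient over an element is determined by the face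
integrals of the trace, and the boundary constraint of the projections is a sum of face integrals.
Hence `uI` may be replaced by `u` (`ah_congr_left`), and no approximation property of the
interpolant is needed.

The face averages of `e` are single valued and vanish on the boundary, while the fluxes of `u` from
the two sides of a face cancel, so the sum of average times flux over all elements and faces is zero
(`Mesh.sum_faces_eq_zero`, `Mesh.integral_normalDeriv_add`). With this sum added, each element
contributes, besides the stabilization, the flux of `u - Q` against `Q_F e - W`, the gradient of `u
- Q` against that of `W - P`, and the load against `W - P` (`consistency_identity`). Here `Q` and
`W` are the patch projections of `u` and `e`, and `P` is the element projection of `e`.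

Young's inequality separates the `u` parts, which form the claimed bound, from the `e` parts, which
have to be controlled by the energy (`consistency_le`). On a face, `Q_F e - W` is a stabilization
term plus an oscillation of at most `diam F` times the gradient of `W`. The pyramids of the height
condition give that `diam F` times the area of `F` is at most a constant times the volume of the
patch (`IsotropicFace.diam_mul_area_le`), so the oscillation costs one patch energy, the volume of
the patch times the squared gradient of `W`. For the load, `W - P` has zero mean on the boundary of
the patch by the common normalization, and is bounded by the patch diameter times its gradient.

The gradient of `W` is the volume-weighted mean of the gradients of the element projections, so a
patch energy is at most the sum of the element energies (`patchEnergy_le`). Patches overlap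
boundedly (`AssumptionD.card_overlap_le`): a patch is connected through faces, has at most `M`
elements, and an element has at most `N` neighbours, so all patches containing an element are
centred in its ball of face distance `M`. A suitable Young parameter then absorbs half of the
energy.

Two analytic facts carry this for nonconvex polytopes. The Gauss formula
(`IsPolytopeWith.integral_weakGrad`) holds near open faces by reduction to a half space, and extends
over the lower dimensional boundary because sets of codimension two have zero capacity: a cut-off at
distance `ε` has gradient of order `1/ε` on a volume of order `ε²`. The connection through faces
(`Mesh.exists_shared_face`) holds because such sets do not disconnect a ball. -/

/-- The hyperplane through `x₀` with normal `n`. -/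
def hyper (x₀ n : Pt d) : Set (Pt d) := {y | inner ℝ (y - x₀) n = 0}

/-- The linear isometry between `n^⊥ × ℝ` and the whole space, for a unit vector `n`. -/
def splitIsometry (n : Pt d) (hn : ‖n‖ = 1) : WithLp 2 ((ℝ ∙ n)ᗮ × ℝ) →ₗᵢ[ℝ] Pt d where
  toFun p := (p.fst : Pt d) + p.snd • n
  map_add' p q := by simp [add_smul]; abel
  map_smul' c p := by simp [mul_smul]
  norm_map' p := by
    have h0 : inner ℝ (p.fst : Pt d) n = 0 := by
      have := p.fst.2 n (Submodule.mem_span_singleton_self n)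
      rwa [real_inner_comm] at this
    have h1 : ‖(p.fst : Pt d) + p.snd • n‖ ^ 2 = ‖p.fst‖ ^ 2 + ‖p.snd‖ ^ 2 := by
      rw [norm_add_sq_real, inner_smul_right, h0, norm_smul, hn]; simp
    have h2 := WithLp.prod_norm_sq_eq_of_L2 p
    rw [← h2] at h1
    exact (sq_eq_sq₀ (norm_nonneg _) (norm_nonneg _)).1 h1

lemma finrank_orth (n : Pt d) (hn : ‖n‖ = 1) : Module.finrank ℝ (ℝ ∙ n)ᗮ = d - 1 := by
  have h0 : n ≠ 0 := by rintro rfl; simp at hn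
  have h1 := Submodule.finrank_add_finrank_orthogonal (ℝ ∙ n)
  rw [finrank_span_singleton h0, finrank_euclideanSpace_fin] at h1
  omega

lemma splitIsometry_surjective (n : Pt d) (hn : ‖n‖ = 1) :
    Function.Surjective (splitIsometry n hn) := by
  intro x
  have hx : x - (inner ℝ n x : ℝ) • n ∈ (ℝ ∙ n)ᗮ := by
    rw [Submodule.mem_orthogonal_singleton_iff_inner_right, inner_sub_right, inner_smul_right,
      real_inner_self_eq_norm_sq, hn]
    ring
  refine ⟨WithLp.toLp 2 (⟨_, hx⟩, inner ℝ n x), ?_⟩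
  simp [splitIsometry]

/-- Coordinates `n^⊥ × ℝ` around `x₀`. -/
def chart (x₀ n : Pt d) (p : (ℝ ∙ n)ᗮ × ℝ) : Pt d := x₀ + ((p.1 : Pt d) + p.2 • n)

lemma measurePreserving_chart (x₀ n : Pt d) (hn : ‖n‖ = 1) :
    MeasurePreserving (chart x₀ n) (volume.prod volume) volume := by
  have h1 := WithLp.volume_preserving_toLp ((ℝ ∙ n)ᗮ) ℝ
  have h2 := (LinearIsometryEquiv.ofSurjective (splitIsometry n hn)
    (splitIsometry_surjective n hn)).measurePreserving
  have h3 := measurePreserving_add_left (volume : Measure (Pt d)) x₀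
  exact (h3.comp (h2.comp h1))

lemma continuous_chart (x₀ n : Pt d) : Continuous (chart x₀ n) := by
  unfold chart; fun_prop

lemma inner_chart (x₀ n : Pt d) (hn : ‖n‖ = 1) (p : (ℝ ∙ n)ᗮ × ℝ) :
    inner ℝ (chart x₀ n p - x₀) n = p.2 := by
  have h0 : inner ℝ (p.1 : Pt d) n = 0 := by
    have := p.1.2 n (Submodule.mem_span_singleton_self n)
    rwa [real_inner_comm] at this
  simp [chart, inner_add_left, inner_smul_left, h0, hn]

lemma chart_injective (x₀ n : Pt d) (hn : ‖n‖ = 1) : Function.Injective (chart x₀ n) := by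
  intro p q h
  have h2 : p.2 = q.2 := by rw [← inner_chart x₀ n hn p, h, inner_chart x₀ n hn]
  refine Prod.ext (Subtype.ext ?_) h2
  simp only [chart, h2, add_right_inj, add_left_inj] at h
  exact h

lemma measurableEmbedding_chart (x₀ n : Pt d) (hn : ‖n‖ = 1) :
    MeasurableEmbedding (chart x₀ n) :=
  (continuous_chart x₀ n).measurableEmbedding (chart_injective x₀ n hn)

lemma isClosedEmbedding_chart (x₀ n : Pt d) (hn : ‖n‖ = 1) :
    IsClosedEmbedding (chart x₀ n) := by
  have h2 := (splitIsometry n hn).isometry.isClosedEmbedding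
  have h3 := (Homeomorph.addLeft x₀).isClosedEmbedding
  exact h3.comp (h2.comp (WithLp.homeomorphProd 2 _ _).symm.isClosedEmbedding)

lemma chart_surjective (x₀ n : Pt d) (hn : ‖n‖ = 1) : Function.Surjective (chart x₀ n) := by
  intro x
  obtain ⟨p, hp⟩ := splitIsometry_surjective n hn (x - x₀)
  refine ⟨(p.fst, p.snd), ?_⟩
  have : (p.fst : Pt d) + p.snd • n = x - x₀ := hp
  simp [chart, this]

/-- The isometric parametrization of the hyperplane. -/
def planeChart (x₀ n : Pt d) (y : (ℝ ∙ n)ᗮ) : Pt d := x₀ + (y : Pt d)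

lemma isometry_planeChart (x₀ n : Pt d) : Isometry (planeChart x₀ n) := by
  refine Isometry.of_dist_eq fun y z => ?_
  simp [planeChart, dist_eq_norm]

lemma range_planeChart (x₀ n : Pt d) : Set.range (planeChart x₀ n) = hyper x₀ n := by
  ext y
  simp only [Set.mem_range, hyper, Set.mem_ofPred_eq, planeChart]
  constructor
  · rintro ⟨z, rfl⟩
    have := z.2 n (Submodule.mem_span_singleton_self n)
    rw [real_inner_comm] at this
    simpa using this
  · intro h
    refine ⟨⟨y - x₀, ?_⟩, by simp⟩
    rw [Submodule.mem_orthogonal_singleton_iff_inner_left]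
    exact h

/-- The Euclidean Hausdorff measure is invariant under isometries and agrees with volume on an inner
product space of its own dimension. Surface integrals over flat faces thus become Lebesgue integrals
on `n^⊥`. -/
lemma measurePreserving_planeChart (x₀ n : Pt d) (hn : ‖n‖ = 1) :
    MeasurePreserving (planeChart x₀ n) volume (surf (hyper x₀ n)) := by
  refine ⟨(isometry_planeChart x₀ n).continuous.measurable, ?_⟩
  have h := (isometry_planeChart x₀ n).map_euclideanHausdorffMeasure (d := d - 1)
  rw [range_planeChart] at h
  rw [surf, ← h, ← finrank_orth n hn, InnerProductSpace.euclideanHausdorffMeasure_eq_volume]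

lemma measurableEmbedding_planeChart (x₀ n : Pt d) : MeasurableEmbedding (planeChart x₀ n) :=
  (isometry_planeChart x₀ n).isClosedEmbedding.measurableEmbedding

lemma chart_zero (x₀ n : Pt d) (y : (ℝ ∙ n)ᗮ) : chart x₀ n (y, 0) = planeChart x₀ n y := by
  simp [chart, planeChart]

lemma inner_gradient (φ : Pt d → ℝ) (x a : Pt d) : inner ℝ (∇ φ x) a = fderiv ℝ φ x a := by
  rw [gradient, InnerProductSpace.toDual_symm_apply]

lemma hasCompactSupport_comp_chart {x₀ n : Pt d} (hn : ‖n‖ = 1) {φ : Pt d → ℝ}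
    (hc : HasCompactSupport φ) : HasCompactSupport (φ ∘ chart x₀ n) :=
  hc.comp_isClosedEmbedding (isClosedEmbedding_chart x₀ n hn)

/-- The divergence theorem on a half space, for a constant direction. -/
lemma integral_halfSpace_gradient (x₀ n a : Pt d) (hn : ‖n‖ = 1) {φ : Pt d → ℝ}
    (hφ : ContDiff ℝ ∞ φ) (hc : HasCompactSupport φ) :
    ∫ x in {x | inner ℝ (x - x₀) n < 0}, inner ℝ (∇ φ x) a =
      inner ℝ a n * ∫ x, φ x ∂(surf (hyper x₀ n)) := by
  set U := (ℝ ∙ n)ᗮ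
  have hφ1 : ContDiff ℝ 1 φ := hφ.of_le (by exact_mod_cast le_top)
  have hD : Differentiable ℝ φ := hφ1.differentiable one_ne_zero
  have hpre : chart x₀ n ⁻¹' {x | inner ℝ (x - x₀) n < 0} = Set.univ ×ˢ Set.Iio (0 : ℝ) := by
    ext p; simp [inner_chart x₀ n hn]
  have hcd : Continuous (fun x => fderiv ℝ φ x) := hφ1.continuous_fderiv one_ne_zero
  have hInt : ∀ v : Pt d, Integrable (fun p : U × ℝ => fderiv ℝ φ (chart x₀ n p) v)
      (volume.prod volume) := by
    intro v
    refine Continuous.integrable_of_hasCompactSupport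
      ((hcd.comp (continuous_chart x₀ n)).clm_apply continuous_const) ?_
    exact hasCompactSupport_comp_chart (φ := fun x => fderiv ℝ φ x v) hn (hc.fderiv_apply ℝ v)
  have hInt' : ∀ v : Pt d, Integrable (fun p : U × ℝ => fderiv ℝ φ (chart x₀ n p) v)
      (volume.prod (volume.restrict (Set.Iio 0))) := by
    intro v
    have := (hInt v).restrict (s := Set.univ ×ˢ Set.Iio (0 : ℝ))
    rwa [← Measure.prod_restrict, Measure.restrict_univ] at this
  simp_rw [inner_gradient]
  rw [← (measurePreserving_chart x₀ n hn).setIntegral_preimage_emb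
    (measurableEmbedding_chart x₀ n hn), hpre, ← Measure.prod_restrict, Measure.restrict_univ]
  rw [← (measurePreserving_planeChart x₀ n hn).integral_comp (measurableEmbedding_planeChart x₀ n)]
  -- tangential directions do not contribute
  have htan : ∀ v : U, ∫ p, fderiv ℝ φ (chart x₀ n p) (v : Pt d)
      ∂((volume : Measure U).prod ((volume : Measure ℝ).restrict (Set.Iio 0))) = 0 := by
    intro v
    rw [integral_prod_symm _ (hInt' v)]
    refine integral_eq_zero_of_ae (Eventually.of_forall fun s => ?_)
    have hg : ∀ y : U, HasFDerivAt (fun y : U => φ (chart x₀ n (y, s)))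
        ((fderiv ℝ φ (chart x₀ n (y, s))).comp U.subtypeL) y := by
      intro y
      refine ((hD _).hasFDerivAt).comp y ?_
      have : HasFDerivAt (fun y : U => x₀ + ((U.subtypeL y : Pt d) + s • n)) U.subtypeL y :=
        (U.subtypeL.hasFDerivAt.add_const _).const_add _
      exact this
    have hcs : HasCompactSupport (fun y : U => φ (chart x₀ n (y, s))) := by
      refine hc.comp_isClosedEmbedding (f := φ) (g := fun y : U => chart x₀ n (y, s)) ?_
      have : (fun y : U => chart x₀ n (y, s)) = planeChart (x₀ + s • n) n := by
        ext1 y; simp only [chart, planeChart]; abel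
      rw [this]
      exact (isometry_planeChart _ n).isClosedEmbedding
    have hfd : ∀ y : U, fderiv ℝ (fun y : U => φ (chart x₀ n (y, s))) y v =
        fderiv ℝ φ (chart x₀ n (y, s)) v := fun y => by rw [(hg y).fderiv]; rfl
    have hcont : Continuous (fun y : U => φ (chart x₀ n (y, s))) :=
      hφ.continuous.comp ((continuous_chart x₀ n).comp (by fun_prop))
    -- Integration by parts against the constant `1`: a directional derivative of a compactly
    -- supported function on `n^⊥` integrates to zero.
    have key := integral_mul_fderiv_eq_neg_fderiv_mul_of_integrable (μ := (volume : Measure U))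
      (f := fun _ => (1 : ℝ)) (g := fun y : U => φ (chart x₀ n (y, s))) (v := v)
      (by simp) ?_ (by simpa using hcont.integrable_of_hasCompactSupport hcs)
      (fun x _ => by fun_prop) (fun x _ => (hg x).differentiableAt)
    · simpa [hfd] using key
    · simp only [one_mul, hfd]
      refine Continuous.integrable_of_hasCompactSupport ?_ ?_
      · exact ((hcd.comp ((continuous_chart x₀ n).comp (by fun_prop))).clm_apply continuous_const)
      · have := hcs.fderiv_apply (𝕜 := ℝ) v
        simpa only [hfd] using this
  have hnor : ∫ p, fderiv ℝ φ (chart x₀ n p) n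
      ∂((volume : Measure U).prod ((volume : Measure ℝ).restrict (Set.Iio 0))) =
      ∫ y, φ (planeChart x₀ n y) := by
    rw [integral_prod _ (hInt' n)]
    refine integral_congr_ae (Eventually.of_forall fun y => ?_)
    have hg : ∀ s : ℝ, HasDerivAt (fun s : ℝ => φ (chart x₀ n (y, s)))
        (fderiv ℝ φ (chart x₀ n (y, s)) n) s := by
      intro s
      have h1 : HasDerivAt (fun s : ℝ => chart x₀ n (y, s)) n s := by
        have := (((hasDerivAt_id s).smul_const n).const_add (y : Pt d)).const_add x₀
        simpa [chart] using this
      exact ((hD _).hasFDerivAt).comp_hasDerivAt s h1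
    have hcs : HasCompactSupport (fun s : ℝ => φ (chart x₀ n (y, s))) := by
      refine (hasCompactSupport_comp_chart hn hc).comp_isClosedEmbedding
        (g := fun s : ℝ => (y, s)) ?_
      refine Isometry.isClosedEmbedding (Isometry.of_dist_eq fun s t => ?_)
      simp [Prod.dist_eq]
    have hC1 : ContDiff ℝ 1 (fun s : ℝ => φ (chart x₀ n (y, s))) := by
      refine hφ1.comp ?_
      change ContDiff ℝ 1 (fun s : ℝ => x₀ + ((y : Pt d) + s • n))
      fun_prop
    -- Along a normal line the fundamental theorem of calculus leaves only the value at the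
    -- hyperplane.
    have := hcs.integral_Iic_deriv_eq hC1 0
    rw [integral_Iic_eq_integral_Iio] at this
    simp only [(hg _).deriv] at this
    simp only [← chart_zero]; exact this
  have ha : ∃ v : U, a = v + (inner ℝ a n : ℝ) • n := by
    obtain ⟨p, hp⟩ := splitIsometry_surjective n hn a
    have hp' : (p.fst : Pt d) + p.snd • n = a := hp
    refine ⟨p.fst, ?_⟩
    have h0 : inner ℝ (p.fst : Pt d) n = 0 := by
      have := p.fst.2 n (Submodule.mem_span_singleton_self n)
      rwa [real_inner_comm] at this
    have : inner ℝ a n = p.snd := by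
      rw [← hp', inner_add_left, inner_smul_left, h0, real_inner_self_eq_norm_sq, hn]; simp
    rw [this, hp']
  obtain ⟨v, hv⟩ := ha
  have : ∀ p : U × ℝ, fderiv ℝ φ (chart x₀ n p) a = fderiv ℝ φ (chart x₀ n p) (v : Pt d) +
      inner ℝ a n * fderiv ℝ φ (chart x₀ n p) n := by
    intro p
    conv_lhs => rw [hv]
    simp
  simp_rw [this]
  rw [integral_add (hInt' _) ((hInt' _).const_mul _), htan, integral_const_mul, hnor, zero_add]

/-! ### Faces and their area -/

lemma isClosed_hyper (x₀ n : Pt d) : IsClosed (hyper x₀ n) := by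
  rw [← range_planeChart]; exact (isometry_planeChart x₀ n).isClosedEmbedding.isClosed_range

lemma IsFlatFace.subset_hyper {F : Set (Pt d)} {ν : Pt d} (h : IsFlatFace F ν) {x : Pt d}
    (hx : x ∈ F) : F ⊆ hyper x ν := fun y hy => h.flat x hx y hy

/-- A face is the intersection of its closed hyperplane with a union of balls, by relative openness.
-/
lemma IsFlatFace.measurableSet {F : Set (Pt d)} {ν : Pt d} (h : IsFlatFace F ν) :
    MeasurableSet F := by
  obtain ⟨x, hx⟩ := h.connected.nonempty
  choose! r hr0 hr using h.relOpen
  have : F = hyper x ν ∩ ⋃ y ∈ F, Metric.ball y (r y) := by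
    ext z
    constructor
    · intro hz
      exact ⟨h.subset_hyper hx hz, Set.mem_biUnion hz (Metric.mem_ball_self (hr0 z hz))⟩
    · rintro ⟨hz, hz'⟩
      obtain ⟨y, hy, hzy⟩ := Set.mem_iUnion₂.1 hz'
      refine hr y hy z hzy ?_
      have h1 := h.flat x hx y hy
      have h2 : inner ℝ (z - x) ν = 0 := hz
      have : z - y = (z - x) - (y - x) := by abel
      rw [this, inner_sub_left, h1, h2, sub_zero]
  rw [this]
  exact (isClosed_hyper x ν).measurableSet.inter
    (isOpen_biUnion fun _ _ => Metric.isOpen_ball).measurableSet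

lemma surf_eq_restrict {F : Set (Pt d)} {x n : Pt d} (hF : MeasurableSet F)
    (h : F ⊆ hyper x n) : surf F = (surf (hyper x n)).restrict F := by
  rw [surf, surf, Measure.restrict_restrict hF, Set.inter_eq_left.2 h]

lemma surf_hyper_apply {x n : Pt d} (hn : ‖n‖ = 1) (s : Set (Pt d)) :
    surf (hyper x n) s = volume (planeChart x n ⁻¹' s) :=
  ((measurePreserving_planeChart x n hn).measure_preimage_emb
    (measurableEmbedding_planeChart x n) s).symm

lemma surf_univ {F : Set (Pt d)} {x n : Pt d} (hn : ‖n‖ = 1) (hF : MeasurableSet F)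
    (h : F ⊆ hyper x n) : surf F Set.univ = volume (planeChart x n ⁻¹' F) := by
  rw [surf_eq_restrict hF h, Measure.restrict_apply_univ, surf_hyper_apply hn]

lemma IsFlatFace.isFiniteMeasure {F : Set (Pt d)} {ν : Pt d} (h : IsFlatFace F ν) :
    IsFiniteMeasure (surf F) := by
  obtain ⟨x, hx⟩ := h.connected.nonempty
  refine ⟨?_⟩
  rw [surf_univ h.unit h.measurableSet (h.subset_hyper hx)]
  exact ((isometry_planeChart x ν).antilipschitz.isBounded_preimage h.bounded).measure_lt_top

lemma IsFlatFace.surf_pos {F : Set (Pt d)} {ν : Pt d} (h : IsFlatFace F ν) :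
    0 < (surf F).real Set.univ := by
  have := h.isFiniteMeasure
  obtain ⟨x, hx⟩ := h.connected.nonempty
  rw [measureReal_def, ENNReal.toReal_pos_iff]
  refine ⟨?_, measure_lt_top _ _⟩
  rw [surf_univ h.unit h.measurableSet (h.subset_hyper hx)]
  obtain ⟨r, hr, hb⟩ := h.relOpen x hx
  refine lt_of_lt_of_le (Metric.measure_ball_pos volume (0 : (ℝ ∙ ν)ᗮ) hr) (measure_mono ?_)
  intro y hy
  refine hb _ ?_ ?_
  · simpa [planeChart] using hy
  · have : planeChart x ν y ∈ hyper x ν := by rw [← range_planeChart]; exact ⟨y, rfl⟩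
    exact this

lemma IsFlatFace.ae_mem {F : Set (Pt d)} {ν : Pt d} (h : IsFlatFace F ν) :
    ∀ᵐ x ∂(surf F), x ∈ F := ae_restrict_mem h.measurableSet

/-- Affine subspaces of codimension two have no area. -/
lemma surf_hyper_affineSubspace {x n : Pt d} (hn : ‖n‖ = 1) {a : AffineSubspace ℝ (Pt d)}
    (ha : Module.finrank ℝ a.direction + 2 ≤ d) : surf (hyper x n) a = 0 := by
  rw [surf_hyper_apply hn]
  let f : (ℝ ∙ n)ᗮ →ᵃ[ℝ] Pt d :=
    (AffineMap.const ℝ _ x) + (ℝ ∙ n)ᗮ.subtype.toAffineMap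
  have : planeChart x n ⁻¹' (a : Set (Pt d)) = (a.comap f : Set _) := by
    ext y; simp [f, planeChart]
  rw [this]
  -- The pullback to `n^⊥` is a proper subspace: otherwise the direction of `a` would contain `n^⊥`,
  -- which has dimension `d - 1`.
  refine Measure.addHaar_affineSubspace _ _ fun htop => ?_
  have hmem : ∀ y : (ℝ ∙ n)ᗮ, x + (y : Pt d) ∈ a := by
    intro y
    have : y ∈ a.comap f := by rw [htop]; trivial
    simpa [f] using this
  have hle : (ℝ ∙ n)ᗮ ≤ a.direction := by
    intro y hy
    have := AffineSubspace.vsub_mem_direction (hmem ⟨y, hy⟩) (hmem 0)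
    simpa using this
  have := Submodule.finrank_mono hle
  rw [finrank_orth n hn] at this
  omega

lemma IsFlatFace.surf_affineSubspace {F : Set (Pt d)} {ν : Pt d} (h : IsFlatFace F ν)
    {a : AffineSubspace ℝ (Pt d)} (ha : Module.finrank ℝ a.direction + 2 ≤ d) :
    surf F a = 0 := by
  obtain ⟨x, hx⟩ := h.connected.nonempty
  rw [surf_eq_restrict h.measurableSet (h.subset_hyper hx)]
  exact Measure.absolutelyContinuous_of_le Measure.restrict_le_self
    (surf_hyper_affineSubspace h.unit ha)

lemma volume_hyper {x n : Pt d} (hn : ‖n‖ = 1) : volume (hyper x n) = 0 := by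
  rw [← (measurePreserving_chart x n hn).measure_preimage_emb (measurableEmbedding_chart x n hn)]
  have : chart x n ⁻¹' hyper x n = Set.univ ×ˢ {(0 : ℝ)} := by
    ext p; simp [hyper, inner_chart x n hn]
  rw [this, Measure.prod_prod]; simp

lemma IsFlatFace.volume_closure {F : Set (Pt d)} {ν : Pt d} (h : IsFlatFace F ν) :
    volume (closure F) = 0 := by
  obtain ⟨x, hx⟩ := h.connected.nonempty
  exact measure_mono_null (closure_minimal (h.subset_hyper hx) (isClosed_hyper x ν))
    (volume_hyper h.unit)

lemma IsPolytopeWith.volume_frontier {K : Set (Pt d)} {S : Finset (Set (Pt d))}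
    {n : Set (Pt d) → Pt d} (h : IsPolytopeWith K S n) : volume (frontier K) = 0 := by
  rw [h.frontier_eq]
  exact (measure_biUnion_null_iff S.countable_toSet).2 fun F hF => (h.flatFace F hF).volume_closure

lemma IsPolytopeWith.volume_closure {K : Set (Pt d)} {S : Finset (Set (Pt d))}
    {n : Set (Pt d) → Pt d} (h : IsPolytopeWith K S n) : volume (closure K) = volume K := by
  refine le_antisymm ?_ (measure_mono subset_closure)
  rw [closure_eq_self_union_frontier]
  exact (measure_union_le _ _).trans (by rw [h.volume_frontier, add_zero])

/-! ### Pyramids, and the bound of face areas by volumes -/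

/-- The volume of a pyramid is bounded below by height times base area. -/
lemma volume_pyramid_ge {β : Set (Pt d)} {x n a : Pt d} {H : ℝ} (hn : ‖n‖ = 1)
    (hβ : MeasurableSet β) (hH : 0 < H)
    (ha : inner ℝ (a - x) n = H) :
    ENNReal.ofReal (H / 2 * (1 / 2) ^ (d - 1)) * surf (hyper x n) β ≤ volume (pyramid β a) := by
  rw [surf_hyper_apply hn, ← (measurePreserving_chart x n hn).measure_preimage_emb
    (measurableEmbedding_chart x n hn)]
  obtain ⟨⟨a', H'⟩, rfl⟩ := chart_surjective x n hn a
  rw [inner_chart x n hn] at ha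
  simp only at ha
  subst ha
  set β' := planeChart x n ⁻¹' β with hβ'
  have hβ'm : MeasurableSet β' := (measurableEmbedding_planeChart x n).measurable hβ
  -- In chart coordinates, `S` is the part of the pyramid below half its height. The slice at height
  -- `s` is the image of the base under the homothety towards the apex with parameter `s / H'`.
  let S : Set ((ℝ ∙ n)ᗮ × ℝ) := Prod.snd ⁻¹' Set.Ioo 0 (H' / 2) ∩
    (fun p : (ℝ ∙ n)ᗮ × ℝ => (1 - p.2 / H')⁻¹ • (p.1 - (p.2 / H') • a')) ⁻¹' β'
  have hS : MeasurableSet S := by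
    have hmeas : Measurable
        (fun p : (ℝ ∙ n)ᗮ × ℝ => (1 - p.2 / H')⁻¹ • (p.1 - (p.2 / H') • a')) := by fun_prop
    exact MeasurableSet.inter (measurable_snd measurableSet_Ioo) (hmeas hβ'm)
  have hsub : S ⊆ chart x n ⁻¹' pyramid β (chart x n (a', H')) := by
    rintro ⟨z, s⟩ ⟨hs, hz⟩
    simp only [Set.mem_preimage] at hs hz
    have ht1 : s / H' < 1 / 2 := by
      rw [div_lt_iff₀ hH]; linarith [hs.2]
    have ht0 : 0 < s / H' := div_pos hs.1 hH
    refine ⟨_, hz, s / H', ⟨ht0, by linarith⟩, ?_⟩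
    have hne : (1 - s / H') ≠ 0 := by linarith
    simp only [chart, planeChart, Submodule.coe_smul, Submodule.coe_sub, smul_add, smul_smul,
      mul_inv_cancel₀ hne, one_smul, div_mul_cancel₀ s hH.ne']
    rw [sub_smul, one_smul]; abel
  refine le_trans ?_ (measure_mono hsub)
  rw [Measure.prod_apply_symm hS]
  have hslice : ∀ s ∈ Set.Ioo 0 (H' / 2), ENNReal.ofReal ((1 / 2) ^ (d - 1)) * volume β' ≤
      volume ((fun z => (z, s)) ⁻¹' S) := by
    intro s hs
    have ht1 : s / H' < 1 / 2 := by
      rw [div_lt_iff₀ hH]; linarith [hs.2]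
    have ht0 : 0 < s / H' := div_pos hs.1 hH
    have : (fun z : (ℝ ∙ n)ᗮ => (z, s)) ⁻¹' S =
        (fun z => z + (-((s / H') • a'))) ⁻¹' ((fun z => (1 - s / H')⁻¹ • z) ⁻¹' β') := by
      ext z; simp only [S, Set.mem_preimage, Set.mem_inter_iff, hs, true_and, sub_eq_add_neg]
    -- The slice is a translate of the base scaled by `1 - s / H'`, which is at least `1/2` in the
    -- lower half; this is the origin of the factor `(1/2) ^ (d - 1)`.
    rw [this, measure_preimage_add_right, Measure.addHaar_preimage_smul _ (by
      apply inv_ne_zero; linarith), finrank_orth n hn]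
    gcongr
    rw [abs_of_pos (by apply inv_pos.2; apply pow_pos; apply inv_pos.2; linarith), inv_pow, inv_inv]
    gcongr
    linarith
  calc ENNReal.ofReal (H' / 2 * (1 / 2) ^ (d - 1)) * volume β'
      = ∫⁻ s in Set.Ioo 0 (H' / 2), ENNReal.ofReal ((1 / 2) ^ (d - 1)) * volume β' := by
        rw [setLIntegral_const, Real.volume_Ioo, sub_zero, ENNReal.ofReal_mul (by positivity)]
        ring
    _ ≤ ∫⁻ s in Set.Ioo 0 (H' / 2), volume ((fun z => (z, s)) ⁻¹' S) :=
        setLIntegral_mono' measurableSet_Ioo hslice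
    _ ≤ _ := setLIntegral_le_lintegral _ _

/-- An inscribed pyramid has its apex above the closure of its base. -/
lemma IsInscribed.infDist_le {D β : Set (Pt d)} {x n m a : Pt d} (hn : ‖n‖ = 1)
    (hβx : β ⊆ hyper x n) (hβ : β.Nonempty) (hm : m = n ∨ m = -n)
    (h : IsInscribed D β m a) : Metric.infDist a β ≤ |inner ℝ (a - x) n| := by
  obtain ⟨y, hy⟩ := hβ
  -- Points of the pyramid lie in the prism, hence straight above a point of the base, and their
  -- distance to the base is at most their height. Letting `t → 1` transfers this to the apex, so a
  -- lower bound on the distance of the apex to the base is one on the perpendicular height.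
  have key : ∀ t ∈ Set.Ioo (0 : ℝ) 1,
      Metric.infDist ((1 - t) • y + t • a) β ≤ t * |inner ℝ (a - x) n| := by
    intro t ht
    obtain ⟨-, x', hx', τ, hτ, he⟩ := h ⟨y, hy, t, ht, rfl⟩
    refine (Metric.infDist_le_dist_of_mem hx').trans ?_
    have h1 : inner ℝ ((1 - t) • y + t • a - x) n = t * inner ℝ (a - x) n := by
      have : (1 - t) • y + t • a - x = (1 - t) • (y - x) + t • (a - x) := by module
      have h0 : inner ℝ (y - x) n = 0 := hβx hy
      rw [this, inner_add_left, inner_smul_left, inner_smul_left, h0]; simp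
    have h2 : inner ℝ ((1 - t) • y + t • a - x) n = τ * inner ℝ m n := by
      have : (1 - t) • y + t • a - x = (x' - x) + τ • m := by rw [he]; abel
      have h0 : inner ℝ (x' - x) n = 0 := hβx hx'
      rw [this, inner_add_left, inner_smul_left, h0]; simp
    have hm1 : |inner ℝ m n| = 1 := by
      rcases hm with rfl | rfl <;> simp [hn]
    have hmn : ‖m‖ = 1 := by rcases hm with rfl | rfl <;> simp [hn]
    have : t * |inner ℝ (a - x) n| = |τ| := by
      rw [← abs_of_pos ht.1, ← abs_mul, ← h1, h2, abs_mul, hm1, mul_one]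
    rw [this, he, dist_eq_norm]
    simp [norm_smul, hmn]
  have hc : Tendsto (fun t : ℝ => Metric.infDist ((1 - t) • y + t • a) β) (𝓝[<] 1)
      (𝓝 (Metric.infDist a β)) := by
    have : Continuous (fun t : ℝ => Metric.infDist ((1 - t) • y + t • a) β) :=
      (Metric.continuous_infDist_pt β).comp (by fun_prop)
    have h1 := (this.tendsto 1).mono_left (nhdsWithin_le_nhds (s := Set.Iio 1))
    simpa using h1
  refine le_of_tendsto hc ?_
  filter_upwards [Ioo_mem_nhdsLT (zero_lt_one' ℝ)] with t ht
  refine (key t ht).trans ?_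
  exact mul_le_of_le_one_left (abs_nonneg _) ht.2.le

/-- The area of a face times its diameter is controlled by the volume of the set toward which it
satisfies the height condition. -/
lemma IsotropicFace.diam_mul_area_le {b : ℕ} {γ₁ κ : ℝ} (hγ₁ : 0 < γ₁) {D F : Set (Pt d)}
    {n m : Pt d} (hF : IsFlatFace F n) (hm : m = n ∨ m = -n)
    (h : IsotropicFace b γ₁ κ D F m) (hD : volume D ≠ ⊤) :
    Metric.diam F * (surf F).real Set.univ ≤ (2 ^ d * b / γ₁) * volume.real D := by
  classical
  obtain ⟨P, hPb, hP, hβ⟩ := h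
  have := hF.isFiniteMeasure
  obtain ⟨x, hx⟩ := hF.connected.nonempty
  have hFm := hF.measurableSet
  have hFx := hF.subset_hyper hx
  have hd : 0 < d := by
    rcases Nat.eq_zero_or_pos d with rfl | h
    · have := hF.unit; rw [Subsingleton.elim n 0] at this; simp at this
    · exact h
  have piece : ∀ β ∈ P, Metric.diam F * (surf F).real β ≤ (2 ^ d / γ₁) * volume.real D := by
    intro β hβP
    -- The hourglass condition supplies an actual pyramid of the required height; the supremum in
    -- `localHeight` need not be attained.
    obtain ⟨a, hins, hdist, -⟩ := (hβ β hβP).2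
    have hβF := hP.subset β hβP
    have hβm := hP.measurable β hβP
    rcases β.eq_empty_or_nonempty with rfl | hne
    · simp; positivity
    rcases eq_or_lt_of_le (Metric.diam_nonneg (s := F)) with h0 | h0
    · rw [← h0]; simp; positivity
    have hsβ : surf F β = surf (hyper x n) β := by
      rw [surf_eq_restrict hFm hFx, Measure.restrict_apply hβm, Set.inter_eq_left.2 hβF]
    have hle := hins.infDist_le hF.unit (hβF.trans hFx) hne hm
    set H := |inner ℝ (a - x) n| with hHdef
    have hH : γ₁ * Metric.diam F ≤ H := hdist.trans hle
    have hHpos : 0 < H := lt_of_lt_of_le (mul_pos hγ₁ h0) hH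
    have hpyr : pyramid β a ⊆ D := fun y hy => (hins hy).1
    have hvol : ENNReal.ofReal (H / 2 * (1 / 2) ^ (d - 1)) * surf (hyper x n) β ≤ volume D := by
      refine le_trans ?_ (measure_mono hpyr)
      rcases le_total 0 (inner ℝ (a - x) n) with hs | hs
      · exact volume_pyramid_ge hF.unit hβm hHpos
          (by rw [hHdef, abs_of_nonneg hs])
      -- If the apex is on the negative side, the normal is reversed, which does not change the
      -- hyperplane.
      · have hh : hyper x (-n) = hyper x n := by ext y; simp [hyper]
        have := volume_pyramid_ge (x := x) (n := -n) (a := a) (H := H) (β := β)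
          (by rw [norm_neg]; exact hF.unit) hβm
          hHpos (by rw [hHdef, abs_of_nonpos hs, inner_neg_right])
        rwa [hh] at this
    rw [← hsβ] at hvol
    have h2 := ENNReal.toReal_mono hD hvol
    rw [ENNReal.toReal_mul, ENNReal.toReal_ofReal (by positivity)] at h2
    have h3 : H / 2 * (1 / 2) ^ (d - 1) = H / 2 ^ d := by
      obtain ⟨k, rfl⟩ : ∃ k, d = k + 1 := ⟨d - 1, by omega⟩
      simp [pow_succ]; field_simp
    rw [h3] at h2
    have h4 : γ₁ * Metric.diam F / 2 ^ d * (surf F).real β ≤ volume.real D := by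
      refine le_trans ?_ h2
      exact mul_le_mul_of_nonneg_right (by gcongr) ENNReal.toReal_nonneg
    have h5 : Metric.diam F * (surf F).real β =
        (2 ^ d / γ₁) * (γ₁ * Metric.diam F / 2 ^ d * (surf F).real β) := by
      field_simp
    rw [h5]
    exact mul_le_mul_of_nonneg_left h4 (by positivity)
  have hcov : (surf F).real Set.univ ≤ ∑ β ∈ P, (surf F).real β := by
    have h1 : (surf F) Set.univ ≤ (surf F) (⋃ β ∈ P, β) := by
      rw [← Set.union_compl_self (⋃ β ∈ P, β)]
      exact (measure_union_le _ _).trans (by rw [hP.cover, add_zero])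
    have h2 : (surf F).real Set.univ ≤ (surf F).real (⋃ β ∈ P, β) :=
      ENNReal.toReal_mono (measure_ne_top _ _) h1
    exact h2.trans (measureReal_biUnion_finset_le P _)
  calc Metric.diam F * (surf F).real Set.univ
      ≤ Metric.diam F * ∑ β ∈ P, (surf F).real β := by gcongr
    _ = ∑ β ∈ P, Metric.diam F * (surf F).real β := Finset.mul_sum _ _ _
    _ ≤ ∑ β ∈ P, (2 ^ d / γ₁) * volume.real D := Finset.sum_le_sum piece
    _ = P.card * ((2 ^ d / γ₁) * volume.real D) := by simp
    _ ≤ b * ((2 ^ d / γ₁) * volume.real D) := by gcongr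
    _ = _ := by ring

/-! ### Sobolev functions -/

lemma continuous_gradient {φ : Pt d → ℝ} (hφ : ContDiff ℝ ∞ φ) : Continuous (∇ φ) :=
  (InnerProductSpace.toDual ℝ (Pt d)).symm.continuous.comp
    (hφ.continuous_fderiv (by simp))

lemma gradient_sub' {φ ψ : Pt d → ℝ} (hφ : ContDiff ℝ ∞ φ) (hψ : ContDiff ℝ ∞ ψ) (x : Pt d) :
    ∇ (φ - ψ) x = ∇ φ x - ∇ ψ x := by
  simp only [gradient]
  rw [fderiv_sub ((hφ.differentiable (by simp)) x) ((hψ.differentiable (by simp)) x), map_sub]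

lemma gradient_mul' {φ ψ : Pt d → ℝ} (hφ : ContDiff ℝ ∞ φ) (hψ : ContDiff ℝ ∞ ψ) (x : Pt d) :
    ∇ (fun x => φ x * ψ x) x = φ x • ∇ ψ x + ψ x • ∇ φ x := by
  simp only [gradient]
  rw [fderiv_fun_mul ((hφ.differentiable (by simp)) x) ((hψ.differentiable (by simp)) x),
    map_add]
  simp

lemma tsupport_gradient_subset (φ : Pt d → ℝ) : tsupport (∇ φ) ⊆ tsupport φ := by
  refine closure_minimal (fun x hx => ?_) (isClosed_tsupport φ)
  by_contra h
  refine hx ?_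
  have : fderiv ℝ φ x = 0 := by
    by_contra h'
    exact h (support_fderiv_subset ℝ h')
  simp [gradient, this]

lemma gradient_eq_zero_of_notMem {φ : Pt d → ℝ} {x : Pt d} (h : x ∉ tsupport φ) :
    ∇ φ x = 0 :=
  image_eq_zero_of_notMem_tsupport fun h' => h (tsupport_gradient_subset φ h')

lemma memLp_of_continuous_of_isBounded {E : Type*} [NormedAddCommGroup E]
    [SecondCountableTopologyEither (Pt d) E] {f : Pt d → E}
    (hf : Continuous f) {D : Set (Pt d)} (hD : Bornology.IsBounded D) (p : ENNReal) :
    MemLp f p (volume.restrict D) := by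
  have hc : IsCompact (closure D) := hD.isCompact_closure
  obtain ⟨C, hC⟩ := hc.exists_bound_of_continuousOn hf.continuousOn
  have : MemLp f p (volume.restrict (closure D)) := by
    have : IsFiniteMeasure (volume.restrict (closure D)) :=
      ⟨by rw [Measure.restrict_apply_univ]; exact hc.measure_lt_top⟩
    exact MemLp.of_bound hf.aestronglyMeasurable C
      ((ae_restrict_iff' isClosed_closure.measurableSet).2 (Eventually.of_forall hC))
  exact this.mono_measure (Measure.restrict_mono subset_closure le_rfl)

lemma integrable_smul_of_memLp {α E : Type*} [MeasurableSpace α] [NormedAddCommGroup E]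
    [NormedSpace ℝ E] {μ : Measure α} {f : α → ℝ} {G : α → E} (hf : MemLp f 2 μ)
    (hG : MemLp G 2 μ) : Integrable (fun x => f x • G x) μ :=
  memLp_one_iff_integrable.1 (hG.smul hf)

/-- This is the fundamental lemma of the calculus of variations. Since `weakGrad` is an arbitrary
choice, every later computation with it passes through this uniqueness. -/
lemma HasWeakGrad.ae_unique {D : Set (Pt d)} (hD : IsOpen D) {v : Pt d → ℝ}
    {G G' : Pt d → Pt d} (h : HasWeakGrad D v G) (h' : HasWeakGrad D v G') :
    G =ᵐ[volume.restrict D] G' := by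
  have hL : MemLp (G - G') 2 (volume.restrict D) := h.memLp_grad.sub h'.memLp_grad
  have key := hD.ae_eq_zero_of_integral_contDiff_smul_eq_zero (f := G - G')
    (μ := volume.restrict D) ((hL.locallyIntegrable (by norm_num)).locallyIntegrableOn D) ?_
  · filter_upwards [key, ae_restrict_mem hD.measurableSet] with x hx hxD
    exact sub_eq_zero.1 (hx hxD)
  · intro φ hφ hc hs
    have hφm : MemLp φ 2 (volume.restrict D) := hφ.continuous.memLp_of_hasCompactSupport hc
    have e := h.weak φ hφ hc hs
    have e' := h'.weak φ hφ hc hs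
    simp only [Pi.sub_apply, smul_sub]
    rw [integral_sub (integrable_smul_of_memLp hφm h.memLp_grad)
      (integrable_smul_of_memLp hφm h'.memLp_grad)]
    rw [e] at e'
    rw [sub_eq_zero]
    exact neg_injective e'

lemma MemH1.hasWeakGrad {D : Set (Pt d)} {v : Pt d → ℝ} (h : MemH1 D v) :
    HasWeakGrad D v (weakGrad D v) := by
  rw [weakGrad, dif_pos h]; exact h.choose_spec

lemma HasWeakGrad.memH1 {D : Set (Pt d)} {v : Pt d → ℝ} {G : Pt d → Pt d}
    (h : HasWeakGrad D v G) : MemH1 D v := ⟨G, h⟩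

lemma HasWeakGrad.weakGrad_ae {D : Set (Pt d)} (hD : IsOpen D) {v : Pt d → ℝ}
    {G : Pt d → Pt d} (h : HasWeakGrad D v G) : weakGrad D v =ᵐ[volume.restrict D] G :=
  h.memH1.hasWeakGrad.ae_unique hD h

lemma HasWeakGrad.sub {D : Set (Pt d)} {v v' : Pt d → ℝ} {G G' : Pt d → Pt d}
    (h : HasWeakGrad D v G) (h' : HasWeakGrad D v' G') :
    HasWeakGrad D (v - v') (G - G') := by
  refine ⟨h.memLp.sub h'.memLp, h.memLp_grad.sub h'.memLp_grad, fun φ hφ hc hs => ?_⟩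
  have hφm : MemLp φ 2 (volume.restrict D) := hφ.continuous.memLp_of_hasCompactSupport hc
  have hgm : MemLp (∇ φ) 2 (volume.restrict D) :=
    (continuous_gradient hφ).memLp_of_hasCompactSupport
      (hc.of_isClosed_subset (isClosed_tsupport _) (tsupport_gradient_subset φ))
  simp only [Pi.sub_apply, smul_sub, sub_smul]
  rw [integral_sub (integrable_smul_of_memLp h.memLp hgm)
      (integrable_smul_of_memLp h'.memLp hgm),
    integral_sub (integrable_smul_of_memLp hφm h.memLp_grad)
      (integrable_smul_of_memLp hφm h'.memLp_grad),
    h.weak φ hφ hc hs, h'.weak φ hφ hc hs]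
  abel

/-- A test function supported in `E` is also one for `D`, and both of its integrals live on `E`. -/
lemma HasWeakGrad.mono {D E : Set (Pt d)} (hD : IsOpen D) (hED : E ⊆ D)
    {v : Pt d → ℝ} {G : Pt d → Pt d} (h : HasWeakGrad D v G) : HasWeakGrad E v G := by
  have hle : volume.restrict E ≤ (volume.restrict D : Measure (Pt d)) :=
    Measure.restrict_mono hED le_rfl
  refine ⟨h.memLp.mono_measure hle, h.memLp_grad.mono_measure hle, fun φ hφ hc hs => ?_⟩
  have := h.weak φ hφ hc (hs.trans hED)
  rwa [setIntegral_eq_of_subset_of_forall_sdiff_eq_zero hD.measurableSet hED,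
    setIntegral_eq_of_subset_of_forall_sdiff_eq_zero hD.measurableSet hED] at this
  · intro x hx
    rw [image_eq_zero_of_notMem_tsupport fun h' => hx.2 (hs h'), zero_smul]
  · intro x hx
    rw [gradient_eq_zero_of_notMem fun h' => hx.2 (hs h'), smul_zero]

/-- Compact support of the test function turns both integrals into integrals over the whole space,
where integration by parts applies in each direction. Boundedness of `D` serves only to have `φ` and
its gradient in `L²`. -/
lemma hasWeakGrad_of_contDiff {D : Set (Pt d)} (hD : Bornology.IsBounded D)
    {φ : Pt d → ℝ} (hφ : ContDiff ℝ ∞ φ) : HasWeakGrad D φ (∇ φ) := by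
  refine ⟨memLp_of_continuous_of_isBounded hφ.continuous hD 2,
    memLp_of_continuous_of_isBounded (continuous_gradient hφ) hD 2, fun ψ hψ hc hs => ?_⟩
  have hgc : HasCompactSupport (∇ ψ) :=
    hc.of_isClosed_subset (isClosed_tsupport _) (tsupport_gradient_subset ψ)
  rw [setIntegral_eq_integral_of_forall_compl_eq_zero fun x hx => by
      rw [gradient_eq_zero_of_notMem fun h' => hx (hs h'), smul_zero],
    setIntegral_eq_integral_of_forall_compl_eq_zero fun x hx => by
      rw [image_eq_zero_of_notMem_tsupport fun h' => hx (hs h'), zero_smul]]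
  have i1 : Integrable (fun x => φ x • ∇ ψ x) :=
    (hφ.continuous.smul (continuous_gradient hψ)).integrable_of_hasCompactSupport hgc.smul_left
  have i2 : Integrable (fun x => ψ x • ∇ φ x) :=
    (hψ.continuous.smul (continuous_gradient hφ)).integrable_of_hasCompactSupport hc.smul_right
  refine ext_inner_left ℝ fun a => ?_
  rw [inner_neg_right, ← integral_inner i1, ← integral_inner i2]
  simp only [real_inner_comm _ a, real_inner_smul_left, inner_gradient]
  have hdφ := hφ.differentiable (by simp)
  have hdψ := hψ.differentiable (by simp)
  have hcφ : Continuous (fun x => fderiv ℝ φ x a) :=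
    (hφ.continuous_fderiv (by simp)).clm_apply continuous_const
  have hcψ : Continuous (fun x => fderiv ℝ ψ x a) :=
    (hψ.continuous_fderiv (by simp)).clm_apply continuous_const
  have key := integral_mul_fderiv_eq_neg_fderiv_mul_of_integrable (μ := (volume : Measure (Pt d)))
    (f := φ) (g := ψ) (v := a)
    ((hcφ.mul hψ.continuous).integrable_of_hasCompactSupport hc.mul_left)
    ((hφ.continuous.mul hcψ).integrable_of_hasCompactSupport (hc.fderiv_apply ℝ a).mul_left)
    ((hφ.continuous.mul hψ.continuous).integrable_of_hasCompactSupport hc.mul_left)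
    (fun x _ => hdφ x) (fun x _ => hdψ x)
  rw [key]
  congr 1
  exact integral_congr_ae (Eventually.of_forall fun x => mul_comm _ _)

lemma weakGrad_sub_ae {D : Set (Pt d)} (hD : IsOpen D) {v w : Pt d → ℝ} (hv : MemH1 D v)
    (hw : MemH1 D w) :
    weakGrad D (v - w) =ᵐ[volume.restrict D] weakGrad D v - weakGrad D w :=
  (hv.hasWeakGrad.sub hw.hasWeakGrad).weakGrad_ae hD

lemma MemH1.sub {D : Set (Pt d)} {v w : Pt d → ℝ} (hv : MemH1 D v) (hw : MemH1 D w) :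
    MemH1 D (v - w) := (hv.hasWeakGrad.sub hw.hasWeakGrad).memH1

lemma TendstoH1.sub {D : Set (Pt d)} (hD : IsOpen D) (hb : Bornology.IsBounded D)
    {v w : Pt d → ℝ} (hv : MemH1 D v) (hw : MemH1 D w) {φ ψ : ℕ → Pt d → ℝ}
    (hφ : ∀ i, ContDiff ℝ ∞ (φ i)) (hψ : ∀ i, ContDiff ℝ ∞ (ψ i))
    (h : TendstoH1 D φ v) (h' : TendstoH1 D ψ w) :
    TendstoH1 D (fun i => φ i - ψ i) (v - w) := by
  have hmφ := fun i => hasWeakGrad_of_contDiff hb (hφ i)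
  have hmψ := fun i => hasWeakGrad_of_contDiff hb (hψ i)
  have s1 := h.1.add h'.1
  have s2 := h.2.add h'.2
  rw [add_zero] at s1 s2
  constructor
  · refine tendsto_of_tendsto_of_tendsto_of_le_of_le tendsto_const_nhds s1
      (fun _ => zero_le) fun i => ?_
    have := eLpNorm_sub_le (μ := volume.restrict D) (p := 2)
      (hv.hasWeakGrad.memLp.sub (hmφ i).memLp).1 (hw.hasWeakGrad.memLp.sub (hmψ i).memLp).1
      (by norm_num)
    refine le_trans (le_of_eq ?_) this
    congr 1; ext x; simp only [Pi.sub_apply]; ring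
  · refine tendsto_of_tendsto_of_tendsto_of_le_of_le tendsto_const_nhds s2
      (fun _ => zero_le) fun i => ?_
    have := eLpNorm_sub_le (μ := volume.restrict D) (p := 2)
      (hv.hasWeakGrad.memLp_grad.sub (hmφ i).memLp_grad).1
      (hw.hasWeakGrad.memLp_grad.sub (hmψ i).memLp_grad).1 (by norm_num)
    refine le_trans (le_of_eq (eLpNorm_congr_ae ?_)) this
    filter_upwards [weakGrad_sub_ae hD hv hw] with x hx
    rw [hx, gradient_sub' (hφ i) (hψ i)]
    simp only [Pi.sub_apply]; abel

/-! ### Traces of differences and of smooth functions -/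

lemma HasTrace.sub {K F : Set (Pt d)} (hK : IsOpen K) (hb : Bornology.IsBounded K)
    {v w s t : Pt d → ℝ} (h : HasTrace K F v s) (h' : HasTrace K F w t) :
    HasTrace K F (v - w) (s - t) := by
  obtain ⟨hv, hs, φ, hφ, hφv, hφs⟩ := h
  obtain ⟨hw, ht, ψ, hψ, hψw, hψt⟩ := h'
  refine ⟨hv.sub hw, hs.sub ht, fun i => φ i - ψ i, fun i => (hφ i).sub (hψ i),
    hφv.sub hK hb hv hw hφ hψ hψw, ?_⟩
  have s1 := hφs.add hψt
  rw [add_zero] at s1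
  refine tendsto_of_tendsto_of_tendsto_of_le_of_le tendsto_const_nhds s1
      (fun _ => zero_le) fun i => ?_
  have := eLpNorm_sub_le (μ := surf F) (p := 2)
      (hs.1.sub (hφ i).continuous.aestronglyMeasurable)
      (ht.1.sub (hψ i).continuous.aestronglyMeasurable)
      (by norm_num)
  refine le_trans (le_of_eq ?_) this
  congr 1; ext x; simp only [Pi.sub_apply]; ring

lemma memLp_face {F : Set (Pt d)} {ν : Pt d} (hF : IsFlatFace F ν) {f : Pt d → ℝ}
    (hf : Continuous f) (p : ENNReal) : MemLp f p (surf F) := by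
  have := hF.isFiniteMeasure
  obtain ⟨C, hC⟩ := hF.bounded.isCompact_closure.exists_bound_of_continuousOn hf.continuousOn
  refine MemLp.of_bound hf.aestronglyMeasurable C ?_
  filter_upwards [hF.ae_mem] with x hx
  exact hC x (subset_closure hx)

lemma hasTrace_of_contDiff {K F : Set (Pt d)} {ν : Pt d} (hK : IsOpen K)
    (hb : Bornology.IsBounded K)
    (hF : IsFlatFace F ν) {φ : Pt d → ℝ} (hφ : ContDiff ℝ ∞ φ) : HasTrace K F φ φ := by
  have hw := hasWeakGrad_of_contDiff hb hφ
  refine ⟨hw.memH1, memLp_face hF hφ.continuous 2, fun _ => φ, fun _ => hφ, ⟨?_, ?_⟩, ?_⟩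
  · simp
  · have : eLpNorm (fun x => weakGrad K φ x - ∇ φ x) 2 (volume.restrict K) = 0 := by
      rw [eLpNorm_congr_ae (g := fun _ => (0 : Pt d))]
      · simp
      · filter_upwards [hw.weakGrad_ae hK] with x hx
        rw [hx, sub_self]
    simp [this]
  · simp

lemma trace_spec {K F : Set (Pt d)} {v : Pt d → ℝ} (h : ∃ t, HasTrace K F v t) :
    HasTrace K F v (trace K F v) := by
  rw [trace, dif_pos h]; exact h.choose_spec

/-! ### Limits of integrals -/

/-- Hölder's inequality bounds the `L¹` distance of the products. This is the passage to the limit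
from smooth functions in the definition of traces. -/
lemma tendsto_integral_mul {α : Type*} [MeasurableSpace α] {μ : Measure α} {f g : α → ℝ}
    {φ : ℕ → α → ℝ} (hg : MemLp g 2 μ) (hf : MemLp f 2 μ) (hφ : ∀ i, MemLp (φ i) 2 μ)
    (h : Tendsto (fun i => eLpNorm (fun x => f x - φ i x) 2 μ) atTop (𝓝 0)) :
    Tendsto (fun i => ∫ x, g x * φ i x ∂μ) atTop (𝓝 (∫ x, g x * f x ∂μ)) := by
  refine tendsto_integral_of_L1' _ (hg.1.mul hf.1)
    (Eventually.of_forall fun i => hg.integrable_mul (hφ i)) ?_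
  have h1 : Tendsto (fun i => eLpNorm g 2 μ * eLpNorm (fun x => f x - φ i x) 2 μ) atTop (𝓝 0) := by
    have := ENNReal.Tendsto.const_mul h (Or.inr hg.2.ne)
    simpa using this
  refine tendsto_of_tendsto_of_tendsto_of_le_of_le tendsto_const_nhds h1 (fun _ => zero_le)
    fun i => ?_
  have := eLpNorm_smul_le_mul_eLpNorm (p := 2) (q := 2) (r := 1) (hf.sub (hφ i)).1 hg.1
  refine le_trans (le_of_eq ?_) this
  rw [← eLpNorm_neg]
  congr 1; ext x; simp; ring

lemma TendstoH1.tendsto_integral_mul {K : Set (Pt d)} (hb : Bornology.IsBounded K)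
    {v : Pt d → ℝ} (hv : MemH1 K v) {φ : ℕ → Pt d → ℝ} (hφ : ∀ i, ContDiff ℝ ∞ (φ i))
    (h : TendstoH1 K φ v) {g : Pt d → ℝ} (hg : MemLp g 2 (volume.restrict K)) :
    Tendsto (fun i => ∫ x in K, g x * φ i x) atTop (𝓝 (∫ x in K, g x * v x)) :=
  VEM.tendsto_integral_mul hg hv.hasWeakGrad.memLp
    (fun i => memLp_of_continuous_of_isBounded (hφ i).continuous hb 2) h.1

lemma TendstoH1.tendsto_integral_grad {K : Set (Pt d)} (hb : Bornology.IsBounded K)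
    {v : Pt d → ℝ} (hv : MemH1 K v) {φ : ℕ → Pt d → ℝ} (hφ : ∀ i, ContDiff ℝ ∞ (φ i))
    (h : TendstoH1 K φ v) {g : Pt d → ℝ} (hg : MemLp g 2 (volume.restrict K)) (a : Pt d) :
    Tendsto (fun i => ∫ x in K, g x * inner ℝ (∇ (φ i) x) a) atTop
      (𝓝 (∫ x in K, g x * inner ℝ (weakGrad K v x) a)) := by
  refine VEM.tendsto_integral_mul hg (hv.hasWeakGrad.memLp_grad.inner_const a)
    (fun i => (memLp_of_continuous_of_isBounded (continuous_gradient (hφ i)) hb 2).inner_const a) ?_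
  have h1 : Tendsto (fun i => ENNReal.ofReal ‖a‖ *
      eLpNorm (fun x => weakGrad K v x - ∇ (φ i) x) 2 (volume.restrict K)) atTop (𝓝 0) := by
    have := ENNReal.Tendsto.const_mul h.2 (Or.inr (ENNReal.ofReal_ne_top (r := ‖a‖)))
    simpa using this
  refine tendsto_of_tendsto_of_tendsto_of_le_of_le tendsto_const_nhds h1 (fun _ => zero_le)
    fun i => ?_
  refine eLpNorm_le_mul_eLpNorm_of_ae_le_mul (Eventually.of_forall fun x => ?_) 2
  rw [← inner_sub_left, mul_comm]
  exact norm_inner_le_norm _ _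

/-! ### Existence of traces on hyperplanes -/

lemma eLpNorm_two_eq {α E : Type*} [MeasurableSpace α] [NormedAddCommGroup E] {μ : Measure α}
    {f : α → E} (hf : MemLp f 2 μ) : eLpNorm f 2 μ = ENNReal.ofReal √(∫ x, ‖f x‖ ^ 2 ∂μ) := by
  rw [hf.eLpNorm_eq_integral_rpow_norm (by norm_num) (by norm_num), Real.sqrt_eq_rpow]
  norm_num

/-- A trace inequality: the integral of `φ²` over the hyperplane of the face equals the integral of
the normal derivative of `φ²` over a half space, and `2 |φ| |∇φ| ≤ |φ|² + |∇φ|²`. -/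
lemma eLpNorm_surf_le {F : Set (Pt d)} {ν : Pt d} (hF : IsFlatFace F ν) {φ : Pt d → ℝ}
    (hφ : ContDiff ℝ ∞ φ) (hc : HasCompactSupport φ) :
    eLpNorm φ 2 (surf F) ≤ eLpNorm φ 2 volume + eLpNorm (∇ φ) 2 volume := by
  obtain ⟨x₀, hx₀⟩ := hF.connected.nonempty
  have hgc : HasCompactSupport (∇ φ) :=
    hc.of_isClosed_subset (isClosed_tsupport _) (tsupport_gradient_subset φ)
  have m1 : MemLp φ 2 volume := hφ.continuous.memLp_of_hasCompactSupport hc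
  have m2 : MemLp (∇ φ) 2 volume := (continuous_gradient hφ).memLp_of_hasCompactSupport hgc
  have i1 : Integrable (fun x => ‖φ x‖ ^ 2) := m1.integrable_norm_pow (by norm_num)
  have i2 : Integrable (fun x => ‖∇ φ x‖ ^ 2) := m2.integrable_norm_pow (by norm_num)
  have hcp : HasCompactSupport (fun y => φ (planeChart x₀ ν y)) :=
    hc.comp_isClosedEmbedding (isometry_planeChart x₀ ν).isClosedEmbedding
  have ih : Integrable (fun x => ‖φ x‖ ^ 2) (surf (hyper x₀ ν)) := by
    rw [← (measurePreserving_planeChart x₀ ν hF.unit).integrable_comp_emb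
      (measurableEmbedding_planeChart x₀ ν)]
    have : MemLp (fun y => φ (planeChart x₀ ν y)) 2 volume :=
      (hφ.continuous.comp (isometry_planeChart x₀ ν).continuous).memLp_of_hasCompactSupport hcp
    exact this.integrable_norm_pow (by norm_num)
  have key : ∫ x, ‖φ x‖ ^ 2 ∂(surf F) ≤ (∫ x, ‖φ x‖ ^ 2) + ∫ x, ‖∇ φ x‖ ^ 2 := by
    have h1 : ∫ x, ‖φ x‖ ^ 2 ∂(surf F) ≤ ∫ x, ‖φ x‖ ^ 2 ∂(surf (hyper x₀ ν)) := by
      rw [surf_eq_restrict hF.measurableSet (hF.subset_hyper hx₀)]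
      exact integral_mono_measure Measure.restrict_le_self
        (Eventually.of_forall fun x => by positivity) ih
    have h2 := integral_halfSpace_gradient x₀ ν ν hF.unit (hφ.mul hφ) hc.mul_left
    simp only [gradient_mul' hφ hφ, real_inner_self_eq_norm_sq, hF.unit, one_pow, one_mul] at h2
    have h3 : ∫ x, ‖φ x‖ ^ 2 ∂(surf (hyper x₀ ν)) =
        ∫ x in {x | inner ℝ (x - x₀) ν < 0}, inner ℝ (φ x • ∇ φ x + φ x • ∇ φ x) ν := by
      rw [h2]; congr 1; ext x; rw [Real.norm_eq_abs, sq_abs, sq]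
    rw [h3] at h1
    refine h1.trans ?_
    rw [← integral_add i1 i2]
    have h4 : ∀ x, ‖inner ℝ (φ x • ∇ φ x + φ x • ∇ φ x) ν‖ ≤ ‖φ x‖ ^ 2 + ‖∇ φ x‖ ^ 2 := by
      intro x
      refine (norm_inner_le_norm _ _).trans ?_
      rw [hF.unit, mul_one, ← two_smul ℝ, norm_smul, norm_smul]
      simp only [Real.norm_ofNat]
      nlinarith [sq_nonneg (‖φ x‖ - ‖∇ φ x‖)]
    refine (Real.le_norm_self _).trans ((norm_integral_le_integral_norm _).trans ?_)
    refine (integral_mono_of_nonneg (Eventually.of_forall fun x => norm_nonneg _)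
      (i1.add i2).integrableOn (Eventually.of_forall h4)).trans ?_
    exact setIntegral_le_integral (i1.add i2) (Eventually.of_forall fun x => by
      simp only [Pi.add_apply, Pi.zero_apply]; positivity)
  rw [eLpNorm_two_eq (memLp_face hF hφ.continuous 2), eLpNorm_two_eq m1, eLpNorm_two_eq m2,
    ← ENNReal.ofReal_add (by positivity) (by positivity)]
  refine ENNReal.ofReal_le_ofReal ((Real.sqrt_le_sqrt key).trans ?_)
  have n1 : 0 ≤ ∫ x, ‖φ x‖ ^ 2 := integral_nonneg fun x => by positivity
  have n2 : 0 ≤ ∫ x, ‖∇ φ x‖ ^ 2 := integral_nonneg fun x => by positivity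
  rw [Real.sqrt_le_left (by positivity)]
  nlinarith [Real.sq_sqrt n1, Real.sq_sqrt n2,
    mul_nonneg (Real.sqrt_nonneg (∫ x, ‖φ x‖ ^ 2)) (Real.sqrt_nonneg (∫ x, ‖∇ φ x‖ ^ 2))]

lemma TendstoH1.mono {D E : Set (Pt d)} (hD : IsOpen D) (hE : IsOpen E) (hED : E ⊆ D)
    {v : Pt d → ℝ} (hv : MemH1 D v) {φ : ℕ → Pt d → ℝ} (h : TendstoH1 D φ v) :
    TendstoH1 E φ v := by
  have hle : volume.restrict E ≤ (volume.restrict D : Measure (Pt d)) :=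
    Measure.restrict_mono hED le_rfl
  constructor
  · exact tendsto_of_tendsto_of_tendsto_of_le_of_le tendsto_const_nhds h.1 (fun _ => zero_le)
      fun i => eLpNorm_mono_measure _ hle
  · refine tendsto_of_tendsto_of_tendsto_of_le_of_le tendsto_const_nhds h.2 (fun _ => zero_le)
      fun i => ?_
    refine le_trans (le_of_eq (eLpNorm_congr_ae ?_)) (eLpNorm_mono_measure _ hle)
    filter_upwards [(hv.hasWeakGrad.mono hD hED).weakGrad_ae hE] with x hx
    rw [hx]

/-- Functions in `H¹₀` have traces on all faces in the closure of the domain. -/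
lemma MemH10.exists_hasTrace {Ω K F : Set (Pt d)} {ν : Pt d} (hΩ : IsOpen Ω)
    (hK : IsOpen K) (hKΩ : K ⊆ Ω) (hF : IsFlatFace F ν) {u : Pt d → ℝ} (hu : MemH10 Ω u) :
    ∃ t, HasTrace K F u t := by
  obtain ⟨hu1, φ, hφ, hφu⟩ := hu
  have mφ : ∀ i, MemLp (φ i) 2 (surf F) := fun i => memLp_face hF (hφ i).1.continuous 2
  have hw := hu1.hasWeakGrad
  have mφv : ∀ i, MemLp (φ i) 2 (volume.restrict Ω) := fun i =>
    (hφ i).1.continuous.memLp_of_hasCompactSupport (hφ i).2.1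
  have mgv : ∀ i, MemLp (∇ (φ i)) 2 (volume.restrict Ω) := fun i =>
    (continuous_gradient (hφ i).1).memLp_of_hasCompactSupport
      ((hφ i).2.1.of_isClosed_subset (isClosed_tsupport _) (tsupport_gradient_subset _))
  -- The approximants have compact support in `Ω`, so the trace inequality on the whole space bounds
  -- their differences on the face by norms over `Ω`; no extension operator is needed.
  have hcau : CauchySeq (fun i => (mφ i).toLp (φ i)) := by
    rw [Lp.cauchySeq_Lp_iff_cauchySeq_eLpNorm]
    let A := fun i => eLpNorm (fun x => u x - φ i x) 2 (volume.restrict Ω)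
    let B := fun i => eLpNorm (fun x => weakGrad Ω u x - ∇ (φ i) x) 2 (volume.restrict Ω)
    have hA : Tendsto A atTop (𝓝 0) := hφu.1
    have hB : Tendsto B atTop (𝓝 0) := hφu.2
    have hlim : Tendsto (fun n : ℕ × ℕ => (A n.1 + A n.2) + (B n.1 + B n.2)) atTop (𝓝 0) := by
      rw [← prod_atTop_atTop_eq]
      have hA' : Tendsto (fun n : ℕ × ℕ => A n.1 + A n.2) (atTop ×ˢ atTop) (𝓝 (0 + 0)) :=
        (hA.comp tendsto_fst).add (hA.comp tendsto_snd)
      have hB' : Tendsto (fun n : ℕ × ℕ => B n.1 + B n.2) (atTop ×ˢ atTop) (𝓝 (0 + 0)) :=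
        (hB.comp tendsto_fst).add (hB.comp tendsto_snd)
      simpa using hA'.add hB'
    refine tendsto_of_tendsto_of_tendsto_of_le_of_le tendsto_const_nhds hlim (fun _ => zero_le) ?_
    rintro ⟨i, j⟩
    have e1 : eLpNorm ((mφ i).toLp (φ i) - (mφ j).toLp (φ j) : Pt d → ℝ) 2 (surf F) =
        eLpNorm (φ i - φ j) 2 (surf F) :=
      eLpNorm_congr_ae ((mφ i).coeFn_toLp.sub (mφ j).coeFn_toLp)
    simp only
    rw [e1]
    have hs : tsupport (φ i - φ j) ⊆ Ω :=
      (tsupport_sub _ _).trans (Set.union_subset (hφ i).2.2 (hφ j).2.2)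
    refine (eLpNorm_surf_le (φ := φ i - φ j) hF ((hφ i).1.sub (hφ j).1)
      ((hφ i).2.1.sub (hφ j).2.1)).trans ?_
    rw [← eLpNorm_restrict_eq_of_support_subset ((subset_tsupport _).trans hs),
      ← eLpNorm_restrict_eq_of_support_subset (f := ∇ (φ i - φ j))
        ((subset_tsupport _).trans ((tsupport_gradient_subset _).trans hs))]
    gcongr
    · have := eLpNorm_sub_le (μ := volume.restrict Ω) (p := 2)
        (hw.memLp.sub (mφv j)).1 (hw.memLp.sub (mφv i)).1 (by norm_num)
      rw [add_comm]
      refine le_trans (le_of_eq ?_) this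
      congr 1; ext x; simp
    · have := eLpNorm_sub_le (μ := volume.restrict Ω) (p := 2)
        (hw.memLp_grad.sub (mgv j)).1 (hw.memLp_grad.sub (mgv i)).1 (by norm_num)
      rw [add_comm]
      refine le_trans (le_of_eq ?_) this
      congr 1; ext1 x; rw [gradient_sub' (hφ i).1 (hφ j).1]; simp
  obtain ⟨t, ht⟩ := cauchySeq_tendsto_of_complete hcau
  rw [Lp.tendsto_Lp_iff_tendsto_eLpNorm'] at ht
  refine ⟨t, (hw.mono hΩ hKΩ).memH1, Lp.memLp t, φ, fun i => (hφ i).1,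
    hφu.mono hΩ hK hKΩ hu1, ht.congr fun i => ?_⟩
  rw [← eLpNorm_neg]
  refine eLpNorm_congr_ae ?_
  filter_upwards [(mφ i).coeFn_toLp] with x hx
  simp [hx]

/-! ### The divergence theorem near a face -/

/-- The Gauss formula near a point of an open face, for functions with a trace. -/
lemma HasTrace.exists_ball_gauss {K F : Set (Pt d)} {n : Pt d} (hK : IsOpen K)
    (hb : Bornology.IsBounded K) (hF : IsFlatFace F n) {x : Pt d} (hx : x ∈ F)
    (hside : ∃ r > 0, ∀ y ∈ Metric.ball x r, (y ∈ K ↔ inner ℝ (y - x) n < 0)) :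
    ∃ r > 0, (∀ y ∈ Metric.ball x r, y ∈ frontier K → y ∈ F) ∧
      ∀ w t, HasTrace K F w t → ∀ ψ : Pt d → ℝ, ContDiff ℝ ∞ ψ → HasCompactSupport ψ →
        tsupport ψ ⊆ Metric.ball x r → ∀ a : Pt d,
        (∫ x in K, w x * inner ℝ (∇ ψ x) a) + (∫ x in K, ψ x * inner ℝ (weakGrad K w x) a) =
          inner ℝ a n * ∫ x, t x * ψ x ∂(surf F) := by
  obtain ⟨r₁, hr₁, h₁⟩ := hside
  obtain ⟨r₂, hr₂, h₂⟩ := hF.relOpen x hx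
  set r := min r₁ r₂
  have hr : 0 < r := lt_min hr₁ hr₂
  have h₁ : ∀ y ∈ Metric.ball x r, (y ∈ K ↔ inner ℝ (y - x) n < 0) := fun y hy =>
    h₁ y (Metric.ball_subset_ball (min_le_left _ _) hy)
  have h₂ : ∀ y ∈ Metric.ball x r, inner ℝ (y - x) n = 0 → y ∈ F := fun y hy =>
    h₂ y (Metric.ball_subset_ball (min_le_right _ _) hy)
  refine ⟨r, hr, ?_, ?_⟩
  · intro y hy hyK
    have hyK' : y ∉ K := by
      rw [hK.frontier_eq] at hyK; exact hyK.2
    rcases lt_trichotomy (inner ℝ (y - x) n) 0 with h | h | h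
    · exact absurd ((h₁ y hy).2 h) hyK'
    · exact h₂ y hy h
    · exfalso
      have hcl : y ∈ closure K := frontier_subset_closure hyK
      have hopen : IsOpen (Metric.ball x r ∩ {z | 0 < inner ℝ (z - x) n}) :=
        Metric.isOpen_ball.inter (isOpen_lt continuous_const (by fun_prop))
      obtain ⟨z, hz, hzK⟩ := mem_closure_iff.1 hcl _ hopen ⟨hy, h⟩
      have := (h₁ z hz.1).1 hzK
      exact lt_asymm hz.2 this
  · rintro w t ⟨hw, ht, φ, hφ, hφw, hφt⟩ ψ hψ hc hs a
    -- On the support of `ψ` the element coincides with a half space, so the half space formula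
    -- applies to the product `ψ φᵢ`. All three terms pass to the limit by the `H¹` convergence and
    -- the convergence on the face.
    have smooth : ∀ i, (∫ x in K, inner ℝ (∇ ψ x) a * φ i x) +
        (∫ x in K, ψ x * inner ℝ (∇ (φ i) x) a) = inner ℝ a n * ∫ x, ψ x * φ i x ∂(surf F) := by
      intro i
      have h3 := integral_halfSpace_gradient x n a hF.unit (hψ.mul (hφ i)) hc.mul_right
      have hz : ∀ y, y ∉ Metric.ball x r → ∇ (fun x => ψ x * φ i x) y = 0 := fun y hy =>
        gradient_eq_zero_of_notMem fun h' => hy (hs (tsupport_mul_subset_left h'))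
      have e1 : ∫ x in {y | inner ℝ (y - x) n < 0}, inner ℝ (∇ (fun x => ψ x * φ i x) x) a =
          ∫ x in K, inner ℝ (∇ (fun x => ψ x * φ i x) x) a := by
        have hset : {y | inner ℝ (y - x) n < 0} ∩ Metric.ball x r = K ∩ Metric.ball x r := by
          ext y; constructor
          · rintro ⟨h, hy⟩; exact ⟨(h₁ y hy).2 h, hy⟩
          · rintro ⟨h, hy⟩; exact ⟨(h₁ y hy).1 h, hy⟩
        have hm : MeasurableSet {y | inner ℝ (y - x) n < 0} :=
          (isOpen_lt (by fun_prop) continuous_const).measurableSet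
        rw [setIntegral_eq_of_subset_of_forall_sdiff_eq_zero hm
            (Set.inter_subset_left (t := Metric.ball x r)),
          setIntegral_eq_of_subset_of_forall_sdiff_eq_zero hK.measurableSet
            (Set.inter_subset_left (t := Metric.ball x r)), hset]
        · rintro y ⟨hy, hy'⟩
          rw [hz y fun h => hy' ⟨hy, h⟩, inner_zero_left]
        · rintro y ⟨hy, hy'⟩
          rw [hz y fun h => hy' ⟨hy, h⟩, inner_zero_left]
      have e2 : ∫ x, ψ x * φ i x ∂(surf (hyper x n)) = ∫ x, ψ x * φ i x ∂(surf F) := by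
        refine setIntegral_eq_of_subset_of_forall_sdiff_eq_zero (isClosed_hyper x n).measurableSet
          (hF.subset_hyper hx) ?_
        rintro y ⟨hy, hy'⟩
        rw [image_eq_zero_of_notMem_tsupport (f := ψ) fun h' => hy' (h₂ y (hs h') hy), zero_mul]
      rw [e1, e2] at h3
      rw [← h3, ← integral_add]
      · refine integral_congr_ae (Eventually.of_forall fun y => ?_)
        simp only [gradient_mul' hψ (hφ i), inner_add_left, real_inner_smul_left]
        ring
      · exact ((memLp_of_continuous_of_isBounded (continuous_gradient hψ) hb 2).inner_const
          a).integrable_mul (memLp_of_continuous_of_isBounded (hφ i).continuous hb 2)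
      · exact (memLp_of_continuous_of_isBounded hψ.continuous hb 2).integrable_mul
          ((memLp_of_continuous_of_isBounded (continuous_gradient (hφ i)) hb 2).inner_const a)
    have l1 := hφw.tendsto_integral_mul hb hw hφ
      ((memLp_of_continuous_of_isBounded (continuous_gradient hψ) hb 2).inner_const a)
    have l2 := hφw.tendsto_integral_grad hb hw hφ
      (memLp_of_continuous_of_isBounded hψ.continuous hb 2) a
    have l3 := (VEM.tendsto_integral_mul (memLp_face hF hψ.continuous 2) ht
      (fun i => memLp_face hF (hφ i).continuous 2) hφt).const_mul (inner ℝ a n)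
    have := tendsto_nhds_unique (l1.add l2) (l3.congr fun i => (smooth i).symm)
    simp only [mul_comm (w _), mul_comm (t _)]
    exact this

/-- Traces are unique. -/
lemma HasTrace.ae_unique {K F : Set (Pt d)} {n : Pt d} (hK : IsOpen K)
    (hb : Bornology.IsBounded K) (hF : IsFlatFace F n)
    (hside : ∀ x ∈ F, ∃ r > 0, ∀ y ∈ Metric.ball x r, (y ∈ K ↔ inner ℝ (y - x) n < 0))
    {w s t : Pt d → ℝ} (hs : HasTrace K F w s) (ht : HasTrace K F w t) : s =ᵐ[surf F] t := by
  have := hF.isFiniteMeasure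
  have hL : MemLp (s - t) 2 (surf F) := hs.2.1.sub ht.2.1
  have hnull : surf F {x | x ∈ F ∧ s x ≠ t x} = 0 := by
    refine measure_null_of_locally_null _ fun x hx => ?_
    obtain ⟨r, hr, -, hg⟩ := HasTrace.exists_ball_gauss hK hb hF hx.1 (hside x hx.1)
    refine ⟨{x | x ∈ F ∧ s x ≠ t x} ∩ Metric.ball x r,
      inter_mem_nhdsWithin _ (Metric.ball_mem_nhds x hr), ?_⟩
    have key := (Metric.isOpen_ball (x := x) (ε := r)).ae_eq_zero_of_integral_contDiff_smul_eq_zero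
      (f := s - t) (μ := surf F) ((hL.integrable (by norm_num)).locallyIntegrable.locallyIntegrableOn
        _) ?_
    · refine measure_mono_null ?_ key
      rintro y ⟨hy, hyb⟩ h
      exact hy.2 (sub_eq_zero.1 (h hyb))
    · intro ψ hψ hc hsup
      -- In the normal direction the Gauss formula expresses the integral of the trace against `ψ`
      -- by `w` and its weak gradient alone, so both traces have the same integrals.
      have e1 := hg w s hs ψ hψ hc hsup n
      have e2 := hg w t ht ψ hψ hc hsup n
      rw [e1, real_inner_self_eq_norm_sq, hF.unit] at e2
      simp only [one_pow, one_mul] at e2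
      have hψm := memLp_face hF hψ.continuous 2
      simp only [Pi.sub_apply, smul_eq_mul, mul_sub]
      have i1 : Integrable (fun x => ψ x * s x) (surf F) := hψm.integrable_mul hs.2.1
      have i2 : Integrable (fun x => ψ x * t x) (surf F) := hψm.integrable_mul ht.2.1
      rw [integral_sub i1 i2]
      simp only [mul_comm (ψ _)]
      rw [e2, sub_self]
  filter_upwards [hF.ae_mem, measure_eq_zero_iff_ae_notMem.1 hnull] with x hx hx'
  by_contra h
  exact hx' ⟨hx, h⟩

/-! ### The divergence theorem on a polytope -/

/-- A property of smooth compactly supported functions that is additive and holds for functions with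
small support holds for all functions. -/
lemma smooth_local_induction {P : (Pt d → ℝ) → Prop} (h0 : P 0)
    (hadd : ∀ φ ψ : Pt d → ℝ, ContDiff ℝ ∞ φ → HasCompactSupport φ → ContDiff ℝ ∞ ψ →
      HasCompactSupport ψ → P φ → P ψ → P (φ + ψ))
    {ψ : Pt d → ℝ} (hψ : ContDiff ℝ ∞ ψ) (hc : HasCompactSupport ψ)
    (hloc : ∀ x ∈ tsupport ψ, ∃ U, IsOpen U ∧ x ∈ U ∧ ∀ χ : Pt d → ℝ, ContDiff ℝ ∞ χ →
      HasCompactSupport χ → tsupport χ ⊆ U → tsupport χ ⊆ tsupport ψ → P χ) : P ψ := by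
  classical
  choose! U hUo hxU hU using hloc
  obtain ⟨s, hs, hcov⟩ := (show IsCompact (tsupport ψ) from hc).elim_nhds_subcover U
    fun x hx => (hUo x hx).mem_nhds (hxU x hx)
  -- A partition of unity subordinate to a finite subcover writes `ψ` as a finite sum of functions
  -- with small support.
  obtain ⟨ρ, hρ⟩ := SmoothPartitionOfUnity.exists_isSubordinate (modelWithCornersSelf ℝ (Pt d))
    (isClosed_tsupport ψ) (fun i : s => U i) (fun i => hUo _ (hs _ i.2)) (by
      intro x hx
      obtain ⟨y, hy, hxy⟩ := Set.mem_iUnion₂.1 (hcov hx)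
      exact Set.mem_iUnion.2 ⟨⟨y, hy⟩, hxy⟩)
  have hρs : ∀ i, ContDiff ℝ ∞ (fun x => ρ i x) := fun i => (ρ i).contMDiff.contDiff
  have hterm : ∀ i, ContDiff ℝ ∞ (fun x => ρ i x * ψ x) ∧
      HasCompactSupport (fun x => ρ i x * ψ x) ∧ P (fun x => ρ i x * ψ x) := by
    intro i
    refine ⟨(hρs i).mul hψ, hc.mul_left, hU i (hs _ i.2) _ ((hρs i).mul hψ) hc.mul_left ?_ ?_⟩
    · exact (tsupport_mul_subset_left).trans (hρ i)
    · exact tsupport_mul_subset_right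
  have hsum : ∀ T : Finset s, ContDiff ℝ ∞ (∑ i ∈ T, fun x => ρ i x * ψ x) ∧
      HasCompactSupport (∑ i ∈ T, fun x => ρ i x * ψ x) ∧
      P (∑ i ∈ T, fun x => ρ i x * ψ x) := by
    intro T
    induction T using Finset.induction_on with
    | empty =>
      rw [Finset.sum_empty]
      exact ⟨contDiff_const, HasCompactSupport.zero, h0⟩
    | insert i T hi ih =>
      rw [Finset.sum_insert hi]
      obtain ⟨t1, t2, t3⟩ := hterm i
      exact ⟨t1.add ih.1, t2.add ih.2.1, hadd _ _ t1 t2 ih.1 ih.2.1 t3 ih.2.2⟩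
  have : ψ = ∑ i : s, fun x => ρ i x * ψ x := by
    ext x
    rw [Finset.sum_apply, ← Finset.sum_mul]
    by_cases hx : x ∈ tsupport ψ
    · have := ρ.sum_eq_one hx
      rw [finsum_eq_sum_of_fintype] at this
      rw [this, one_mul]
    · rw [image_eq_zero_of_notMem_tsupport hx, mul_zero]
  rw [this]
  exact (hsum _).2.2

/-- The defect in the Gauss formula for `w` (with traces `t`) times a smooth function. -/
def gaussDefect (K : Set (Pt d)) (S : Finset (Set (Pt d))) (n : Set (Pt d) → Pt d)
    (t : Set (Pt d) → Pt d → ℝ) (w : Pt d → ℝ) (a : Pt d) (ψ : Pt d → ℝ) : ℝ :=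
  (∫ x in K, w x * inner ℝ (∇ ψ x) a) + (∫ x in K, ψ x * inner ℝ (weakGrad K w x) a) -
    ∑ F ∈ S, inner ℝ a (n F) * ∫ x, t F x * ψ x ∂(surf F)

lemma gradient_add' {φ ψ : Pt d → ℝ} (hφ : ContDiff ℝ ∞ φ) (hψ : ContDiff ℝ ∞ ψ) (x : Pt d) :
    ∇ (φ + ψ) x = ∇ φ x + ∇ ψ x := by
  simp only [gradient]
  rw [fderiv_add ((hφ.differentiable (by simp)) x) ((hψ.differentiable (by simp)) x), map_add]

section

variable {K : Set (Pt d)} {S : Finset (Set (Pt d))} {n : Set (Pt d) → Pt d}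
  {t : Set (Pt d) → Pt d → ℝ} {w : Pt d → ℝ}

lemma gaussDefect_add (hb : Bornology.IsBounded K)
    (hS : ∀ F ∈ S, IsFlatFace F (n F)) (hw : MemH1 K w) (ht : ∀ F ∈ S, MemLp (t F) 2 (surf F))
    (a : Pt d) {φ ψ : Pt d → ℝ} (hφ : ContDiff ℝ ∞ φ) (hψ : ContDiff ℝ ∞ ψ) :
    gaussDefect K S n t w a (φ + ψ) = gaussDefect K S n t w a φ + gaussDefect K S n t w a ψ := by
  have mg : ∀ φ : Pt d → ℝ, ContDiff ℝ ∞ φ → Integrable (fun x => w x * inner ℝ (∇ φ x) a)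
      (volume.restrict K) := fun φ hφ => hw.hasWeakGrad.memLp.integrable_mul
    ((memLp_of_continuous_of_isBounded (continuous_gradient hφ) hb 2).inner_const a)
  have mw : ∀ φ : Pt d → ℝ, ContDiff ℝ ∞ φ → Integrable (fun x => φ x * inner ℝ (weakGrad K w x) a)
      (volume.restrict K) := fun φ hφ =>
    (memLp_of_continuous_of_isBounded hφ.continuous hb 2).integrable_mul
      (hw.hasWeakGrad.memLp_grad.inner_const a)
  have mt : ∀ φ : Pt d → ℝ, ContDiff ℝ ∞ φ → ∀ F ∈ S, Integrable (fun x => t F x * φ x)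
      (surf F) := fun φ hφ F hF =>
    (ht F hF).integrable_mul (memLp_face (hS F hF) hφ.continuous 2)
  have hsum : ∑ F ∈ S, inner ℝ a (n F) * ∫ x, t F x * (φ + ψ) x ∂(surf F) =
      ∑ F ∈ S, inner ℝ a (n F) * ∫ x, t F x * φ x ∂(surf F) +
      ∑ F ∈ S, inner ℝ a (n F) * ∫ x, t F x * ψ x ∂(surf F) := by
    rw [← Finset.sum_add_distrib]
    refine Finset.sum_congr rfl fun F hF => ?_
    simp only [Pi.add_apply, mul_add (t F _)]
    rw [integral_add (mt φ hφ F hF) (mt ψ hψ F hF), mul_add]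
  rw [gaussDefect, hsum]
  simp only [gaussDefect, gradient_add' hφ hψ, inner_add_left, mul_add, Pi.add_apply, add_mul]
  rw [integral_add (mg φ hφ) (mg ψ hψ), integral_add (mw φ hφ) (mw ψ hψ)]
  ring

lemma gaussDefect_zero (a : Pt d) : gaussDefect K S n t w a 0 = 0 := by
  have : ∀ x : Pt d, ∇ (0 : Pt d → ℝ) x = 0 := fun x => by
    apply gradient_eq_zero_of_notMem; simp
  simp [gaussDefect, this]

/-- The Gauss formula holds for test functions that vanish near the lower dimensional part of the
boundary. -/
lemma gaussDefect_eq_zero_of_disjoint (hK : IsPolytopeWith K S n)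
    (ht : ∀ F ∈ S, HasTrace K F w (t F)) (hw : MemH1 K w) (a : Pt d) {ψ : Pt d → ℝ}
    (hψ : ContDiff ℝ ∞ ψ) (hc : HasCompactSupport ψ)
    (hdisj : ∀ x ∈ tsupport ψ, x ∈ frontier K → ∃ F ∈ S, x ∈ F) :
    gaussDefect K S n t w a ψ = 0 := by
  have hfr : ∀ F ∈ S, F ⊆ frontier K := fun F hF => by
    rw [hK.frontier_eq]
    exact subset_closure.trans (Set.subset_biUnion_of_mem (u := fun F => closure F) hF)
  refine smooth_local_induction (P := fun ψ => gaussDefect K S n t w a ψ = 0) (gaussDefect_zero a)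
    (fun φ ψ hφ _ hψ _ h1 h2 => by
      rw [gaussDefect_add hK.bounded hK.flatFace hw (fun F hF => (ht F hF).2.1) a hφ hψ, h1, h2,
        add_zero]) hψ hc fun x hx => ?_
  have faces0 : ∀ χ : Pt d → ℝ, ∀ F ∈ S, Disjoint (tsupport χ) F →
      ∫ x, t F x * χ x ∂(surf F) = 0 := by
    intro χ F hF hd
    refine integral_eq_zero_of_ae ?_
    filter_upwards [(hK.flatFace F hF).ae_mem] with y hy
    have : χ y = 0 := image_eq_zero_of_notMem_tsupport fun h => Set.disjoint_left.1 hd h hy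
    simp [this]
  -- Inside `K` the claim is the definition of the weak gradient, at a boundary point it is the
  -- local formula on an open face, and outside the closure every term vanishes.
  by_cases hxK : x ∈ K
  · refine ⟨K, hK.isOpen, hxK, fun χ hχ hcχ hsup _ => ?_⟩
    have e0 : ∑ F ∈ S, inner ℝ a (n F) * ∫ x, t F x * χ x ∂(surf F) = 0 := by
      refine Finset.sum_eq_zero fun F hF => ?_
      rw [faces0 χ F hF, mul_zero]
      refine Set.disjoint_left.2 fun y hy hyF => ?_
      have := hfr F hF hyF
      rw [hK.isOpen.frontier_eq] at this
      exact this.2 (hsup hy)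
    have e := hw.hasWeakGrad.weak χ hχ hcχ hsup
    have i1 := integrable_smul_of_memLp hw.hasWeakGrad.memLp
      (memLp_of_continuous_of_isBounded (continuous_gradient hχ) hK.bounded 2)
    have i2 := integrable_smul_of_memLp
      (memLp_of_continuous_of_isBounded hχ.continuous hK.bounded 2) hw.hasWeakGrad.memLp_grad
    have e' := congrArg (fun v => inner ℝ a v) e
    simp only [inner_neg_right] at e'
    rw [← integral_inner i1, ← integral_inner i2] at e'
    simp only [real_inner_comm _ a, real_inner_smul_left] at e'
    simp only [gaussDefect, e0, sub_zero]
    rw [e', neg_add_cancel]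
  by_cases hxc : x ∈ closure K
  · have hxf : x ∈ frontier K := by rw [hK.isOpen.frontier_eq]; exact ⟨hxc, hxK⟩
    obtain ⟨F, hF, hxF⟩ := hdisj x hx hxf
    obtain ⟨r, hr, hball, hg⟩ := HasTrace.exists_ball_gauss hK.isOpen hK.bounded
      (hK.flatFace F hF) hxF (hK.oneSided F hF x hxF)
    refine ⟨Metric.ball x r, Metric.isOpen_ball, Metric.mem_ball_self hr,
      fun χ hχ hcχ hsup _ => ?_⟩
    have e := hg w (t F) (ht F hF) χ hχ hcχ hsup a
    rw [gaussDefect, e, Finset.sum_eq_single_of_mem F hF, sub_self]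
    intro F' hF' hne
    rw [faces0 χ F' hF', mul_zero]
    refine Set.disjoint_left.2 fun y hy hyF => ?_
    have h1 := hball y (hsup hy) (hfr F' hF' hyF)
    exact Set.disjoint_left.1 (hK.disjoint F' hF' F hF hne) hyF h1
  · refine ⟨(closure K)ᶜ, isClosed_closure.isOpen_compl, hxc, fun χ hχ hcχ hsup _ => ?_⟩
    have hzero : ∀ y ∈ closure K, y ∉ tsupport χ := fun y hy h => hsup h hy
    have e0 : ∑ F ∈ S, inner ℝ a (n F) * ∫ x, t F x * χ x ∂(surf F) = 0 := by
      refine Finset.sum_eq_zero fun F hF => ?_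
      rw [faces0 χ F hF, mul_zero]
      exact Set.disjoint_left.2 fun y hy hyF =>
        hzero y (frontier_subset_closure (hfr F hF hyF)) hy
    rw [gaussDefect, e0, setIntegral_eq_zero_of_forall_eq_zero,
      setIntegral_eq_zero_of_forall_eq_zero]
    · simp
    · intro y hy
      rw [image_eq_zero_of_notMem_tsupport (hzero y (subset_closure hy)), zero_mul]
    · intro y hy
      rw [gradient_eq_zero_of_notMem (hzero y (subset_closure hy)), inner_zero_left, mul_zero]

end

/-! ### Cut-off functions around affine subspaces of codimension two -/

/-- The squared distance to the subspace through `p` orthogonal to `e₁`, `e₂`. -/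
def quad (p e₁ e₂ x : Pt d) : ℝ := inner ℝ (x - p) e₁ ^ 2 + inner ℝ (x - p) e₂ ^ 2

/-- The cut-off function that vanishes where `quad ≤ ε²`, and is one where `quad ≥ 2 ε²`. -/
def cutoff (p e₁ e₂ : Pt d) (ε : ℝ) (x : Pt d) : ℝ :=
  Real.smoothTransition (quad p e₁ e₂ x / ε ^ 2 - 1)

lemma contDiff_quad (p e₁ e₂ : Pt d) : ContDiff ℝ ∞ (quad p e₁ e₂) := by
  unfold quad
  have h : ∀ e : Pt d, ContDiff ℝ ∞ (fun x : Pt d => inner ℝ (x - p) e) := fun e =>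
    (contDiff_id.sub contDiff_const).inner ℝ contDiff_const
  exact ((h e₁).pow 2).add ((h e₂).pow 2)

lemma contDiff_cutoff (p e₁ e₂ : Pt d) (ε : ℝ) : ContDiff ℝ ∞ (cutoff p e₁ e₂ ε) := by
  unfold cutoff
  exact Real.smoothTransition.contDiff.comp
    (((contDiff_quad p e₁ e₂).div_const _).sub contDiff_const)

lemma cutoff_mem_Icc (p e₁ e₂ : Pt d) (ε : ℝ) (x : Pt d) : cutoff p e₁ e₂ ε x ∈ Set.Icc 0 1 :=
  ⟨Real.smoothTransition.nonneg _, Real.smoothTransition.le_one _⟩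

lemma tsupport_cutoff_subset (p e₁ e₂ : Pt d) {ε : ℝ} (hε : 0 < ε) :
    tsupport (cutoff p e₁ e₂ ε) ⊆ {x | ε ^ 2 ≤ quad p e₁ e₂ x} := by
  refine closure_minimal (fun x hx => ?_)
    (isClosed_le continuous_const (contDiff_quad p e₁ e₂).continuous)
  by_contra h
  refine hx (Real.smoothTransition.zero_of_nonpos ?_)
  have h' : quad p e₁ e₂ x < ε ^ 2 := not_le.1 h
  rw [sub_nonpos, div_le_one (by positivity)]
  exact h'.le

lemma cutoff_eq_one (p e₁ e₂ : Pt d) {ε : ℝ} (hε : 0 < ε) {x : Pt d}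
    (hx : 2 * ε ^ 2 ≤ quad p e₁ e₂ x) : cutoff p e₁ e₂ ε x = 1 := by
  refine Real.smoothTransition.one_of_one_le ?_
  rw [le_sub_iff_add_le, le_div_iff₀ (by positivity)]
  linarith

/-- The gradient of the cut-off function is bounded by a multiple of `1 / ε`, and is zero away from
the subspace. -/
lemma exists_cutoff_gradient_bound : ∃ C : ℝ, 0 ≤ C ∧ ∀ (p e₁ e₂ a : Pt d) (ε : ℝ), ‖e₁‖ = 1 →
    ‖e₂‖ = 1 → 0 < ε → ∀ x, |inner ℝ (∇ (cutoff p e₁ e₂ ε) x) a| ≤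
      Set.indicator {x | quad p e₁ e₂ x ≤ 2 * ε ^ 2} (fun _ => C * ‖a‖ / ε) x := by
  have hcont : Continuous (deriv Real.smoothTransition) :=
    (Real.smoothTransition.contDiff (n := 1)).continuous_deriv (by simp)
  -- A bound on `[-1, 1]` suffices: where `quad ≤ 2 ε²`, the argument `quad / ε² - 1` lies in this
  -- interval. The factor `8` comes from two terms, each with a `2` from differentiating a square
  -- and an inner product of at most `2 ε`.
  obtain ⟨C, hC⟩ := (isCompact_Icc (a := (-1 : ℝ)) (b := 1)).exists_bound_of_continuousOn
    hcont.continuousOn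
  have hC0 : 0 ≤ C := (norm_nonneg _).trans (hC 0 (by simp))
  refine ⟨8 * C, by positivity, fun p e₁ e₂ a ε h1 h2 hε x => ?_⟩
  by_cases hx : quad p e₁ e₂ x ≤ 2 * ε ^ 2
  · rw [Set.indicator_of_mem (by exact hx), inner_gradient]
    have hin : ∀ e : Pt d, HasFDerivAt (fun x : Pt d => inner ℝ (x - p) e) (innerSL ℝ e) x := by
      intro e
      have : (fun x : Pt d => inner ℝ (x - p) e) = fun x => innerSL ℝ e x - inner ℝ p e := by
        ext y; simp [inner_sub_left, real_inner_comm]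
      rw [this]
      exact (innerSL ℝ e).hasFDerivAt.sub_const _
    have hq : HasFDerivAt (quad p e₁ e₂)
        ((2 * inner ℝ (x - p) e₁) • innerSL ℝ e₁ + (2 * inner ℝ (x - p) e₂) • innerSL ℝ e₂) x := by
      have := ((hin e₁).pow 2).add ((hin e₂).pow 2)
      simp only [Nat.cast_ofNat, Nat.add_one_sub_one, pow_one, nsmul_eq_mul] at this
      exact this
    have hs : HasDerivAt Real.smoothTransition
        (deriv Real.smoothTransition (quad p e₁ e₂ x / ε ^ 2 - 1)) (quad p e₁ e₂ x / ε ^ 2 - 1) :=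
      ((Real.smoothTransition.contDiff (n := 1)).differentiable (by simp) _).hasDerivAt
    have hq' : HasFDerivAt (fun x => quad p e₁ e₂ x / ε ^ 2 - 1) ((ε ^ 2)⁻¹ •
        ((2 * inner ℝ (x - p) e₁) • innerSL ℝ e₁ + (2 * inner ℝ (x - p) e₂) • innerSL ℝ e₂)) x := by
      have := (hq.const_mul ((ε ^ 2)⁻¹)).sub_const 1
      simpa [div_eq_inv_mul] using this
    have hd := hs.comp_hasFDerivAt x hq'
    have hd' : fderiv ℝ (cutoff p e₁ e₂ ε) x = _ := hd.fderiv
    rw [hd']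
    simp only [smul_apply, add_apply, innerSL_apply_apply,
      smul_eq_mul]
    have hq0 : 0 ≤ quad p e₁ e₂ x := by unfold quad; positivity
    have b1 : |deriv Real.smoothTransition (quad p e₁ e₂ x / ε ^ 2 - 1)| ≤ C := by
      refine hC _ ⟨?_, ?_⟩
      · have := div_nonneg hq0 (sq_nonneg ε); linarith
      · have : quad p e₁ e₂ x / ε ^ 2 ≤ 2 := by rw [div_le_iff₀ (by positivity)]; exact hx
        linarith
    have bx : ∀ e, inner ℝ (x - p) e ^ 2 ≤ quad p e₁ e₂ x → |inner ℝ (x - p) e| ≤ 2 * ε := by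
      intro e he
      refine abs_le_of_sq_le_sq (by nlinarith) (by positivity)
    have b2 := bx e₁ (by unfold quad; nlinarith [sq_nonneg (inner ℝ (x - p) e₂)])
    have b3 := bx e₂ (by unfold quad; nlinarith [sq_nonneg (inner ℝ (x - p) e₁)])
    have b4 : |inner ℝ e₁ a| ≤ ‖a‖ := by
      have := abs_real_inner_le_norm e₁ a; rwa [h1, one_mul] at this
    have b5 : |inner ℝ e₂ a| ≤ ‖a‖ := by
      have := abs_real_inner_le_norm e₂ a; rwa [h2, one_mul] at this
    have b6 : |2 * inner ℝ (x - p) e₁ * inner ℝ e₁ a + 2 * inner ℝ (x - p) e₂ * inner ℝ e₂ a| ≤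
        8 * ε * ‖a‖ := by
      refine (abs_add_le _ _).trans ?_
      rw [abs_mul, abs_mul, abs_mul, abs_mul, abs_two]
      have c1 := mul_le_mul b2 b4 (abs_nonneg _) (by positivity)
      have c2 := mul_le_mul b3 b5 (abs_nonneg _) (by positivity)
      linarith
    rw [abs_mul, abs_mul, abs_of_pos (by positivity : 0 < (ε ^ 2)⁻¹)]
    calc _ ≤ C * ((ε ^ 2)⁻¹ * (8 * ε * ‖a‖)) := by gcongr
      _ = 8 * C * ‖a‖ / ε := by field_simp
  · rw [Set.indicator_of_notMem (by exact hx)]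
    have : cutoff p e₁ e₂ ε =ᶠ[𝓝 x] fun _ => 1 := by
      have : {y | 2 * ε ^ 2 < quad p e₁ e₂ y} ∈ 𝓝 x :=
        (isOpen_lt continuous_const (contDiff_quad p e₁ e₂).continuous).mem_nhds (not_le.1 hx)
      filter_upwards [this] with y hy
      exact cutoff_eq_one p e₁ e₂ hε hy.le
    rw [inner_gradient, this.fderiv_eq]
    simp

/-- The volume of the neighbourhood of a subspace of codimension two in a bounded set. -/
lemma exists_volume_quad_le {p e₁ e₂ : Pt d} (h1 : ‖e₁‖ = 1) (h2 : ‖e₂‖ = 1)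
    (h12 : inner ℝ e₁ e₂ = 0) {K : Set (Pt d)} (hK : Bornology.IsBounded K) :
    ∃ C : ℝ, 0 ≤ C ∧ ∀ ε, 0 < ε →
      volume ({x | quad p e₁ e₂ x ≤ 2 * ε ^ 2} ∩ K) ≤ ENNReal.ofReal (C * ε ^ 2) := by
  classical
  obtain ⟨R, hR0, hR⟩ : ∃ R : ℝ, 0 ≤ R ∧ ∀ x ∈ K, ‖x - p‖ ≤ R := by
    obtain ⟨R, hR⟩ := hK.subset_closedBall p
    refine ⟨max R 0, le_max_right _ _, fun x hx => ?_⟩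
    have := hR hx
    rw [Metric.mem_closedBall, dist_eq_norm] at this
    exact this.trans (le_max_left _ _)
  have hd : 2 ≤ d := by
    have hor : Orthonormal ℝ ![e₁, e₂] := by
      rw [orthonormal_iff_ite]
      intro i j
      fin_cases i <;> fin_cases j <;> simp [h12, real_inner_comm, h1, h2]
    have := hor.linearIndependent.fintype_card_le_finrank
    simpa using this
  let i₀ : Fin d := ⟨0, by omega⟩
  let i₁ : Fin d := ⟨1, by omega⟩
  have hi : i₀ ≠ i₁ := by simp [i₀, i₁]
  obtain ⟨b, hb⟩ := Orthonormal.exists_orthonormalBasis_extension_of_card_eq (𝕜 := ℝ)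
    (E := Pt d) (ι := Fin d) (by simp) (v := fun i => if i = i₀ then e₁ else e₂) (s := {i₀, i₁}) (by
      rw [orthonormal_iff_ite]
      rintro ⟨i, hi'⟩ ⟨j, hj'⟩
      rcases hi' with rfl | rfl <;> rcases hj' with rfl | rfl <;>
        simp [Subtype.ext_iff, hi, hi.symm, h12, real_inner_comm, h1, h2])
  have hb0 : b i₀ = e₁ := by simpa using hb i₀ (by simp)
  have hb1 : b i₁ = e₂ := by simpa [hi.symm] using hb i₁ (by simp)
  -- Half side lengths of a box containing the set, in an orthonormal basis extending `e₁`, `e₂`: of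
  -- order `ε` in these two directions, and the radius of `K` in the others.
  let c : ℝ → Fin d → ℝ := fun ε i => if i = i₀ ∨ i = i₁ then 2 * ε else R
  refine ⟨16 * (2 * R) ^ (d - 2), by positivity, fun ε hε => ?_⟩
  let T : Pt d → (Fin d → ℝ) := fun x => WithLp.ofLp (b.repr (x - p))
  have hT : MeasurePreserving T := by
    have m1 := measurePreserving_sub_right (volume : Measure (Pt d)) p
    exact (PiLp.volume_preserving_ofLp (Fin d)).comp (b.measurePreserving_repr.comp m1)
  have hsub : {x | quad p e₁ e₂ x ≤ 2 * ε ^ 2} ∩ K ⊆ T ⁻¹' Set.Icc (-(c ε)) (c ε) := by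
    rintro x ⟨hx, hxK⟩
    have hx : quad p e₁ e₂ x ≤ 2 * ε ^ 2 := hx
    have habs : ∀ i, |T x i| ≤ c ε i := by
      intro i
      have hTi : T x i = inner ℝ (b i) (x - p) := b.repr_apply_apply _ _
      rw [hTi]
      by_cases h : i = i₀ ∨ i = i₁
      · simp only [c, h, if_true]
        refine abs_le_of_sq_le_sq ?_ (by positivity)
        rcases h with rfl | rfl
        · rw [hb0, real_inner_comm]
          unfold quad at hx; nlinarith [sq_nonneg (inner ℝ (x - p) e₂)]
        · rw [hb1, real_inner_comm]
          unfold quad at hx; nlinarith [sq_nonneg (inner ℝ (x - p) e₁)]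
      · simp only [c, h, if_false]
        refine (abs_real_inner_le_norm _ _).trans ?_
        rw [b.norm_eq_one, one_mul]
        exact hR x hxK
    exact ⟨fun i => (abs_le.1 (habs i)).1, fun i => (abs_le.1 (habs i)).2⟩
  refine (measure_mono hsub).trans ?_
  rw [hT.measure_preimage measurableSet_Icc.nullMeasurableSet, Real.volume_Icc_pi,
    ← ENNReal.ofReal_prod_of_nonneg]
  · refine ENNReal.ofReal_le_ofReal (le_of_eq ?_)
    have hcard : (Finset.univ.filter fun i : Fin d => i = i₀ ∨ i = i₁) = {i₀, i₁} := by
      ext i; simp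
    have hterm : ∀ i, c ε i - (-(c ε)) i = if i = i₀ ∨ i = i₁ then 4 * ε else 2 * R := by
      intro i
      simp only [c, Pi.neg_apply]
      split_ifs <;> ring
    simp_rw [hterm]
    have hcard' : (Finset.univ.filter fun i : Fin d => ¬ (i = i₀ ∨ i = i₁)).card = d - 2 := by
      have := Finset.card_filter_add_card_filter_not (s := (Finset.univ : Finset (Fin d)))
        (fun i => i = i₀ ∨ i = i₁)
      rw [hcard, Finset.card_pair hi, Finset.card_univ, Fintype.card_fin] at this
      omega
    rw [Finset.prod_ite, Finset.prod_const, Finset.prod_const, hcard, Finset.card_pair hi, hcard']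
    ring
  · intro i _
    simp only [c, Pi.neg_apply]
    split_ifs <;> linarith

/-- An affine subspace of codimension at least two lies in one that is given by two equations. -/
lemma exists_quad_eq_zero {a : AffineSubspace ℝ (Pt d)}
    (ha : Module.finrank ℝ a.direction + 2 ≤ d) :
    ∃ p e₁ e₂ : Pt d, ‖e₁‖ = 1 ∧ ‖e₂‖ = 1 ∧ inner ℝ e₁ e₂ = 0 ∧
      (∀ x ∈ a, quad p e₁ e₂ x = 0) ∧ ∃ a' : AffineSubspace ℝ (Pt d),
        Module.finrank ℝ a'.direction + 2 ≤ d ∧ ∀ x, quad p e₁ e₂ x = 0 → x ∈ a' := by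
  have hfr := Submodule.finrank_add_finrank_orthogonal a.direction
  rw [finrank_euclideanSpace_fin] at hfr
  set W := a.directionᗮ
  let b := stdOrthonormalBasis ℝ W
  let i₀ : Fin (Module.finrank ℝ W) := ⟨0, by omega⟩
  let i₁ : Fin (Module.finrank ℝ W) := ⟨1, by omega⟩
  have hi : i₀ ≠ i₁ := by simp [i₀, i₁]
  -- An affine subspace may be empty; then the base point is arbitrary and the inclusion holds
  -- vacuously.
  have hp : ∃ p : Pt d, a = ⊥ ∨ p ∈ a := by
    rcases a.eq_bot_or_nonempty with h | ⟨p, hp⟩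
    · exact ⟨0, Or.inl h⟩
    · exact ⟨p, Or.inr hp⟩
  obtain ⟨p, hp⟩ := hp
  have n0 : ‖(b i₀ : Pt d)‖ = 1 := b.norm_eq_one i₀
  have n1 : ‖(b i₁ : Pt d)‖ = 1 := b.norm_eq_one i₁
  have n01 : inner ℝ (b i₀ : Pt d) (b i₁ : Pt d) = 0 := by
    have := b.orthonormal.2 hi
    simpa using this
  refine ⟨p, b i₀, b i₁, n0, n1, n01, ?_, AffineSubspace.mk' p
    (Submodule.span ℝ {(b i₀ : Pt d), (b i₁ : Pt d)})ᗮ, ?_, ?_⟩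
  · intro x hx
    have hpa : p ∈ a := by
      rcases hp with rfl | h
      · exact absurd hx (AffineSubspace.notMem_bot ℝ _ x)
      · exact h
    have hdir : x - p ∈ a.direction := AffineSubspace.vsub_mem_direction hx hpa
    have z : ∀ i, inner ℝ (x - p) (b i : Pt d) = 0 := fun i => (b i).2 _ hdir
    simp [quad, z]
  · rw [AffineSubspace.direction_mk']
    have hor : Orthonormal ℝ ![(b i₀ : Pt d), (b i₁ : Pt d)] := by
      rw [orthonormal_iff_ite]
      intro i j
      fin_cases i <;> fin_cases j <;> simp [n01, real_inner_comm, n0, n1]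
    have hspan := finrank_span_eq_card hor.linearIndependent
    rw [Matrix.range_cons_cons_empty, Fintype.card_fin] at hspan
    have := Submodule.finrank_add_finrank_orthogonal
      (Submodule.span ℝ {(b i₀ : Pt d), (b i₁ : Pt d)})
    rw [finrank_euclideanSpace_fin] at this
    omega
  · intro x hx
    rw [AffineSubspace.mem_mk']
    have h1 : inner ℝ (x - p) (b i₀ : Pt d) = 0 := by
      unfold quad at hx
      nlinarith [sq_nonneg (inner ℝ (x - p) (b i₀ : Pt d)), sq_nonneg (inner ℝ (x - p) (b i₁ : Pt d))]
    have h2 : inner ℝ (x - p) (b i₁ : Pt d) = 0 := by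
      unfold quad at hx
      nlinarith [sq_nonneg (inner ℝ (x - p) (b i₀ : Pt d)), sq_nonneg (inner ℝ (x - p) (b i₁ : Pt d))]
    rw [Submodule.mem_orthogonal]
    intro u hu
    obtain ⟨s, t, rfl⟩ := Submodule.mem_span_pair.1 hu
    rw [vsub_eq_sub, inner_add_left, real_inner_smul_left, real_inner_smul_left, real_inner_comm, h1,
      real_inner_comm, h2]
    simp

/-! ### Removal of the lower dimensional part of the boundary -/

lemma tendsto_cutoff {p e₁ e₂ x : Pt d} (hx : quad p e₁ e₂ x ≠ 0) :
    Tendsto (fun k : ℕ => cutoff p e₁ e₂ (1 / ((k : ℝ) + 1)) x) atTop (𝓝 1) := by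
  have hpos : 0 < quad p e₁ e₂ x := lt_of_le_of_ne (by unfold quad; positivity) hx.symm
  have h0 : Tendsto (fun k : ℕ => 2 * (1 / ((k : ℝ) + 1)) ^ 2) atTop (𝓝 0) := by
    have := (tendsto_one_div_add_atTop_nhds_zero_nat (𝕜 := ℝ)).pow 2 |>.const_mul 2
    simpa using this
  refine tendsto_const_nhds.congr' ?_
  filter_upwards [h0.eventually_lt_const hpos] with k hk
  exact (cutoff_eq_one p e₁ e₂ (by positivity) hk.le).symm

/-- Dominated convergence: the cut-offs lie between zero and one and tend to one off the subspace,
which is required to be null for `μ`. -/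
lemma tendsto_integral_cutoff {μ : Measure (Pt d)} {f : Pt d → ℝ} (hf : Integrable f μ)
    {p e₁ e₂ : Pt d} (hμ : ∀ᵐ x ∂μ, quad p e₁ e₂ x ≠ 0) :
    Tendsto (fun k : ℕ => ∫ x, cutoff p e₁ e₂ (1 / ((k : ℝ) + 1)) x * f x ∂μ) atTop
      (𝓝 (∫ x, f x ∂μ)) := by
  refine tendsto_integral_of_dominated_convergence (fun x => ‖f x‖) (fun k => ?_) hf.norm
    (fun k => Eventually.of_forall fun x => ?_) ?_
  · exact (contDiff_cutoff p e₁ e₂ _).continuous.aestronglyMeasurable.mul hf.1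
  · have := cutoff_mem_Icc p e₁ e₂ (1 / ((k : ℝ) + 1)) x
    rw [norm_mul, Real.norm_eq_abs, abs_of_nonneg this.1]
    exact mul_le_of_le_one_left (norm_nonneg _) this.2
  · filter_upwards [hμ] with x hx
    simpa using (tendsto_cutoff hx).mul_const (f x)

/-- The gradient of the cut-off function converges weakly to zero. -/
lemma tendsto_integral_gradient_cutoff {K : Set (Pt d)}
    (hb : Bornology.IsBounded K) {p e₁ e₂ : Pt d} (h1 : ‖e₁‖ = 1) (h2 : ‖e₂‖ = 1)
    (h12 : inner ℝ e₁ e₂ = 0) {v : Pt d → ℝ} (hv : MemLp v 2 (volume.restrict K)) (a : Pt d) :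
    Tendsto (fun k : ℕ => ∫ x in K, v x * inner ℝ (∇ (cutoff p e₁ e₂ (1 / ((k : ℝ) + 1))) x) a)
      atTop (𝓝 0) := by
  obtain ⟨C, hC0, hC⟩ := exists_cutoff_gradient_bound (d := d)
  obtain ⟨C', hC'0, hC'⟩ := exists_volume_quad_le (p := p) h1 h2 h12 hb
  let N : ℝ → Set (Pt d) := fun ε => {x | quad p e₁ e₂ x ≤ 2 * ε ^ 2}
  have hN : ∀ ε, MeasurableSet (N ε) := fun ε =>
    (isClosed_le (contDiff_quad p e₁ e₂).continuous continuous_const).measurableSet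
  have hvol : ∀ ε, 0 < ε → (volume.restrict K) (N ε) ≤ ENNReal.ofReal (C' * ε ^ 2) := fun ε hε => by
    rw [Measure.restrict_apply (hN ε)]; exact hC' ε hε
  let g : ℝ → Pt d → ℝ := fun ε x => inner ℝ (∇ (cutoff p e₁ e₂ ε) x) a
  have hgm : ∀ ε, AEStronglyMeasurable (g ε) (volume.restrict K) := fun ε =>
    ((memLp_of_continuous_of_isBounded (continuous_gradient (contDiff_cutoff p e₁ e₂ ε)) hb
      2).inner_const a).1
  -- the gradients are bounded in L²
  have hgb : ∀ ε, 0 < ε → eLpNorm (g ε) 2 (volume.restrict K) ≤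
      ENNReal.ofReal (C * ‖a‖ * √C') := by
    intro ε hε
    have m : eLpNorm (g ε) 2 (volume.restrict K) ≤
        eLpNorm ((N ε).indicator fun _ => C * ‖a‖ / ε) 2 (volume.restrict K) :=
      eLpNorm_mono_real fun x => hC p e₁ e₂ a ε h1 h2 hε x
    refine m.trans ?_
    rw [eLpNorm_indicator_const (hN ε) (by norm_num) (by norm_num)]
    have : (volume.restrict K) (N ε) ^ (1 / (2 : ENNReal).toReal) ≤ ENNReal.ofReal (√C' * ε) := by
      refine (ENNReal.rpow_le_rpow (hvol ε hε) (by positivity)).trans (le_of_eq ?_)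
      rw [ENNReal.ofReal_rpow_of_nonneg (by positivity) (by positivity)]
      congr 1
      rw [ENNReal.toReal_ofNat, ← Real.sqrt_eq_rpow, Real.sqrt_mul hC'0, Real.sqrt_sq hε.le]
    refine (mul_le_mul_right this _).trans (le_of_eq ?_)
    rw [Real.enorm_eq_ofReal (by positivity), ← ENNReal.ofReal_mul (by positivity)]
    congr 1
    field_simp
  rw [tendsto_zero_iff_norm_tendsto_zero]
  -- The gradient of the cut-off lives on `N ε`, so only the restriction of `v` to this set enters
  -- the product.
  have hbound : ∀ ε, 0 < ε → ‖∫ x in K, v x * g ε x‖ₑ ≤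
      eLpNorm ((N ε).indicator v) 2 (volume.restrict K) * ENNReal.ofReal (C * ‖a‖ * √C') := by
    intro ε hε
    have e : (fun x => v x * g ε x) = (N ε).indicator v • g ε := by
      ext x
      by_cases hx : x ∈ N ε
      · simp [Set.indicator_of_mem hx]
      · have := hC p e₁ e₂ a ε h1 h2 hε x
        rw [Set.indicator_of_notMem (by exact hx)] at this
        have : g ε x = 0 := abs_nonpos_iff.1 this
        simp [this]
    refine (enorm_integral_le_lintegral_enorm _).trans ?_
    rw [← eLpNorm_one_eq_lintegral_enorm, e]
    refine (eLpNorm_smul_le_mul_eLpNorm (p := 2) (q := 2) (hgm ε) (hv.1.indicator (hN ε))).trans ?_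
    exact mul_le_mul_right (hgb ε hε) _
  set D := C * ‖a‖ * √C' with hD
  have hD0 : 0 ≤ D := by positivity
  rw [Metric.tendsto_atTop]
  intro δ hδ
  -- The `L²` norm of the gradients is merely bounded, not small; smallness comes from absolute
  -- continuity of the `L²` norm of `v` on the shrinking sets. The denominator `D + 1` avoids
  -- division by zero.
  obtain ⟨η, hη, hsmall⟩ := MemLp.eLpNorm_indicator_le (p := 2) (by norm_num) (by norm_num) hv
    (ε := δ / (2 * (D + 1))) (by positivity)
  have hlim : Tendsto (fun k : ℕ => C' * (1 / ((k : ℝ) + 1)) ^ 2) atTop (𝓝 0) := by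
    have := (tendsto_one_div_add_atTop_nhds_zero_nat (𝕜 := ℝ)).pow 2 |>.const_mul C'
    simpa using this
  obtain ⟨k₀, hk₀⟩ := (eventually_atTop.1 (hlim.eventually_lt_const hη))
  refine ⟨k₀, fun k hk => ?_⟩
  have hε : 0 < 1 / ((k : ℝ) + 1) := by positivity
  have hs := hsmall (N (1 / ((k : ℝ) + 1))) (hN _)
    ((hvol _ hε).trans (ENNReal.ofReal_le_ofReal (hk₀ k hk).le))
  have hfin := (hbound _ hε).trans (mul_le_mul_left hs _)
  rw [← ENNReal.ofReal_mul (by positivity), ← ofReal_norm,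
    ENNReal.ofReal_le_ofReal_iff (by positivity)] at hfin
  rw [dist_zero_right, norm_norm]
  refine lt_of_le_of_lt hfin ?_
  rw [div_mul_eq_mul_div, div_lt_iff₀ (by positivity)]
  nlinarith

section

variable {K : Set (Pt d)} {S : Finset (Set (Pt d))} {n : Set (Pt d) → Pt d}
  {t : Set (Pt d) → Pt d → ℝ} {w : Pt d → ℝ}

lemma affineSubspace_ne_top {a : AffineSubspace ℝ (Pt d)}
    (ha : Module.finrank ℝ a.direction + 2 ≤ d) : a ≠ ⊤ := by
  rintro rfl
  rw [AffineSubspace.direction_top, finrank_top, finrank_euclideanSpace_fin] at ha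
  omega

/-- The Gauss formula extends across an affine subspace of codimension two. -/
lemma gaussDefect_eq_zero_of_affineSubspace (hK : IsPolytopeWith K S n)
    (ht : ∀ F ∈ S, HasTrace K F w (t F)) (hw : MemH1 K w) (v : Pt d)
    {a : AffineSubspace ℝ (Pt d)} (ha : Module.finrank ℝ a.direction + 2 ≤ d) {Z : Set (Pt d)}
    (h : ∀ ψ : Pt d → ℝ, ContDiff ℝ ∞ ψ → HasCompactSupport ψ → Disjoint (tsupport ψ) Z →
      Disjoint (tsupport ψ) (a : Set (Pt d)) → gaussDefect K S n t w v ψ = 0)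
    {ψ : Pt d → ℝ} (hψ : ContDiff ℝ ∞ ψ) (hc : HasCompactSupport ψ)
    (hZ : Disjoint (tsupport ψ) Z) : gaussDefect K S n t w v ψ = 0 := by
  obtain ⟨p, e₁, e₂, h1, h2, h12, hquad, a', ha', hquad'⟩ := exists_quad_eq_zero ha
  let η : ℕ → Pt d → ℝ := fun k => cutoff p e₁ e₂ (1 / ((k : ℝ) + 1))
  have hη : ∀ k, ContDiff ℝ ∞ (η k) := fun k => contDiff_cutoff p e₁ e₂ _
  have hb := hK.bounded
  -- The product with the cut-off is supported away from the subspace, so the hypothesis covers it.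
  have hzero : ∀ k, gaussDefect K S n t w v (fun x => η k x * ψ x) = 0 := by
    intro k
    refine h _ ((hη k).mul hψ) hc.mul_left (hZ.mono_left tsupport_mul_subset_right) ?_
    refine Set.disjoint_left.2 fun x hx hxa => ?_
    have hx' := tsupport_cutoff_subset p e₁ e₂ (ε := 1 / ((k : ℝ) + 1)) (by positivity)
      (tsupport_mul_subset_left hx)
    have hx'' : (1 / ((k : ℝ) + 1)) ^ 2 ≤ quad p e₁ e₂ x := hx'
    rw [hquad x hxa] at hx''
    have : 0 < (1 / ((k : ℝ) + 1)) ^ 2 := by positivity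
    linarith
  have aeK : ∀ᵐ x ∂(volume.restrict K), quad p e₁ e₂ x ≠ 0 := by
    refine ae_restrict_of_ae ?_
    refine measure_mono_null ?_ (Measure.addHaar_affineSubspace volume a' (affineSubspace_ne_top ha'))
    intro x hx
    exact hquad' x (not_not.1 hx)
  have aeF : ∀ F ∈ S, ∀ᵐ x ∂(surf F), quad p e₁ e₂ x ≠ 0 := by
    intro F hF
    refine measure_mono_null ?_ ((hK.flatFace F hF).surf_affineSubspace ha')
    intro x hx
    exact hquad' x (not_not.1 hx)
  have mψ := memLp_of_continuous_of_isBounded hψ.continuous hb 2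
  have mg := (memLp_of_continuous_of_isBounded (continuous_gradient hψ) hb 2).inner_const
    (𝕜 := ℝ) v
  have mw := hw.hasWeakGrad.memLp
  have l1 := tendsto_integral_cutoff (p := p) (e₁ := e₁) (e₂ := e₂) (mw.integrable_mul mg) aeK
  have mwψ : MemLp (fun x => w x * ψ x) 2 (volume.restrict K) := by
    obtain ⟨B, hB⟩ := (show IsCompact (tsupport ψ) from hc).exists_bound_of_continuousOn
      hψ.continuous.continuousOn
    refine MemLp.of_le_mul (c := max B 0) mw (mw.1.mul hψ.continuous.aestronglyMeasurable)
      (Eventually.of_forall fun x => ?_)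
    rw [norm_mul, mul_comm]
    gcongr
    by_cases hx : x ∈ tsupport ψ
    · exact (hB x hx).trans (le_max_left _ _)
    · rw [image_eq_zero_of_notMem_tsupport hx]; simp
  -- The only term without a counterpart in the limit: the one where the derivative falls on the
  -- cut-off.
  have l2 := tendsto_integral_gradient_cutoff (p := p) hb h1 h2 h12 mwψ v
  have l3 := tendsto_integral_cutoff (p := p) (e₁ := e₁) (e₂ := e₂)
    (mψ.integrable_mul (hw.hasWeakGrad.memLp_grad.inner_const (𝕜 := ℝ) v)) aeK
  have l4 : Tendsto (fun k : ℕ => ∑ F ∈ S, inner ℝ v (n F) * ∫ x, η k x * (t F x * ψ x) ∂(surf F))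
      atTop (𝓝 (∑ F ∈ S, inner ℝ v (n F) * ∫ x, t F x * ψ x ∂(surf F))) := by
    refine tendsto_finsetSum _ fun F hF => Tendsto.const_mul _ ?_
    exact tendsto_integral_cutoff (((ht F hF).2.1).integrable_mul
      (memLp_face (hK.flatFace F hF) hψ.continuous 2)) (aeF F hF)
  have hlim := ((l1.add l2).add l3).sub l4
  rw [add_zero] at hlim
  have hcongr : ∀ k, gaussDefect K S n t w v (fun x => η k x * ψ x) =
      (∫ x in K, η k x * ((fun x => w x) * fun x => inner ℝ (∇ ψ x) v) x) +
      (∫ x in K, w x * ψ x * inner ℝ (∇ (η k) x) v) +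
      (∫ x in K, η k x * ((fun x => ψ x) * fun x => inner ℝ (weakGrad K w x) v) x) -
      ∑ F ∈ S, inner ℝ v (n F) * ∫ x, η k x * (t F x * ψ x) ∂(surf F) := by
    intro k
    have mη := memLp_of_continuous_of_isBounded (continuous_gradient (hη k)) hb 2
    have i1 : Integrable (fun x => w x * ψ x * inner ℝ (∇ (η k) x) v) (volume.restrict K) :=
      mwψ.integrable_mul (mη.inner_const v)
    have i2 : Integrable (fun x => η k x * (w x * inner ℝ (∇ ψ x) v)) (volume.restrict K) := by
      have hm : MemLp (fun x => η k x * inner ℝ (∇ ψ x) v) 2 (volume.restrict K) := by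
        refine memLp_of_continuous_of_isBounded ?_ hb 2
        exact (hη k).continuous.mul ((continuous_gradient hψ).inner continuous_const)
      refine (mw.integrable_mul hm).congr (Eventually.of_forall fun x => ?_)
      simp only [Pi.mul_apply]; ring
    simp only [gaussDefect, Pi.mul_apply]
    rw [← integral_add i2 i1]
    congr 1
    · congr 1
      · refine integral_congr_ae (Eventually.of_forall fun x => ?_)
        simp only [gradient_mul' (hη k) hψ, inner_add_left, real_inner_smul_left]
        ring
      · refine integral_congr_ae (Eventually.of_forall fun x => ?_)
        simp only; ring
    · refine Finset.sum_congr rfl fun F _ => ?_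
      congr 1
      refine integral_congr_ae (Eventually.of_forall fun x => ?_)
      simp only; ring
  exact tendsto_nhds_unique hlim
    ((tendsto_const_nhds (x := (0 : ℝ))).congr fun k => (hzero k).symm.trans (hcongr k))

/-- **Gauss formula** on a polytope, for functions with traces on the faces. -/
theorem IsPolytopeWith.integral_weakGrad (hK : IsPolytopeWith K S n)
    (ht : ∀ F ∈ S, HasTrace K F w (t F)) (hw : MemH1 K w) (a : Pt d) :
    ∫ x in K, inner ℝ (weakGrad K w x) a = ∑ F ∈ S, inner ℝ a (n F) * ∫ x, t F x ∂(surf F) := by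
  classical
  have hA : ∃ A : Finset (AffineSubspace ℝ (Pt d)),
      (∀ a ∈ A, Module.finrank ℝ a.direction + 2 ≤ d) ∧
      ∀ F ∈ S, closure F \ F ⊆ ⋃ a ∈ A, (a : Set (Pt d)) := by
    choose! B hB hB' using fun F (hF : F ∈ S) => (hK.flatFace F hF).bdry
    refine ⟨S.biUnion B, fun a ha => ?_, fun F hF x hx => ?_⟩
    · obtain ⟨F, hF, haF⟩ := Finset.mem_biUnion.1 ha
      exact hB F hF a haF
    · obtain ⟨a, ha, hxa⟩ := Set.mem_iUnion₂.1 (hB' F hF hx)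
      exact Set.mem_iUnion₂.2 ⟨a, Finset.mem_biUnion.2 ⟨F, hF, ha⟩, hxa⟩
  obtain ⟨A, hAc, hA⟩ := hA
  -- Test functions are first kept away from all exceptional subspaces; induction on `B` then admits
  -- these one at a time.
  have key : ∀ B ⊆ A, ∀ ψ : Pt d → ℝ, ContDiff ℝ ∞ ψ → HasCompactSupport ψ →
      Disjoint (tsupport ψ) (⋃ a ∈ A \ B, (a : Set (Pt d))) → gaussDefect K S n t w a ψ = 0 := by
    intro B
    induction B using Finset.induction_on with
    | empty =>
      intro _ ψ hψ hc hdisj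
      refine gaussDefect_eq_zero_of_disjoint hK ht hw a hψ hc fun x hx hxf => ?_
      rw [hK.frontier_eq] at hxf
      obtain ⟨F, hF, hxF⟩ := Set.mem_iUnion₂.1 hxf
      by_contra hcon
      push Not at hcon
      have := hA F hF ⟨hxF, hcon F hF⟩
      rw [Finset.sdiff_empty] at hdisj
      exact Set.disjoint_left.1 hdisj hx this
    | insert b B hb ih =>
      intro hBA ψ hψ hc hdisj
      refine gaussDefect_eq_zero_of_affineSubspace hK ht hw a
        (hAc b (hBA (Finset.mem_insert_self b B))) (fun φ hφ hcφ hZ hb' => ?_) hψ hc hdisj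
      refine ih ((Finset.subset_insert b B).trans hBA) φ hφ hcφ ?_
      refine Set.disjoint_left.2 fun x hx hxU => ?_
      obtain ⟨c, hc', hxc⟩ := Set.mem_iUnion₂.1 hxU
      rw [Finset.mem_sdiff] at hc'
      by_cases hcb : c = b
      · exact Set.disjoint_left.1 hb' hx (hcb ▸ hxc)
      · refine Set.disjoint_left.1 hZ hx (Set.mem_iUnion₂.2 ⟨c, ?_, hxc⟩)
        simp [hc'.1, hc'.2, hcb]
  obtain ⟨R, hR⟩ := hK.bounded.subset_ball 0
  -- A bump function equal to one on the closure of `K` plays the role of the test function `1`,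
  -- which has no compact support.
  let f : ContDiffBump (0 : Pt d) := ⟨|R| + 1, |R| + 2, by positivity, by linarith⟩
  have hf1 : ∀ x ∈ closure K, f x = 1 := by
    intro x hx
    refine f.one_of_mem_closedBall ?_
    have : closure K ⊆ Metric.closedBall 0 R :=
      closure_minimal (hR.trans Metric.ball_subset_closedBall) Metric.isClosed_closedBall
    refine Metric.closedBall_subset_closedBall ?_ (this hx)
    change R ≤ |R| + 1
    linarith [le_abs_self R]
  have hg := key A subset_rfl f f.contDiff f.hasCompactSupport (by simp)
  have hgrad : ∀ x ∈ K, ∇ (f : Pt d → ℝ) x = 0 := by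
    intro x hx
    have : (f : Pt d → ℝ) =ᶠ[𝓝 x] fun _ => 1 := by
      filter_upwards [hK.isOpen.mem_nhds hx] with y hy
      exact hf1 y (subset_closure hy)
    simp [gradient, this.fderiv_eq]
  rw [gaussDefect, setIntegral_eq_zero_of_forall_eq_zero (fun x hx => by
    rw [hgrad x hx, inner_zero_left, mul_zero]), zero_add, sub_eq_zero] at hg
  have e1 : ∫ x in K, f x * inner ℝ (weakGrad K w x) a = ∫ x in K, inner ℝ (weakGrad K w x) a :=
    setIntegral_congr_fun hK.isOpen.measurableSet fun x hx => by
      simp only [hf1 x (subset_closure hx), one_mul]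
  rw [← e1, hg]
  refine Finset.sum_congr rfl fun F hF => ?_
  congr 1
  refine integral_congr_ae ?_
  filter_upwards [(hK.flatFace F hF).ae_mem] with x hx
  have : x ∈ closure K := frontier_subset_closure (by
    rw [hK.frontier_eq]; exact Set.mem_iUnion₂.2 ⟨F, hF, subset_closure hx⟩)
  rw [hf1 x this, mul_one]

end

/-! ### Geometry of polytopes and meshes -/

lemma IsPolytopeWith.face_subset_frontier {K : Set (Pt d)} {S : Finset (Set (Pt d))}
    {n : Set (Pt d) → Pt d} (h : IsPolytopeWith K S n) {F : Set (Pt d)} (hF : F ∈ S) :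
    F ⊆ frontier K := by
  rw [h.frontier_eq]
  exact subset_closure.trans (Set.subset_biUnion_of_mem (u := fun F => closure F) hF)

/-- The open faces are dense in the boundary, and near a point of an open face the outer half ball
misses `K`; so no boundary point is interior to the closure. This rules out slits. -/
lemma IsPolytopeWith.interior_closure {K : Set (Pt d)} {S : Finset (Set (Pt d))}
    {n : Set (Pt d) → Pt d} (h : IsPolytopeWith K S n) : interior (closure K) = K := by
  refine Set.Subset.antisymm (fun x hx => ?_) (h.isOpen.subset_interior_iff.2 subset_closure)
  by_contra hxK
  have hxf : x ∈ frontier K := by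
    rw [h.isOpen.frontier_eq]; exact ⟨interior_subset hx, hxK⟩
  rw [h.frontier_eq] at hxf
  obtain ⟨F, hF, hxF⟩ := Set.mem_iUnion₂.1 hxf
  obtain ⟨y, hy, hyF⟩ := mem_closure_iff.1 hxF _ isOpen_interior hx
  obtain ⟨r, hr, hside⟩ := h.oneSided F hF y hyF
  have hO : IsOpen (interior (closure K) ∩ Metric.ball y r) :=
    isOpen_interior.inter Metric.isOpen_ball
  have hc : Tendsto (fun s : ℝ => y + s • n F) (𝓝[>] 0) (𝓝 y) := by
    have : Continuous (fun s : ℝ => y + s • n F) := by fun_prop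
    have h1 := (this.tendsto 0).mono_left (nhdsWithin_le_nhds (s := Set.Ioi 0))
    simpa using h1
  obtain ⟨s, hs, hs0⟩ := ((hc.eventually (hO.mem_nhds ⟨hy, Metric.mem_ball_self hr⟩)).and
    self_mem_nhdsWithin).exists
  have hs0 : 0 < s := hs0
  have hpos : 0 < inner ℝ (y + s • n F - y) (n F) := by
    simp [real_inner_smul_left, (h.flatFace F hF).unit, hs0]
  have hopen : IsOpen (Metric.ball y r ∩ {z | 0 < inner ℝ (z - y) (n F)}) :=
    Metric.isOpen_ball.inter (isOpen_lt continuous_const (by fun_prop))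
  obtain ⟨z, hz, hzK⟩ := mem_closure_iff.1 (interior_subset hs.1) _ hopen ⟨hs.2, hpos⟩
  exact lt_asymm hz.2 ((hside z hz.1).1 hzK)

/-- The component of `n'` orthogonal to `n` is a direction along the face, because the face is
relatively open. Hence it is orthogonal to `n'` as well, and therefore zero. -/
lemma IsFlatFace.normal_eq_or_neg {F : Set (Pt d)} {n n' : Pt d} (h : IsFlatFace F n)
    (h' : IsFlatFace F n') : n' = n ∨ n' = -n := by
  obtain ⟨x, hx⟩ := h.connected.nonempty
  obtain ⟨r, hr, hb⟩ := h.relOpen x hx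
  set v := n' - (inner ℝ n' n : ℝ) • n with hv
  have hvn : inner ℝ v n = 0 := by
    rw [hv, inner_sub_left, real_inner_smul_left, real_inner_self_eq_norm_sq, h.unit]; ring
  have hvn' : inner ℝ v n' = 0 := by
    set s := r / (2 * (‖v‖ + 1)) with hs
    have hs0 : 0 < s := by positivity
    have hmem : x + s • v ∈ F := by
      refine hb _ ?_ ?_
      · rw [Metric.mem_ball, dist_eq_norm, add_sub_cancel_left, norm_smul, Real.norm_eq_abs,
          abs_of_pos hs0, hs, div_mul_eq_mul_div, div_lt_iff₀ (by positivity)]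
        nlinarith [norm_nonneg v]
      · simp [real_inner_smul_left, hvn]
    have := h'.flat x hx _ hmem
    rw [add_sub_cancel_left, real_inner_smul_left] at this
    exact (mul_eq_zero.1 this).resolve_left hs0.ne'
  have hv0 : v = 0 := by
    have : inner ℝ v v = 0 := by
      nth_rewrite 2 [hv]
      rw [inner_sub_right, hvn', inner_smul_right, hvn]; simp
    exact inner_self_eq_zero.1 this
  have he : n' = (inner ℝ n' n : ℝ) • n := sub_eq_zero.1 hv0
  have habs : |(inner ℝ n' n : ℝ)| = 1 := by
    have := congrArg norm he
    rw [norm_smul, h.unit, h'.unit, mul_one] at this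
    exact this.symm
  rcases (abs_eq zero_le_one).1 habs with h1 | h1
  · left; rw [he, h1, one_smul]
  · right; rw [he, h1, neg_one_smul]

/-! ### Shared faces, patches and the skeleton of a mesh -/

section Mesh

variable {Ω : Set (Pt d)} (T : Mesh Ω)

/-- With equal outward normals, both elements would contain the same half ball at a point of the
face, against disjointness. -/
lemma Mesh.normal_eq_neg {K K' F : Set (Pt d)} (hK : K ∈ T.cells) (hK' : K' ∈ T.cells)
    (hne : K ≠ K') (hF : F ∈ T.faces K) (hF' : F ∈ T.faces K') :
    T.normal K' F = -T.normal K F := by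
  have p := T.polytope K hK
  have p' := T.polytope K' hK'
  rcases (p.flatFace F hF).normal_eq_or_neg (p'.flatFace F hF') with h | h
  · exfalso
    obtain ⟨x, hx⟩ := (p.flatFace F hF).connected.nonempty
    obtain ⟨r, hr, hs⟩ := p.oneSided F hF x hx
    obtain ⟨r', hr', hs'⟩ := p'.oneSided F hF' x hx
    rw [h] at hs'
    set ρ := min r r' / 2 with hρ
    have hρ0 : 0 < ρ := by positivity
    have hlt : ρ < min r r' := by rw [hρ]; linarith [lt_min hr hr']
    set y := x - ρ • T.normal K F with hy
    have hd : dist y x = ρ := by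
      rw [dist_eq_norm, hy, sub_sub_cancel_left, norm_neg, norm_smul, (p.flatFace F hF).unit,
        Real.norm_eq_abs, abs_of_pos hρ0, mul_one]
    have hneg : inner ℝ (y - x) (T.normal K F) < 0 := by
      rw [hy, sub_sub_cancel_left, inner_neg_left, real_inner_smul_left,
        real_inner_self_eq_norm_sq, (p.flatFace F hF).unit]
      linarith
    have h1 : y ∈ K := (hs y (by rw [Metric.mem_ball, hd]; exact hlt.trans_le (min_le_left _ _))).2 hneg
    have h2 : y ∈ K' :=
      (hs' y (by rw [Metric.mem_ball, hd]; exact hlt.trans_le (min_le_right _ _))).2 hneg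
    exact Set.disjoint_left.1 (T.disjoint K hK K' hK' hne) h1 h2
  · exact h

/-- A face is shared by at most two elements. -/
lemma Mesh.eq_of_mem_faces {K K' K'' F : Set (Pt d)} (hK : K ∈ T.cells) (hK' : K' ∈ T.cells)
    (hK'' : K'' ∈ T.cells) (hF : F ∈ T.faces K) (hF' : F ∈ T.faces K') (hF'' : F ∈ T.faces K'')
    (h1 : K' ≠ K) (h2 : K'' ≠ K) : K' = K'' := by
  by_contra hne
  -- Three unit normals cannot be pairwise opposite.
  have e1 := T.normal_eq_neg hK hK' h1.symm hF hF'
  have e2 := T.normal_eq_neg hK hK'' h2.symm hF hF''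
  have e3 := T.normal_eq_neg hK' hK'' hne hF' hF''
  rw [e1, e2, neg_neg] at e3
  have h0 : T.normal K F = 0 := by
    have h3 : (2 : ℝ) • T.normal K F = 0 := by
      rw [two_smul]; nth_rewrite 1 [← e3]; exact neg_add_cancel _
    exact (smul_eq_zero.1 h3).resolve_left two_ne_zero
  have := ((T.polytope K hK).flatFace F hF).unit
  rw [h0] at this; simp at this

/-- Near a shared face there are only the two elements. -/
lemma Mesh.exists_ball_subset {K K' F : Set (Pt d)} (hK : K ∈ T.cells) (hK' : K' ∈ T.cells)
    (hne : K ≠ K') (hF : F ∈ T.faces K) (hF' : F ∈ T.faces K') {x : Pt d} (hx : x ∈ F) :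
    ∃ r > 0, Metric.ball x r ⊆ K ∪ K' ∪ F := by
  have p := T.polytope K hK
  have p' := T.polytope K' hK'
  obtain ⟨r, hr, hs⟩ := p.oneSided F hF x hx
  obtain ⟨r', hr', hs'⟩ := p'.oneSided F hF' x hx
  obtain ⟨r'', hr'', hs''⟩ := (p.flatFace F hF).relOpen x hx
  rw [T.normal_eq_neg hK hK' hne hF hF'] at hs'
  refine ⟨min r (min r' r''), lt_min hr (lt_min hr' hr''), fun y hy => ?_⟩
  have hy := Metric.mem_ball.1 hy
  rw [lt_min_iff, lt_min_iff] at hy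
  rcases lt_trichotomy (inner ℝ (y - x) (T.normal K F)) 0 with h | h | h
  · exact Or.inl (Or.inl ((hs y hy.1).2 h))
  · exact Or.inr (hs'' y hy.2.2 h)
  · refine Or.inl (Or.inr ((hs' y hy.2.1).2 ?_))
    rw [inner_neg_right]; linarith

lemma Mesh.face_subset_closure {K F : Set (Pt d)} (hK : K ∈ T.cells) (hF : F ∈ T.faces K) :
    F ⊆ closure K :=
  ((T.polytope K hK).face_subset_frontier hF).trans frontier_subset_closure

lemma Mesh.subset_patch {A : Finset (Set (Pt d))} (hA : A ⊆ T.cells) {K : Set (Pt d)}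
    (hK : K ∈ A) : K ⊆ patch A := by
  refine (T.polytope K (hA hK)).isOpen.subset_interior_iff.2 ?_
  exact subset_closure.trans (Set.subset_biUnion_of_mem (u := fun K => closure K) hK)

/-- The patch is an open subset of the closure of `Ω`, and the polytope `Ω` is the interior of its
closure. -/
lemma Mesh.patch_subset (hΩ : IsPolytope Ω) {A : Finset (Set (Pt d))} (hA : A ⊆ T.cells) :
    patch A ⊆ Ω := by
  obtain ⟨S, n, h⟩ := hΩ
  rw [← h.interior_closure]
  refine interior_mono ?_
  exact Set.iUnion₂_subset fun K hK => closure_mono (T.subset K (hA hK))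

lemma isClosed_biUnion_closure (A : Finset (Set (Pt d))) : IsClosed (⋃ K ∈ A, closure K) :=
  A.finite_toSet.isClosed_biUnion fun _ _ => isClosed_closure

lemma isBounded_biUnion_closure {A : Finset (Set (Pt d))} (hA : A ⊆ T.cells) :
    Bornology.IsBounded (⋃ K ∈ A, closure K) :=
  (Bornology.isBounded_biUnion_finset A).2 fun K hK =>
    (T.polytope K (hA hK)).bounded.closure

lemma Mesh.isBounded_patch {A : Finset (Set (Pt d))} (hA : A ⊆ T.cells) :
    Bornology.IsBounded (patch A) := (isBounded_biUnion_closure T hA).subset interior_subset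

/-- Passing from elements to their closures adds no volume, since the boundary of a polytope is
null. -/
lemma Mesh.volume_patch_le {A : Finset (Set (Pt d))} (hA : A ⊆ T.cells) :
    volume.real (patch A) ≤ ∑ K ∈ A, volume.real K := by
  refine (measureReal_mono interior_subset
    (isBounded_biUnion_closure T hA).measure_lt_top.ne).trans ?_
  refine (measureReal_biUnion_finset_le A _).trans (Finset.sum_le_sum fun K hK => ?_)
  rw [measureReal_def, measureReal_def, (T.polytope K (hA hK)).volume_closure]

/-- A face of an element of a patch that meets the boundary of the patch is an outer face. -/
lemma Mesh.mem_outerFaces (hΩ : IsPolytope Ω) {A : Finset (Set (Pt d))} (hA : A ⊆ T.cells)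
    {K F : Set (Pt d)} (hK : K ∈ A) (hF : F ∈ T.faces K) {x : Pt d} (hx : x ∈ F)
    (hxf : x ∈ frontier (patch A)) : F ∈ T.outerFaces A K := by
  classical
  have hpo : IsOpen (patch A) := isOpen_interior
  have hcl : F ⊆ closure (patch A) :=
    (T.face_subset_closure (hA hK) hF).trans (closure_mono (T.subset_patch hA hK))
  -- A face either lies on the patch boundary or inside the patch, according to whether its second
  -- element belongs to `A`. If it does, the two elements fill a ball around `x`, which is then
  -- interior.
  suffices hd : Disjoint F (patch A) by
    refine Finset.mem_filter.2 ⟨hF, fun y hy => ?_⟩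
    rw [hpo.frontier_eq]
    exact ⟨hcl hy, Set.disjoint_left.1 hd hy⟩
  rw [hpo.frontier_eq] at hxf
  rcases T.conforming K (hA hK) F hF with h | ⟨K', hK', hne, hF'⟩
  · obtain ⟨S, n, hp⟩ := id hΩ
    refine Set.disjoint_left.2 fun y hy hyp => ?_
    have := h hy
    rw [hp.isOpen.frontier_eq] at this
    exact this.2 (T.patch_subset hΩ hA hyp)
  · by_cases hKA : K' ∈ A
    · exfalso
      obtain ⟨r, hr, hball⟩ := T.exists_ball_subset (hA hK) hK' hne.symm hF hF' hx
      refine hxf.2 (mem_interior.2 ⟨Metric.ball x r, ?_, Metric.isOpen_ball,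
        Metric.mem_ball_self hr⟩)
      intro y hy
      rcases hball hy with (h | h) | h
      · exact Set.mem_iUnion₂.2 ⟨K, hK, subset_closure h⟩
      · exact Set.mem_iUnion₂.2 ⟨K', hKA, subset_closure h⟩
      · exact Set.mem_iUnion₂.2 ⟨K, hK, T.face_subset_closure (hA hK) hF h⟩
    · refine Set.disjoint_left.2 fun y hy hyp => ?_
      -- A point of the face inside the patch would make `K'` meet the patch, hence meet an element
      -- of `A` other than itself.
      obtain ⟨z, hz, hzK⟩ := mem_closure_iff.1 (T.face_subset_closure hK' hF' hy) _ hpo hyp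
      obtain ⟨K₁, hK₁, hzK₁⟩ := Set.mem_iUnion₂.1 (interior_subset hz)
      obtain ⟨z', hz', hz'K₁⟩ := mem_closure_iff.1 hzK₁ _ (T.polytope K' hK').isOpen hzK
      have hne' : K' ≠ K₁ := fun h => hKA (h ▸ hK₁)
      exact Set.disjoint_left.1 (T.disjoint K' hK' K₁ (hA hK₁) hne') hz' hz'K₁

/-- The codimension two subspaces that contain the relative boundaries of the faces. -/
lemma Mesh.exists_skeleton {A : Finset (Set (Pt d))} (hA : A ⊆ T.cells) :
    ∃ Z : Finset (AffineSubspace ℝ (Pt d)),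
      (∀ a ∈ Z, Module.finrank ℝ a.direction + 2 ≤ d) ∧
      ∀ K ∈ A, ∀ x ∈ frontier K, (∀ a ∈ Z, x ∉ a) → ∃ F ∈ T.faces K, x ∈ F := by
  classical
  have hb : ∀ K ∈ A, ∀ F ∈ T.faces K, _ := fun K hK F hF =>
    ((T.polytope K (hA hK)).flatFace F hF).bdry
  choose! B hB hB' using hb
  refine ⟨A.biUnion fun K => (T.faces K).biUnion (B K), ?_, ?_⟩
  · intro a ha
    obtain ⟨K, hK, ha⟩ := Finset.mem_biUnion.1 ha
    obtain ⟨F, hF, ha⟩ := Finset.mem_biUnion.1 ha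
    exact hB K hK F hF a ha
  · intro K hK x hx hxZ
    rw [(T.polytope K (hA hK)).frontier_eq] at hx
    obtain ⟨F, hF, hxF⟩ := Set.mem_iUnion₂.1 hx
    refine ⟨F, hF, ?_⟩
    by_contra hcon
    obtain ⟨a, ha, hxa⟩ := Set.mem_iUnion₂.1 (hB' K hK F hF ⟨hxF, hcon⟩)
    exact hxZ a (Finset.mem_biUnion.2 ⟨K, hK, Finset.mem_biUnion.2 ⟨F, hF, ha⟩⟩) hxa

/-- A patch has at least one outer face. -/
lemma Mesh.exists_outerFace (hd : 0 < d) (hΩ : IsPolytope Ω) {A : Finset (Set (Pt d))}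
    (hA : A ⊆ T.cells) (hp : IsPolytope (patch A)) : ∃ K ∈ A, (T.outerFaces A K).Nonempty := by
  obtain ⟨S, n, hS⟩ := hp
  have : Nonempty (Fin d) := ⟨⟨0, hd⟩⟩
  have hfr : (frontier (patch A)).Nonempty := by
    rw [Set.nonempty_iff_ne_empty]
    intro h0
    have hclopen : IsClopen (patch A) := isClopen_iff_frontier_eq_empty.2 h0
    have huniv := hclopen.eq_univ hS.connected.nonempty
    have := hS.bounded
    rw [huniv] at this
    exact NormedSpace.unbounded_univ ℝ (Pt d) this
  obtain ⟨x, hx⟩ := hfr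
  rw [hS.frontier_eq] at hx
  obtain ⟨F', hF', -⟩ := Set.mem_iUnion₂.1 hx
  obtain ⟨Z, hZ, hZA⟩ := T.exists_skeleton hA
  have hface := hS.flatFace F' hF'
  have hfin := hface.isFiniteMeasure
  -- `F'` is a face of the patch as a polytope, not necessarily of the mesh. It has positive area
  -- while the skeleton has none, so some point of it avoids the skeleton and therefore lies on an
  -- open mesh face.
  have hnull : ∀ᵐ y ∂(surf F'), ∀ a ∈ Z, y ∉ a := by
    rw [Filter.eventually_all_finset]
    intro a ha
    exact measure_eq_zero_iff_ae_notMem.1 (hface.surf_affineSubspace (hZ a ha))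
  have hne : (ae (surf F')).NeBot := by
    rw [ae_neBot]
    intro h0
    have := hface.surf_pos
    rw [h0] at this; simp at this
  obtain ⟨y, hyF', hyZ⟩ := (hface.ae_mem.and hnull).exists
  have hyfr : y ∈ frontier (patch A) := hS.face_subset_frontier hF' hyF'
  have hyfr' := hyfr
  rw [hS.isOpen.frontier_eq] at hyfr
  have hcl : closure (patch A) ⊆ ⋃ K ∈ A, closure K :=
    closure_minimal interior_subset (isClosed_biUnion_closure A)
  obtain ⟨K, hK, hyK⟩ := Set.mem_iUnion₂.1 (hcl hyfr.1)
  have hyKf : y ∈ frontier K := by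
    rw [(T.polytope K (hA hK)).isOpen.frontier_eq]
    exact ⟨hyK, fun h => hyfr.2 (T.subset_patch hA hK h)⟩
  obtain ⟨F, hF, hyF⟩ := hZA K hK y hyKf hyZ
  exact ⟨K, hK, F, T.mem_outerFaces hΩ hA hK hF hyF hyfr'⟩

end Mesh

/-! ### Overlap of the patches -/

/-- Two points of a nonempty open set are joined by two segments that avoid a finite set of affine
subspaces of codimension two. -/
lemma exists_segments_avoid {Z : Finset (AffineSubspace ℝ (Pt d))}
    (hZ : ∀ a ∈ Z, Module.finrank ℝ a.direction + 2 ≤ d) {B : Set (Pt d)} (hB : IsOpen B)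
    (hne : B.Nonempty) {p q : Pt d} (hp : ∀ a ∈ Z, p ∉ a) (hq : ∀ a ∈ Z, q ∉ a) :
    ∃ z ∈ B, (∀ x ∈ segment ℝ p z, ∀ a ∈ Z, x ∉ a) ∧ ∀ x ∈ segment ℝ z q, ∀ a ∈ Z, x ∉ a := by
  -- A segment from `p` to `z` can hit `a` only if `z` lies in the span of `p` and `a`, whose
  -- dimension is at most `d - 1`. Almost every `z` avoids these finitely many null sets.
  have hspan : ∀ p : Pt d, ∀ a ∈ Z, ∀ᵐ z : Pt d,
      z ∉ affineSpan ℝ (insert p (a : Set (Pt d))) := by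
    intro p a ha
    refine measure_eq_zero_iff_ae_notMem.1 (Measure.addHaar_affineSubspace volume _ fun h => ?_)
    have h1 := finrank_vectorSpan_insert_le a p
    rw [← direction_affineSpan, h, AffineSubspace.direction_top, finrank_top,
      finrank_euclideanSpace_fin] at h1
    have := hZ a ha
    omega
  have hall : ∀ᵐ z : Pt d, ∀ a ∈ Z, z ∉ affineSpan ℝ (insert p (a : Set (Pt d))) ∧
      z ∉ affineSpan ℝ (insert q (a : Set (Pt d))) := by
    rw [Filter.eventually_all_finset]
    exact fun a ha => (hspan p a ha).and (hspan q a ha)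
  have hfreq : ∃ᵐ z : Pt d, z ∈ B := by
    rw [frequently_ae_mem_iff]
    exact (hB.measure_pos volume hne).ne'
  obtain ⟨z, hzB, hz⟩ := (hfreq.and_eventually hall).exists
  have key : ∀ p : Pt d, (∀ a ∈ Z, p ∉ a) →
      (∀ a ∈ Z, z ∉ affineSpan ℝ (insert p (a : Set (Pt d)))) →
      ∀ x ∈ segment ℝ p z, ∀ a ∈ Z, x ∉ a := by
    intro p hp hz x hx a ha hxa
    rw [segment_eq_image_lineMap] at hx
    obtain ⟨t, ht, rfl⟩ := hx
    have ht0 : t ≠ 0 := by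
      rintro rfl
      simp only [AffineMap.lineMap_apply_zero] at hxa
      exact hp a ha hxa
    refine hz a ha ?_
    have h1 : p ∈ affineSpan ℝ (insert p (a : Set (Pt d))) :=
      subset_affineSpan ℝ _ (Set.mem_insert _ _)
    have h2 : AffineMap.lineMap p z t ∈ affineSpan ℝ (insert p (a : Set (Pt d))) :=
      subset_affineSpan ℝ _ (Set.mem_insert_of_mem _ hxa)
    -- Both `p` and the point hit lie in the span, and `z` is recovered on their line with the
    -- inverse parameter.
    have h3 := AffineMap.lineMap_mem t⁻¹ h1 h2
    have h4 : AffineMap.lineMap p (AffineMap.lineMap p z t) t⁻¹ = z := by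
      simp [AffineMap.lineMap_apply, smul_smul, inv_mul_cancel₀ ht0]
    rwa [h4] at h3
  refine ⟨z, hzB, key p hp fun a ha => (hz a ha).1, ?_⟩
  rw [segment_symm]
  exact key q hq fun a ha => (hz a ha).2

section Mesh

variable {Ω : Set (Pt d)} (T : Mesh Ω)

/-- The elements of a patch are connected through faces. -/
lemma Mesh.exists_shared_face {A S : Finset (Set (Pt d))} (hA : A ⊆ T.cells)
    (hp : IsPreconnected (patch A)) (hSA : S ⊆ A) (hS : S.Nonempty) (hS' : ∃ K ∈ A, K ∉ S) :
    ∃ K ∈ S, ∃ K' ∈ A, K' ∉ S ∧ ∃ F ∈ T.faces K, F ∈ T.faces K' := by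
  classical
  by_contra hcon
  push Not at hcon
  obtain ⟨Z, hZ, hZA⟩ := T.exists_skeleton hA
  set U := ⋃ K ∈ S, closure K with hU
  set V := ⋃ K ∈ A \ S, closure K with hV
  have hUV : ∀ y ∈ patch A, y ∈ U ∨ y ∈ V := by
    intro y hy
    obtain ⟨K, hK, hyK⟩ := Set.mem_iUnion₂.1 (interior_subset hy)
    by_cases hKS : K ∈ S
    · exact Or.inl (Set.mem_iUnion₂.2 ⟨K, hKS, hyK⟩)
    · exact Or.inr (Set.mem_iUnion₂.2 ⟨K, Finset.mem_sdiff.2 ⟨hK, hKS⟩, hyK⟩)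
  -- Off the skeleton, a common point of the closures of two elements lies on an open face of each.
  -- Distinct faces are disjoint, so the face is shared, which was excluded.
  have hdisj : ∀ y, (∀ a ∈ Z, y ∉ a) → y ∈ U → y ∈ V → False := by
    intro y hyZ hyU hyV
    obtain ⟨K, hK, hyK⟩ := Set.mem_iUnion₂.1 hyU
    obtain ⟨K', hK', hyK'⟩ := Set.mem_iUnion₂.1 hyV
    rw [Finset.mem_sdiff] at hK'
    have hne : K ≠ K' := fun h => hK'.2 (h ▸ hK)
    have hKc := hA (hSA hK)
    have hKc' := hA hK'.1
    have hdis := T.disjoint K hKc K' hKc' hne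
    have f1 : y ∈ frontier K := by
      rw [(T.polytope K hKc).isOpen.frontier_eq]
      refine ⟨hyK, fun h => ?_⟩
      obtain ⟨z, hz, hz'⟩ := mem_closure_iff.1 hyK' _ (T.polytope K hKc).isOpen h
      exact Set.disjoint_left.1 hdis hz hz'
    have f2 : y ∈ frontier K' := by
      rw [(T.polytope K' hKc').isOpen.frontier_eq]
      refine ⟨hyK', fun h => ?_⟩
      obtain ⟨z, hz, hz'⟩ := mem_closure_iff.1 hyK _ (T.polytope K' hKc').isOpen h
      exact Set.disjoint_left.1 hdis hz' hz
    obtain ⟨F, hF, hyF⟩ := hZA K (hSA hK) y f1 hyZ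
    obtain ⟨F', hF', hyF'⟩ := hZA K' hK'.1 y f2 hyZ
    have hFF : F = F' := by
      by_contra h
      exact Set.disjoint_left.1 (T.faces_disjoint K hKc K' hKc' F hF F' hF' h) hyF hyF'
    exact hcon K hK K' hK'.1 hK'.2 F hF (hFF ▸ hF')
  have meets : ∀ K ∈ A, (patch A ∩ closure K).Nonempty := fun K hK => by
    obtain ⟨y, hy⟩ := (T.polytope K (hA hK)).connected.nonempty
    exact ⟨y, T.subset_patch hA hK hy, subset_closure hy⟩
  obtain ⟨K₁, hK₁⟩ := hS
  obtain ⟨K₂, hK₂, hK₂S⟩ := hS'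
  obtain ⟨x, hxp, hxU, hxV⟩ := isPreconnected_closed_iff.1 hp U V (isClosed_biUnion_closure S)
    (isClosed_biUnion_closure _) (fun y hy => hUV y hy)
    (by
      obtain ⟨y, hy, hyK⟩ := meets K₁ (hSA hK₁)
      exact ⟨y, hy, Set.mem_iUnion₂.2 ⟨K₁, hK₁, hyK⟩⟩)
    (by
      obtain ⟨y, hy, hyK⟩ := meets K₂ hK₂
      exact ⟨y, hy, Set.mem_iUnion₂.2 ⟨K₂, Finset.mem_sdiff.2 ⟨hK₂, hK₂S⟩, hyK⟩⟩)
  obtain ⟨r, hr, hball⟩ := Metric.isOpen_iff.1 (isOpen_interior : IsOpen (patch A)) x hxp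
  have hnull : ∀ᵐ y : Pt d, ∀ a ∈ Z, y ∉ a := by
    rw [Filter.eventually_all_finset]
    exact fun a ha => measure_eq_zero_iff_ae_notMem.1
      (Measure.addHaar_affineSubspace volume a (affineSubspace_ne_top (hZ a ha)))
  have pick : ∀ K ∈ A, x ∈ closure K → ∃ p ∈ Metric.ball x r, p ∈ K ∧ ∀ a ∈ Z, p ∉ a := by
    intro K hK hxK
    have hopen := (Metric.isOpen_ball (x := x) (ε := r)).inter (T.polytope K (hA hK)).isOpen
    have hne := mem_closure_iff.1 hxK _ Metric.isOpen_ball (Metric.mem_ball_self hr)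
    have hfreq : ∃ᵐ z : Pt d, z ∈ Metric.ball x r ∩ K := by
      rw [frequently_ae_mem_iff]
      exact (hopen.measure_pos volume hne).ne'
    obtain ⟨p, hp, hpZ⟩ := (hfreq.and_eventually hnull).exists
    exact ⟨p, hp.1, hp.2, hpZ⟩
  obtain ⟨K, hK, hxK⟩ := Set.mem_iUnion₂.1 hxU
  obtain ⟨K', hK', hxK'⟩ := Set.mem_iUnion₂.1 hxV
  obtain ⟨p, hpB, hpK, hpZ⟩ := pick K (hSA hK) hxK
  obtain ⟨q, hqB, hqK, hqZ⟩ := pick K' (Finset.mem_sdiff.1 hK').1 hxK'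
  -- The point `x` itself may lie on the skeleton. A broken line in a ball around it, from an
  -- element of `S` to one outside `S` and avoiding the skeleton, must still cross from `U` to `V`.
  obtain ⟨z, hzB, hs1, hs2⟩ := exists_segments_avoid hZ Metric.isOpen_ball
    ⟨x, Metric.mem_ball_self hr⟩ hpZ hqZ
  have hconn : IsPreconnected (segment ℝ p z ∪ segment ℝ z q) :=
    IsPreconnected.union z (right_mem_segment ℝ p z) (left_mem_segment ℝ z q)
      (convex_segment p z).isPreconnected (convex_segment z q).isPreconnected
  have hsubB : segment ℝ p z ∪ segment ℝ z q ⊆ Metric.ball x r :=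
    Set.union_subset ((convex_ball x r).segment_subset hpB hzB)
      ((convex_ball x r).segment_subset hzB hqB)
  obtain ⟨y, hy, hyU, hyV⟩ := isPreconnected_closed_iff.1 hconn U V (isClosed_biUnion_closure S)
    (isClosed_biUnion_closure _) (fun y hy => hUV y (hball (hsubB hy)))
    ⟨p, Or.inl (left_mem_segment ℝ p z), Set.mem_iUnion₂.2 ⟨K, hK, subset_closure hpK⟩⟩
    ⟨q, Or.inr (right_mem_segment ℝ z q), Set.mem_iUnion₂.2 ⟨K', hK', subset_closure hqK⟩⟩
  refine hdisj y ?_ hyU hyV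
  rcases hy with h | h
  · exact hs1 y h
  · exact hs2 y h

/-! ### Face distance between elements -/

open Classical in
/-- The elements that share a face with `K`. -/
def Mesh.neighbors (K : Set (Pt d)) : Finset (Set (Pt d)) :=
  T.cells.filter fun K' => K' ≠ K ∧ ∃ F ∈ T.faces K, F ∈ T.faces K'

/-- Across each face there is at most one other element. -/
lemma Mesh.card_neighbors_le {N : ℕ} (hN : AssumptionA T N) {K : Set (Pt d)} (hK : K ∈ T.cells) :
    (T.neighbors K).card ≤ N := by
  classical
  have hsub : T.neighbors K ⊆ (T.faces K).biUnion fun F =>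
      T.cells.filter fun K' => K' ≠ K ∧ F ∈ T.faces K' := by
    intro K' hK'
    obtain ⟨h1, h2, F, hF, hF'⟩ := Finset.mem_filter.1 hK'
    exact Finset.mem_biUnion.2 ⟨F, hF, Finset.mem_filter.2 ⟨h1, h2, hF'⟩⟩
  refine (Finset.card_le_card hsub).trans ((Finset.card_biUnion_le_card_mul _ _ 1 ?_).trans ?_)
  · intro F hF
    refine Finset.card_le_one.2 fun K₁ h₁ K₂ h₂ => ?_
    obtain ⟨a1, a2, a3⟩ := Finset.mem_filter.1 h₁
    obtain ⟨b1, b2, b3⟩ := Finset.mem_filter.1 h₂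
    exact T.eq_of_mem_faces hK a1 b1 hF a3 b3 a2 b2
  · rw [mul_one]; exact hN K hK

open Classical in
/-- The elements at face distance at most `j` from `K`. -/
def Mesh.faceBall (K : Set (Pt d)) : ℕ → Finset (Set (Pt d))
  | 0 => {K}
  | j + 1 => Mesh.faceBall K j ∪ (Mesh.faceBall K j).biUnion T.neighbors

lemma Mesh.faceBall_subset {K : Set (Pt d)} (hK : K ∈ T.cells) (j : ℕ) :
    T.faceBall K j ⊆ T.cells := by
  classical
  induction j with
  | zero => simpa [Mesh.faceBall] using hK
  | succ j ih =>
    refine Finset.union_subset ih (Finset.biUnion_subset.2 fun K' _ => Finset.filter_subset _ _)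

lemma Mesh.card_faceBall_le {N : ℕ} (hN : AssumptionA T N) {K : Set (Pt d)} (hK : K ∈ T.cells)
    (j : ℕ) : (T.faceBall K j).card ≤ (N + 1) ^ j := by
  classical
  induction j with
  | zero => simp [Mesh.faceBall]
  | succ j ih =>
    calc (T.faceBall K (j + 1)).card
        ≤ (T.faceBall K j).card + ((T.faceBall K j).biUnion T.neighbors).card :=
          Finset.card_union_le _ _
      _ ≤ (T.faceBall K j).card + (T.faceBall K j).card * N := by
          gcongr
          exact Finset.card_biUnion_le_card_mul _ _ _ fun K' hK' =>
            T.card_neighbors_le hN (T.faceBall_subset hK j hK')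
      _ = (T.faceBall K j).card * (N + 1) := by ring
      _ ≤ (N + 1) ^ j * (N + 1) := by gcongr
      _ = (N + 1) ^ (j + 1) := by ring

/-- While the ball does not contain all of `A`, connection through faces makes each enlargement gain
an element of `A`. The ball of radius `0` already has one, so failure at radius `M` would give `M +
1` elements of `A`. -/
lemma Mesh.subset_faceBall {A : Finset (Set (Pt d))} (hA : A ⊆ T.cells)
    (hp : IsPreconnected (patch A)) {K : Set (Pt d)} (hK : K ∈ A) {M : ℕ} (hM : A.card ≤ M) :
    A ⊆ T.faceBall K M := by
  classical
  have key : ∀ j, A ⊆ T.faceBall K j ∨ j + 1 ≤ (T.faceBall K j ∩ A).card := by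
    intro j
    induction j with
    | zero =>
      right
      rw [zero_add, Nat.one_le_iff_ne_zero, Finset.card_ne_zero]
      exact ⟨K, by simp [Mesh.faceBall, hK]⟩
    | succ j ih =>
      have hmono : T.faceBall K j ⊆ T.faceBall K (j + 1) := Finset.subset_union_left
      by_cases hall : A ⊆ T.faceBall K j
      · exact Or.inl (hall.trans hmono)
      right
      have hcard := ih.resolve_left hall
      obtain ⟨K₀, hK₀, hK₀'⟩ := Finset.not_subset.1 hall
      have hSne : (T.faceBall K j ∩ A).Nonempty := by
        rw [← Finset.card_pos]; omega
      obtain ⟨K₁, hK₁, K₂, hK₂, hK₂S, F, hF, hF'⟩ := T.exists_shared_face hA hp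
        Finset.inter_subset_right hSne ⟨K₀, hK₀, fun h => hK₀' (Finset.mem_inter.1 h).1⟩
      have hne : K₂ ≠ K₁ := fun h => hK₂S (h ▸ hK₁)
      have hmem : K₂ ∈ T.faceBall K (j + 1) := Finset.mem_union_right _
        (Finset.mem_biUnion.2 ⟨K₁, (Finset.mem_inter.1 hK₁).1,
          Finset.mem_filter.2 ⟨hA hK₂, hne, F, hF, hF'⟩⟩)
      have hlt : (T.faceBall K j ∩ A).card < (T.faceBall K (j + 1) ∩ A).card := by
        refine Finset.card_lt_card ⟨Finset.inter_subset_inter_right hmono, fun h => hK₂S ?_⟩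
        exact h (Finset.mem_inter.2 ⟨hmem, hK₂⟩)
      omega
  rcases key M with h | h
  · exact h
  · have := Finset.card_le_card (Finset.inter_subset_right (s₁ := T.faceBall K M) (s₂ := A))
    omega

open Classical in
/-- Every element belongs to a bounded number of patches. -/
lemma AssumptionD.card_overlap_le {N b M : ℕ} {γ₁ κ γ₂ : ℝ}
    {Λ : Set (Pt d) → Finset (Set (Pt d))} (hN : AssumptionA T N)
    (h : AssumptionD T N b M γ₁ κ γ₂ Λ) {K' : Set (Pt d)} (hK' : K' ∈ T.cells) :
    (T.cells.filter fun K => K' ∈ Λ K).card ≤ (N + 1) ^ M := by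
  refine le_trans (Finset.card_le_card ?_) (T.card_faceBall_le hN hK' M)
  intro K hK
  obtain ⟨hKc, hKΛ⟩ := Finset.mem_filter.1 hK
  obtain ⟨S, n, hS⟩ := (h.isotropic K hKc).polytope
  -- The patch of `K` contains both `K` and `K'`; growing it from `K'` shows that its centre `K` is
  -- within face distance `M` of `K'`.
  exact T.subset_faceBall (h.subset K hKc) hS.connected.isPreconnected hKΛ (h.card_le K hKc)
    (h.mem K hKc)

end Mesh

/-! ### Normal derivatives on shared faces -/

lemma integrable_inner_of_memLp {μ : Measure (Pt d)} {G H : Pt d → Pt d} (hG : MemLp G 2 μ)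
    (hH : MemLp H 2 μ) : Integrable (fun x => inner ℝ (G x) (H x)) μ :=
  (hG.norm.integrable_mul hH.norm).mono' (hG.1.inner hH.1)
    (Eventually.of_forall fun x => norm_inner_le_norm (G x) (H x))

lemma memH10_of_contDiff {Ω : Set (Pt d)} (hΩ : IsOpen Ω) (hb : Bornology.IsBounded Ω)
    {φ : Pt d → ℝ} (hφ : ContDiff ℝ ∞ φ) (hc : HasCompactSupport φ) (hs : tsupport φ ⊆ Ω) :
    MemH10 Ω φ := by
  have hw := hasWeakGrad_of_contDiff hb hφ
  refine ⟨hw.memH1, fun _ => φ, fun _ => ⟨hφ, hc, hs⟩, ?_, ?_⟩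
  · simp
  · have : eLpNorm (fun x => weakGrad Ω φ x - ∇ φ x) 2 (volume.restrict Ω) = 0 := by
      rw [eLpNorm_congr_ae (g := fun _ => (0 : Pt d))]
      · simp
      · filter_upwards [hw.weakGrad_ae hΩ] with x hx
        rw [hx, sub_self]
    simp [this]

/-- The normal derivatives from the two sides of a face cancel. -/
lemma Mesh.integral_normalDeriv_add {Ω : Set (Pt d)} (T : Mesh Ω) (hΩ : IsPolytope Ω)
    {f u : Pt d → ℝ} (hf : MemLp f 2 (volume.restrict Ω)) (hu : IsWeakSolution Ω f u)
    {g : Set (Pt d) → Set (Pt d) → Pt d → ℝ}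
    (hg : ∀ K ∈ T.cells, HasNormalDeriv K (T.faces K) u (fun x => -f x) (g K))
    {K K' F : Set (Pt d)} (hK : K ∈ T.cells) (hK' : K' ∈ T.cells) (hne : K ≠ K')
    (hF : F ∈ T.faces K) (hF' : F ∈ T.faces K') :
    (∫ x, g K F x ∂(surf F)) + ∫ x, g K' F x ∂(surf F) = 0 := by
  obtain ⟨S, n, hS⟩ := hΩ
  have p := T.polytope K hK
  have p' := T.polytope K' hK'
  have hFf := p.flatFace F hF
  have hfin := hFf.isFiniteMeasure
  have m1 := (hg K hK).memLp_face F hF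
  have m2 := (hg K' hK').memLp_face F hF'
  -- The sum of the two normal derivatives vanishes almost everywhere, not only in the mean. Near a
  -- point of the face, the Green formulas of both elements are added for a test function `ψ` in a
  -- ball, and the weak equation on `Ω` cancels the volume terms.
  have hnull : surf F {x | x ∈ F ∧ g K F x + g K' F x ≠ 0} = 0 := by
    refine measure_null_of_locally_null _ fun x hx => ?_
    obtain ⟨r, hr, hball⟩ := T.exists_ball_subset hK hK' hne hF hF' hx.1
    refine ⟨{x | x ∈ F ∧ g K F x + g K' F x ≠ 0} ∩ Metric.ball x r,
      inter_mem_nhdsWithin _ (Metric.ball_mem_nhds x hr), ?_⟩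
    have key := (Metric.isOpen_ball (x := x) (ε := r)).ae_eq_zero_of_integral_contDiff_smul_eq_zero
      (f := g K F + g K' F) (μ := surf F)
      (((m1.add m2).integrable (by norm_num)).locallyIntegrable.locallyIntegrableOn _) ?_
    · refine measure_mono_null ?_ key
      rintro y ⟨hy, hyb⟩ h
      exact hy.2 (h hyb)
    intro ψ hψ hc hsup
    have hballΩ : Metric.ball x r ⊆ Ω := by
      rw [← hS.interior_closure]
      refine Metric.isOpen_ball.subset_interior_iff.2 (hball.trans ?_)
      refine Set.union_subset (Set.union_subset ?_ ?_) ?_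
      · exact (T.subset K hK).trans subset_closure
      · exact (T.subset K' hK').trans subset_closure
      · exact (T.face_subset_closure hK hF).trans (closure_mono (T.subset K hK))
    have hψ0 : ∀ y, y ∉ Metric.ball x r → ψ y = 0 := fun y hy =>
      image_eq_zero_of_notMem_tsupport fun h => hy (hsup h)
    have hgψ0 : ∀ y, y ∉ Metric.ball x r → ∇ ψ y = 0 := fun y hy =>
      gradient_eq_zero_of_notMem fun h => hy (hsup h)
    have hFnull : volume F = 0 := measure_mono_null subset_closure hFf.volume_closure
    -- integrals over `Ω` split
    have split : ∀ q : Pt d → ℝ, IntegrableOn q Ω → (∀ y, y ∉ Metric.ball x r → q y = 0) →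
        ∫ y in Ω, q y = (∫ y in K, q y) + ∫ y in K', q y := by
      intro q hq hq0
      have hsub : K ∪ K' ⊆ Ω := Set.union_subset (T.subset K hK) (T.subset K' hK')
      rw [← setIntegral_union (T.disjoint K hK K' hK' hne) p'.isOpen.measurableSet
        (hq.mono_set (T.subset K hK)) (hq.mono_set (T.subset K' hK'))]
      refine setIntegral_eq_of_subset_of_ae_sdiff_eq_zero hS.isOpen.measurableSet.nullMeasurableSet
        hsub ?_
      filter_upwards [measure_eq_zero_iff_ae_notMem.1 hFnull] with y hyF hy
      by_cases hyb : y ∈ Metric.ball x r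
      · rcases hball hyb with h | h
        · exact absurd h hy.2
        · exact absurd h hyF
      · exact hq0 y hyb
    have hu1 := hu.1.1.hasWeakGrad
    have mψ : MemLp ψ 2 (volume.restrict Ω) := hψ.continuous.memLp_of_hasCompactSupport hc
    have mg : MemLp (∇ ψ) 2 (volume.restrict Ω) :=
      memLp_of_continuous_of_isBounded (continuous_gradient hψ) hS.bounded 2
    have weak := hu.2 ψ (memH10_of_contDiff hS.isOpen hS.bounded hψ hc (hsup.trans hballΩ))
    have e1 : ∫ y in Ω, inner ℝ (weakGrad Ω u y) (weakGrad Ω ψ y) =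
        ∫ y in Ω, inner ℝ (weakGrad Ω u y) (∇ ψ y) := by
      refine integral_congr_ae ?_
      filter_upwards [(hasWeakGrad_of_contDiff hS.bounded hψ).weakGrad_ae hS.isOpen] with y hy
      rw [hy]
    rw [e1, split (fun y => inner ℝ (weakGrad Ω u y) (∇ ψ y))
        (integrable_inner_of_memLp hu1.memLp_grad mg)
        (fun y hy => by rw [hgψ0 y hy, inner_zero_right]),
      split (fun y => f y * ψ y) (hf.integrable_mul mψ) (fun y hy => by simp [hψ0 y hy])] at weak
    -- the Green formulas on the two elements
    have green : ∀ L ∈ T.cells, F ∈ T.faces L → (L = K ∨ L = K') →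
        (∫ y in L, inner ℝ (weakGrad Ω u y) (∇ ψ y)) - (∫ y in L, f y * ψ y) =
          ∫ y, g L F y * ψ y ∂(surf F) := by
      intro L hL hFL hLK
      have pL := T.polytope L hL
      have h := (hg L hL).green ψ hψ
      have e2 : ∫ y in L, inner ℝ (weakGrad L u y) (∇ ψ y) =
          ∫ y in L, inner ℝ (weakGrad Ω u y) (∇ ψ y) := by
        refine integral_congr_ae ?_
        filter_upwards [(hu1.mono hS.isOpen (T.subset L hL)).weakGrad_ae pL.isOpen] with y hy
        rw [hy]
      have e3 : ∑ F₁ ∈ T.faces L, ∫ y, g L F₁ y * ψ y ∂(surf F₁) =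
          ∫ y, g L F y * ψ y ∂(surf F) := by
        -- Another face of `L` contains no point of the ball: the ball consists of `K`, `K'` and
        -- `F`, and a boundary point of `L` lies in no element.
        refine Finset.sum_eq_single_of_mem F hFL fun F₁ hF₁ hF₁ne => ?_
        refine integral_eq_zero_of_ae ?_
        filter_upwards [(pL.flatFace F₁ hF₁).ae_mem] with y hy
        have hyb : y ∉ Metric.ball x r := by
          intro hyb
          have hycl : y ∈ closure L := T.face_subset_closure hL hF₁ hy
          have hyL : y ∉ L := by
            have := pL.face_subset_frontier hF₁ hy
            rw [pL.isOpen.frontier_eq] at this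
            exact this.2
          have hother : ∀ L' ∈ T.cells, L' ≠ L → y ∉ L' := by
            intro L' hL' hne' hy'
            obtain ⟨z, hz, hz'⟩ := mem_closure_iff.1 hycl _ (T.polytope L' hL').isOpen hy'
            exact Set.disjoint_left.1 (T.disjoint L' hL' L hL hne') hz hz'
          rcases hball hyb with (h | h) | h
          · by_cases hLK' : K = L
            · exact hyL (hLK' ▸ h)
            · exact hother K hK hLK' h
          · by_cases hLK' : K' = L
            · exact hyL (hLK' ▸ h)
            · exact hother K' hK' hLK' h
          · exact Set.disjoint_left.1 (pL.disjoint F₁ hF₁ F hFL hF₁ne) hy h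
        simp [hψ0 y hyb]
      rw [e2, e3] at h
      rw [← h]
      simp only [neg_mul, integral_neg]
      ring
    have g1 := green K hK hF (Or.inl rfl)
    have g2 := green K' hK' hF' (Or.inr rfl)
    have mψF := memLp_face hFf hψ.continuous 2
    have i1 : Integrable (fun y => g K F y * ψ y) (surf F) := m1.integrable_mul mψF
    have i2 : Integrable (fun y => g K' F y * ψ y) (surf F) := m2.integrable_mul mψF
    have : ∀ y, ψ y • (g K F + g K' F) y = g K F y * ψ y + g K' F y * ψ y := fun y => by
      simp only [Pi.add_apply, smul_eq_mul]; ring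
    simp_rw [this]
    rw [integral_add i1 i2, ← g1, ← g2]
    linarith
  rw [← integral_add (m1.integrable (by norm_num)) (m2.integrable (by norm_num))]
  refine integral_eq_zero_of_ae ?_
  filter_upwards [hFf.ae_mem, measure_eq_zero_iff_ae_notMem.1 hnull] with x hx hx'
  by_contra h
  exact hx' ⟨hx, h⟩

/-- Quantities that are single valued on faces and zero on the boundary, times quantities with
opposite signs from the two sides, sum up to zero. -/
lemma Mesh.sum_faces_eq_zero {Ω : Set (Pt d)} (T : Mesh Ω) (c I : Set (Pt d) → Set (Pt d) → ℝ)
    (hbdry : ∀ K ∈ T.cells, ∀ F ∈ T.faces K, F ⊆ frontier Ω → c K F = 0)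
    (hc : ∀ K ∈ T.cells, ∀ K' ∈ T.cells, K ≠ K' → ∀ F ∈ T.faces K, F ∈ T.faces K' →
      c K F = c K' F)
    (hI : ∀ K ∈ T.cells, ∀ K' ∈ T.cells, K ≠ K' → ∀ F ∈ T.faces K, F ∈ T.faces K' →
      I K F + I K' F = 0) :
    ∑ K ∈ T.cells, ∑ F ∈ T.faces K, c K F * I K F = 0 := by
  classical
  have hex : ∀ K ∈ T.cells, ∀ F ∈ T.faces K, ∃ K' ∈ T.cells, F ∈ T.faces K' ∧
      ((K' = K ∧ F ⊆ frontier Ω) ∨ (K' ≠ K ∧ ¬ F ⊆ frontier Ω)) := by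
    intro K hK F hF
    by_cases hb : F ⊆ frontier Ω
    · exact ⟨K, hK, hF, Or.inl ⟨rfl, hb⟩⟩
    · rcases T.conforming K hK F hF with h | ⟨K', hK', hne, hF'⟩
      · exact absurd h hb
      · exact ⟨K', hK', hF', Or.inr ⟨hne, hb⟩⟩
  -- `o K F` is the element across `F`, or `K` itself on the boundary, where the term is zero.
  -- Exchanging the two sides of a face is an involution under which the terms cancel.
  choose! o ho1 ho2 ho3 using hex
  rw [Finset.sum_sigma']
  refine Finset.sum_involution (fun a _ => ⟨o a.1 a.2, a.2⟩) ?_ ?_ ?_ ?_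
  · rintro ⟨K, F⟩ ha
    obtain ⟨hK, hF⟩ := Finset.mem_sigma.1 ha
    simp only at hK hF ⊢
    rcases ho3 K hK F hF with ⟨h1, h2⟩ | ⟨h1, h2⟩
    · rw [h1, hbdry K hK F hF h2]; ring
    · have hm := ho1 K hK F hF
      have hm' := ho2 K hK F hF
      rw [← hc K hK _ hm h1.symm F hF hm', ← mul_add, hI K hK _ hm h1.symm F hF hm', mul_zero]
  · rintro ⟨K, F⟩ ha hne heq
    obtain ⟨hK, hF⟩ := Finset.mem_sigma.1 ha
    simp only at hK hF hne
    have heq' : o K F = K := congrArg Sigma.fst heq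
    rcases ho3 K hK F hF with ⟨h1, h2⟩ | ⟨h1, h2⟩
    · exact hne (by rw [hbdry K hK F hF h2, zero_mul])
    · exact h1 heq'
  · rintro ⟨K, F⟩ ha
    obtain ⟨hK, hF⟩ := Finset.mem_sigma.1 ha
    exact Finset.mem_sigma.2 ⟨ho1 K hK F hF, ho2 K hK F hF⟩
  · rintro ⟨K, F⟩ ha
    obtain ⟨hK, hF⟩ := Finset.mem_sigma.1 ha
    simp only at hK hF
    have hm := ho1 K hK F hF
    have hm' := ho2 K hK F hF
    have : o (o K F) F = K := by
      rcases ho3 K hK F hF with ⟨h1, h2⟩ | ⟨h1, h2⟩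
      · rw [h1, h1]
      · rcases ho3 _ hm F hm' with ⟨h1', h2'⟩ | ⟨h1', h2'⟩
        · exact absurd h2' h2
        · exact T.eq_of_mem_faces hm (ho1 _ hm F hm') hK hm' (ho2 _ hm F hm') hF h1' h1.symm
    simp only [this]

/-! ### Piecewise Sobolev functions with traces -/

/-- `v` is in `H¹` of every element, and has traces on all faces. -/
def HasTraces {Ω : Set (Pt d)} (T : Mesh Ω) (v : Pt d → ℝ) : Prop :=
  ∀ K ∈ T.cells, MemH1 K v ∧ ∀ F ∈ T.faces K, ∃ t, HasTrace K F v t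

section

variable {Ω : Set (Pt d)} {T : Mesh Ω} {v w : Pt d → ℝ}

lemma HasTraces.sub (hv : HasTraces T v) (hw : HasTraces T w) : HasTraces T (v - w) := by
  intro K hK
  refine ⟨(hv K hK).1.sub (hw K hK).1, fun F hF => ?_⟩
  obtain ⟨s, hs⟩ := (hv K hK).2 F hF
  obtain ⟨t, ht⟩ := (hw K hK).2 F hF
  exact ⟨s - t, hs.sub (T.polytope K hK).isOpen (T.polytope K hK).bounded ht⟩

lemma hasTraces_of_contDiff (T : Mesh Ω) (hv : ContDiff ℝ ∞ v) : HasTraces T v := fun K hK =>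
  ⟨(hasWeakGrad_of_contDiff (T.polytope K hK).bounded hv).memH1, fun F hF =>
    ⟨v, hasTrace_of_contDiff (T.polytope K hK).isOpen (T.polytope K hK).bounded
      ((T.polytope K hK).flatFace F hF) hv⟩⟩

lemma MemSpace.hasTraces (hv : MemSpace T v) : HasTraces T v := fun K hK =>
  ⟨(hv.loc K hK).memH1, (hv.loc K hK).hasTrace⟩

/-- For functions in `V_h` traces are part of the definition; this provides them for the exact
solution `u`. -/
lemma MemH10.hasTraces (T : Mesh Ω) (hΩ : IsPolytope Ω) (hv : MemH10 Ω v) : HasTraces T v := by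
  obtain ⟨S, n, hS⟩ := hΩ
  intro K hK
  have p := T.polytope K hK
  exact ⟨(hv.1.hasWeakGrad.mono hS.isOpen (T.subset K hK)).memH1, fun F hF =>
    hv.exists_hasTrace hS.isOpen p.isOpen (T.subset K hK) (p.flatFace F hF)⟩

lemma HasTraces.hasTrace (hv : HasTraces T v) {K F : Set (Pt d)} (hK : K ∈ T.cells)
    (hF : F ∈ T.faces K) : HasTrace K F v (trace K F v) := trace_spec ((hv K hK).2 F hF)

/-- Since `trace` is an arbitrary choice, uniqueness is what allows computing it from any candidate.
-/
lemma HasTrace.trace_ae {K F : Set (Pt d)} (hK : K ∈ T.cells)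
    (hF : F ∈ T.faces K) {t : Pt d → ℝ} (ht : HasTrace K F v t) : trace K F v =ᵐ[surf F] t :=
  (trace_spec ⟨t, ht⟩).ae_unique (T.polytope K hK).isOpen (T.polytope K hK).bounded
    ((T.polytope K hK).flatFace F hF) ((T.polytope K hK).oneSided F hF) ht

lemma HasTraces.trace_sub (hv : HasTraces T v) (hw : HasTraces T w) {K F : Set (Pt d)}
    (hK : K ∈ T.cells) (hF : F ∈ T.faces K) :
    trace K F (v - w) =ᵐ[surf F] trace K F v - trace K F w :=
  HasTrace.trace_ae hK hF ((hv.hasTrace hK hF).sub (T.polytope K hK).isOpen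
    (T.polytope K hK).bounded (hw.hasTrace hK hF))

lemma trace_of_contDiff (hv : ContDiff ℝ ∞ v) {K F : Set (Pt d)}
    (hK : K ∈ T.cells) (hF : F ∈ T.faces K) : trace K F v =ᵐ[surf F] v :=
  HasTrace.trace_ae hK hF (hasTrace_of_contDiff (T.polytope K hK).isOpen
    (T.polytope K hK).bounded ((T.polytope K hK).flatFace F hF) hv)

lemma Mesh.isFiniteMeasure_surf (T : Mesh Ω) {K F : Set (Pt d)} (hK : K ∈ T.cells)
    (hF : F ∈ T.faces K) : IsFiniteMeasure (surf F) :=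
  ((T.polytope K hK).flatFace F hF).isFiniteMeasure

lemma HasTraces.memLp_trace (hv : HasTraces T v) {K F : Set (Pt d)} (hK : K ∈ T.cells)
    (hF : F ∈ T.faces K) : MemLp (trace K F v) 2 (surf F) := (hv.hasTrace hK hF).2.1

lemma HasTraces.integrable_trace (hv : HasTraces T v) {K F : Set (Pt d)} (hK : K ∈ T.cells)
    (hF : F ∈ T.faces K) : Integrable (trace K F v) (surf F) := by
  have := T.isFiniteMeasure_surf hK hF
  exact (hv.memLp_trace hK hF).integrable (by norm_num)

lemma HasTraces.integral_trace_sub (hv : HasTraces T v) (hw : HasTraces T w) {K F : Set (Pt d)}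
    (hK : K ∈ T.cells) (hF : F ∈ T.faces K) :
    ∫ x, trace K F (v - w) x ∂(surf F) =
      (∫ x, trace K F v x ∂(surf F)) - ∫ x, trace K F w x ∂(surf F) := by
  rw [← integral_sub (hv.integrable_trace hK hF) (hw.integrable_trace hK hF)]
  exact integral_congr_ae (hv.trace_sub hw hK hF)

lemma HasTraces.faceAvg_sub (hv : HasTraces T v) (hw : HasTraces T w) {K F : Set (Pt d)}
    (hK : K ∈ T.cells) (hF : F ∈ T.faces K) :
    faceAvg K F (v - w) = faceAvg K F v - faceAvg K F w := by
  simp only [faceAvg, average_eq, hv.integral_trace_sub hw hK hF, smul_sub]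

lemma Mesh.area_mul_faceAvg (T : Mesh Ω) {K F : Set (Pt d)} (hK : K ∈ T.cells)
    (hF : F ∈ T.faces K) (v : Pt d → ℝ) :
    (surf F).real Set.univ * faceAvg K F v = ∫ x, trace K F v x ∂(surf F) := by
  have h := ((T.polytope K hK).flatFace F hF).surf_pos
  rw [faceAvg, average_eq, smul_eq_mul, mul_inv_cancel_left₀ h.ne']

/-- The Gauss formula on an element. -/
lemma HasTraces.integral_weakGrad (hv : HasTraces T v) {K : Set (Pt d)} (hK : K ∈ T.cells)
    (a : Pt d) : ∫ x in K, inner ℝ (weakGrad K v x) a =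
      ∑ F ∈ T.faces K, inner ℝ a (T.normal K F) * ∫ x, trace K F v x ∂(surf F) :=
  (T.polytope K hK).integral_weakGrad (t := fun F => trace K F v)
    (fun _ hF => hv.hasTrace hK hF) (hv K hK).1 a

lemma integral_gradient_of_contDiff (hv : ContDiff ℝ ∞ v) {K : Set (Pt d)} (hK : K ∈ T.cells)
    (a : Pt d) : ∫ x in K, inner ℝ (∇ v x) a =
      ∑ F ∈ T.faces K, inner ℝ a (T.normal K F) * ∫ x, v x ∂(surf F) := by
  have h := (hasTraces_of_contDiff T hv).integral_weakGrad hK a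
  have e : ∫ x in K, inner ℝ (weakGrad K v x) a = ∫ x in K, inner ℝ (∇ v x) a := by
    refine integral_congr_ae ?_
    filter_upwards [(hasWeakGrad_of_contDiff (T.polytope K hK).bounded hv).weakGrad_ae
      (T.polytope K hK).isOpen] with x hx
    rw [hx]
  rw [← e, h]
  refine Finset.sum_congr rfl fun F hF => ?_
  rw [integral_congr_ae (trace_of_contDiff hv hK hF)]

lemma HasNormalDeriv.sub {K : Set (Pt d)} {S : Finset (Set (Pt d))} {n : Set (Pt d) → Pt d}
    (hK : IsPolytopeWith K S n) {c c' : Set (Pt d) → ℝ}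
    (hv : HasNormalDeriv K S v 0 (fun F _ => c F)) (hw : HasNormalDeriv K S w 0 (fun F _ => c' F)) :
    HasNormalDeriv K S (v - w) 0 (fun F _ => c F - c' F) := by
  refine ⟨hv.memH1.sub hw.memH1, hv.memLp, fun F hF => (hv.memLp_face F hF).sub (hw.memLp_face F hF),
    fun φ hφ => ?_⟩
  have h1 := hv.green φ hφ
  have h2 := hw.green φ hφ
  have mg := memLp_of_continuous_of_isBounded (continuous_gradient hφ) hK.bounded 2
  have e : ∫ x in K, inner ℝ (weakGrad K (v - w) x) (∇ φ x) =
      (∫ x in K, inner ℝ (weakGrad K v x) (∇ φ x)) - ∫ x in K, inner ℝ (weakGrad K w x) (∇ φ x) := by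
    rw [← integral_sub (integrable_inner_of_memLp hv.memH1.hasWeakGrad.memLp_grad mg)
      (integrable_inner_of_memLp hw.memH1.hasWeakGrad.memLp_grad mg)]
    refine integral_congr_ae ?_
    filter_upwards [weakGrad_sub_ae hK.isOpen hv.memH1 hw.memH1] with x hx
    rw [hx, Pi.sub_apply, inner_sub_left]
  simp only [Pi.zero_apply, zero_mul, integral_zero, add_zero, integral_const_mul] at h1 h2 ⊢
  rw [e, h1, h2, ← Finset.sum_sub_distrib]
  exact Finset.sum_congr rfl fun F _ => (sub_mul _ _ _).symm

lemma MemSpace.sub (hv : MemSpace T v) (hw : MemSpace T w) : MemSpace T (v - w) := by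
  have tv := hv.hasTraces
  have tw := hw.hasTraces
  refine ⟨hv.memLp.sub hw.memLp, fun K hK => ?_, ?_, ?_⟩
  · obtain ⟨c, hc⟩ := (hv.loc K hK).neumann
    obtain ⟨c', hc'⟩ := (hw.loc K hK).neumann
    exact ⟨(tv.sub tw K hK).1, (tv.sub tw K hK).2, _, hc.sub (T.polytope K hK) hc'⟩
  · intro K hK K' hK' hne F hF hF'
    rw [tv.integral_trace_sub tw hK hF, tv.integral_trace_sub tw hK' hF',
      hv.jump K hK K' hK' hne F hF hF', hw.jump K hK K' hK' hne F hF hF']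
  · intro K hK F hF hb
    rw [tv.integral_trace_sub tw hK hF, hv.bdry K hK F hF hb, hw.bdry K hK F hF hb, sub_zero]

end

/-! ### Linear polynomials -/

lemma gradient_inner_add (a : Pt d) (c : ℝ) (x : Pt d) :
    ∇ (fun x => inner ℝ a x + c) x = a := by
  refine HasGradientAt.gradient ?_
  rw [hasGradientAt_iff_hasFDerivAt]
  exact ((InnerProductSpace.toDual ℝ (Pt d) a).hasFDerivAt (x := x)).add_const c

section P1

variable {q r : Pt d → ℝ}

lemma IsP1.contDiff (h : IsP1 q) : ContDiff ℝ ∞ q := by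
  obtain ⟨a, c, hq⟩ := h
  rw [funext hq]
  exact (contDiff_const.inner ℝ contDiff_id).add contDiff_const

lemma IsP1.gradient_eq (h : IsP1 q) (x : Pt d) : ∇ q x = ∇ q 0 := by
  obtain ⟨a, c, hq⟩ := h
  rw [funext hq, gradient_inner_add, gradient_inner_add]

lemma IsP1.sub_eq_inner (h : IsP1 q) (x y : Pt d) : q x - q y = inner ℝ (∇ q 0) (x - y) := by
  obtain ⟨a, c, hq⟩ := h
  rw [funext hq, gradient_inner_add, inner_sub_right]
  ring

lemma IsP1.sub (h : IsP1 q) (h' : IsP1 r) : IsP1 (q - r) := by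
  obtain ⟨a, c, hq⟩ := h
  obtain ⟨b, e, hr⟩ := h'
  refine ⟨a - b, c - e, fun x => ?_⟩
  rw [Pi.sub_apply, hq, hr, inner_sub_left]
  ring

lemma isP1_inner_add (a : Pt d) (c : ℝ) : IsP1 (fun x => inner ℝ a x + c) := ⟨a, c, fun _ => rfl⟩

lemma IsP1.gradient_sub (h : IsP1 q) (h' : IsP1 r) : ∇ (q - r) 0 = ∇ q 0 - ∇ r 0 :=
  gradient_sub' h.contDiff h'.contDiff 0

lemma IsP1.abs_sub_le (h : IsP1 q) (x y : Pt d) : |q x - q y| ≤ ‖∇ q 0‖ * dist x y := by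
  rw [h.sub_eq_inner, dist_eq_norm]
  exact abs_real_inner_le_norm _ _

end P1

/-! ### The elliptic projections -/

section Proj

variable {Ω : Set (Pt d)} {T : Mesh Ω} {A B : Finset (Set (Pt d))} {v w q r : Pt d → ℝ}

/-- The projection to linear polynomials on the elements in `B`, normalized on the boundary of the
patch `A`, is well defined. -/
structure Mesh.Admissible (T : Mesh Ω) (A B : Finset (Set (Pt d))) : Prop where
  left_subset : A ⊆ T.cells
  right_subset : B ⊆ T.cells
  right_nonempty : B.Nonempty
  outer : ∃ K ∈ A, (T.outerFaces A K).Nonempty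

lemma Mesh.volume_pos (T : Mesh Ω) {K : Set (Pt d)} (hK : K ∈ T.cells) : 0 < volume.real K :=
  ENNReal.toReal_pos ((T.polytope K hK).isOpen.measure_pos volume
    (T.polytope K hK).connected.nonempty).ne' (T.polytope K hK).bounded.measure_lt_top.ne

lemma Mesh.outerFaces_subset (T : Mesh Ω) (A : Finset (Set (Pt d))) (K : Set (Pt d)) :
    T.outerFaces A K ⊆ T.faces K := by
  classical
  exact Finset.filter_subset _ _

lemma Mesh.Admissible.volume_pos (h : T.Admissible A B) : 0 < ∑ K ∈ B, volume.real K :=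
  Finset.sum_pos (fun _ hK => T.volume_pos (h.right_subset hK)) h.right_nonempty

lemma Mesh.Admissible.area_pos (h : T.Admissible A B) :
    0 < ∑ K ∈ A, ∑ F ∈ T.outerFaces A K, (surf F).real Set.univ := by
  obtain ⟨K, hK, hne⟩ := h.outer
  refine Finset.sum_pos' (fun _ _ => Finset.sum_nonneg fun _ _ => measureReal_nonneg)
    ⟨K, hK, Finset.sum_pos (fun F hF => ?_) hne⟩
  exact ((T.polytope K (h.left_subset hK)).flatFace F (T.outerFaces_subset A K hF)).surf_pos

lemma HasTraces.integrable_weakGrad (hv : HasTraces T v) {K : Set (Pt d)} (hK : K ∈ T.cells) :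
    Integrable (weakGrad K v) (volume.restrict K) := by
  have : IsFiniteMeasure (volume.restrict K) :=
    ⟨by simpa using (T.polytope K hK).bounded.measure_lt_top⟩
  exact (hv K hK).1.hasWeakGrad.memLp_grad.integrable (by norm_num)

lemma HasTraces.sum_integral_inner (hv : HasTraces T v) (hB : B ⊆ T.cells) (a : Pt d) :
    ∑ K ∈ B, ∫ x in K, inner ℝ (weakGrad K v x) a =
      inner ℝ (∑ K ∈ B, ∫ x in K, weakGrad K v x) a := by
  rw [sum_inner]
  refine Finset.sum_congr rfl fun K hK => ?_
  rw [real_inner_comm, ← integral_inner (hv.integrable_weakGrad (hB hK))]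
  simp only [real_inner_comm a]

lemma IsP1.sum_integral_inner (hq : IsP1 q) (hr : IsP1 r) (B : Finset (Set (Pt d))) :
    ∑ K ∈ B, ∫ x in K, inner ℝ (∇ q x) (∇ r x) =
      (∑ K ∈ B, volume.real K) * inner ℝ (∇ q 0) (∇ r 0) := by
  simp only [hq.gradient_eq, hr.gradient_eq, setIntegral_const, smul_eq_mul, Finset.sum_mul]

/-- Testing with linear functions of arbitrary gradient identifies the constant gradient of the
projection as the mean of the broken gradient of `v`. -/
lemma IsProj.smul_gradient (h : IsProj T A B v q) (hv : HasTraces T v) (hB : B ⊆ T.cells) :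
    (∑ K ∈ B, volume.real K) • ∇ q 0 = ∑ K ∈ B, ∫ x in K, weakGrad K v x := by
  refine ext_inner_right ℝ fun a => ?_
  have h1 := h.grad _ (isP1_inner_add a 0)
  rw [h.isP1.sum_integral_inner (isP1_inner_add a 0)] at h1
  simp only [gradient_inner_add] at h1
  rw [real_inner_smul_left, h1, hv.sum_integral_inner hB]

/-- The gradient is the mean of the weak gradients, and the constant is then fitted to the boundary
integral. The two divisions need positive volume and positive outer area. -/
lemma exists_isProj (hT : T.Admissible A B) (hv : HasTraces T v) : ∃ q, IsProj T A B v q := by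
  set m := ∑ K ∈ B, volume.real K with hm
  set S := ∑ K ∈ A, ∑ F ∈ T.outerFaces A K, (surf F).real Set.univ with hS
  set a := m⁻¹ • ∑ K ∈ B, ∫ x in K, weakGrad K v x with ha
  set c := S⁻¹ * ((∑ K ∈ A, ∑ F ∈ T.outerFaces A K, ∫ x, trace K F v x ∂(surf F)) -
    ∑ K ∈ A, ∑ F ∈ T.outerFaces A K, ∫ x, inner ℝ a x ∂(surf F)) with hc
  have hm0 : m ≠ 0 := hT.volume_pos.ne'
  have hS0 : S ≠ 0 := hT.area_pos.ne'
  refine ⟨fun x => inner ℝ a x + c, isP1_inner_add a c, fun p hp => ?_, ?_⟩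
  · rw [(isP1_inner_add a c).sum_integral_inner hp]
    simp only [hp.gradient_eq, gradient_inner_add]
    rw [hv.sum_integral_inner hT.right_subset, ← real_inner_smul_left, ha, smul_inv_smul₀ hm0]
  · have e : ∑ K ∈ A, ∑ F ∈ T.outerFaces A K, ∫ x, inner ℝ a x + c ∂(surf F) =
        (∑ K ∈ A, ∑ F ∈ T.outerFaces A K, ∫ x, inner ℝ a x ∂(surf F)) + S * c := by
      rw [hS, Finset.sum_mul, ← Finset.sum_add_distrib]
      refine Finset.sum_congr rfl fun K hK => ?_
      rw [Finset.sum_mul, ← Finset.sum_add_distrib]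
      refine Finset.sum_congr rfl fun F hF => ?_
      have hFf := (T.polytope K (hT.left_subset hK)).flatFace F (T.outerFaces_subset A K hF)
      have := hFf.isFiniteMeasure
      rw [integral_add ((memLp_face hFf (by fun_prop) 2).integrable (by norm_num))
        (integrable_const c), integral_const, smul_eq_mul]
    rw [e, hc, mul_inv_cancel_left₀ hS0]
    ring

/-- The projection depends on the integral of the gradient and on the boundary integral only. -/
lemma IsProj.eq_of_data (hT : T.Admissible A B) (hv : HasTraces T v) (hw : HasTraces T w)
    (hq : IsProj T A B v q) (hr : IsProj T A B w r)
    (hg : ∑ K ∈ B, ∫ x in K, weakGrad K v x = ∑ K ∈ B, ∫ x in K, weakGrad K w x)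
    (hb : ∑ K ∈ A, ∑ F ∈ T.outerFaces A K, ∫ x, trace K F v x ∂(surf F) =
      ∑ K ∈ A, ∑ F ∈ T.outerFaces A K, ∫ x, trace K F w x ∂(surf F)) : q = r := by
  have e1 := hq.smul_gradient hv hT.right_subset
  rw [hg, ← hr.smul_gradient hw hT.right_subset] at e1
  have hgr : ∇ q 0 = ∇ r 0 := smul_right_injective _ hT.volume_pos.ne' e1
  have hconst : ∀ x, q x = r x + (q 0 - r 0) := by
    intro x
    have h1 := hq.isP1.sub_eq_inner x 0
    have h2 := hr.isP1.sub_eq_inner x 0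
    rw [hgr] at h1
    linarith
  have e2 := hq.bdry
  rw [hb, ← hr.bdry] at e2
  have e3 : ∑ K ∈ A, ∑ F ∈ T.outerFaces A K, ∫ x, q x ∂(surf F) =
      (∑ K ∈ A, ∑ F ∈ T.outerFaces A K, ∫ x, r x ∂(surf F)) +
        (∑ K ∈ A, ∑ F ∈ T.outerFaces A K, (surf F).real Set.univ) * (q 0 - r 0) := by
    rw [Finset.sum_mul, ← Finset.sum_add_distrib]
    refine Finset.sum_congr rfl fun K hK => ?_
    rw [Finset.sum_mul, ← Finset.sum_add_distrib]
    refine Finset.sum_congr rfl fun F hF => ?_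
    have hFf := (T.polytope K (hT.left_subset hK)).flatFace F (T.outerFaces_subset A K hF)
    have := hFf.isFiniteMeasure
    rw [integral_congr_ae (Eventually.of_forall hconst),
      integral_add ((memLp_face hFf hr.isP1.contDiff.continuous 2).integrable (by norm_num))
        (integrable_const _), integral_const, smul_eq_mul]
  have e4 : q 0 - r 0 = 0 := by
    have : (∑ K ∈ A, ∑ F ∈ T.outerFaces A K, (surf F).real Set.univ) * (q 0 - r 0) = 0 := by
      linarith
    exact (mul_eq_zero.1 this).resolve_left hT.area_pos.ne'
  funext x
  rw [hconst x, e4, add_zero]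

lemma isProj_proj (hT : T.Admissible A B) (hv : HasTraces T v) :
    IsProj T A B v (proj T A B v) := by
  have h := exists_isProj hT hv
  rw [proj, dif_pos h]
  exact h.choose_spec

lemma IsProj.sub (hT : T.Admissible A B) (hv : HasTraces T v) (hw : HasTraces T w)
    (hq : IsProj T A B v q) (hr : IsProj T A B w r) : IsProj T A B (v - w) (q - r) := by
  refine ⟨hq.isP1.sub hr.isP1, fun p hp => ?_, ?_⟩
  · have h1 := hq.grad p hp
    have h2 := hr.grad p hp
    rw [hq.isP1.sum_integral_inner hp] at h1
    rw [hr.isP1.sum_integral_inner hp] at h2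
    rw [(hq.isP1.sub hr.isP1).sum_integral_inner hp, hq.isP1.gradient_sub hr.isP1, inner_sub_left,
      mul_sub, h1, h2, ← Finset.sum_sub_distrib]
    refine Finset.sum_congr rfl fun K hK => ?_
    have hKc := hT.right_subset hK
    simp only [hp.gradient_eq]
    rw [← integral_sub ((hv.integrable_weakGrad hKc).inner_const _)
      ((hw.integrable_weakGrad hKc).inner_const _)]
    refine integral_congr_ae ?_
    filter_upwards [weakGrad_sub_ae (T.polytope K hKc).isOpen (hv K hKc).1 (hw K hKc).1] with x hx
    rw [hx, Pi.sub_apply, inner_sub_left]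
  · have h1 := hq.bdry
    have h2 := hr.bdry
    have e1 : ∑ K ∈ A, ∑ F ∈ T.outerFaces A K, ∫ x, (q - r) x ∂(surf F) =
        (∑ K ∈ A, ∑ F ∈ T.outerFaces A K, ∫ x, q x ∂(surf F)) -
          ∑ K ∈ A, ∑ F ∈ T.outerFaces A K, ∫ x, r x ∂(surf F) := by
      simp only [← Finset.sum_sub_distrib]
      refine Finset.sum_congr rfl fun K hK => Finset.sum_congr rfl fun F hF => ?_
      have hFf := (T.polytope K (hT.left_subset hK)).flatFace F (T.outerFaces_subset A K hF)
      have := hFf.isFiniteMeasure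
      exact integral_sub ((memLp_face hFf hq.isP1.contDiff.continuous 2).integrable (by norm_num))
        ((memLp_face hFf hr.isP1.contDiff.continuous 2).integrable (by norm_num))
    rw [e1, h1, h2]
    simp only [← Finset.sum_sub_distrib]
    exact Finset.sum_congr rfl fun K hK => Finset.sum_congr rfl fun F hF =>
      (hv.integral_trace_sub hw (hT.left_subset hK) (T.outerFaces_subset A K hF)).symm

/-- The projection is a choice, so its linearity follows from uniqueness for given data. -/
lemma proj_sub (hT : T.Admissible A B) (hv : HasTraces T v) (hw : HasTraces T w) :
    proj T A B (v - w) = proj T A B v - proj T A B w :=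
  (isProj_proj hT (hv.sub hw)).eq_of_data hT (hv.sub hw) (hv.sub hw)
    ((isProj_proj hT hv).sub hT hv hw (isProj_proj hT hw)) rfl rfl

/-- The integral of the gradient is determined by the averages on the faces. -/
lemma HasTraces.integral_weakGrad_congr (hv : HasTraces T v) (hw : HasTraces T w)
    {K : Set (Pt d)} (hK : K ∈ T.cells) (h : ∀ F ∈ T.faces K, faceAvg K F v = faceAvg K F w) :
    ∫ x in K, weakGrad K v x = ∫ x in K, weakGrad K w x := by
  refine ext_inner_right ℝ fun a => ?_
  have e1 := hv.sum_integral_inner (Finset.singleton_subset_iff.2 hK) a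
  have e2 := hw.sum_integral_inner (Finset.singleton_subset_iff.2 hK) a
  rw [Finset.sum_singleton, Finset.sum_singleton] at e1 e2
  rw [← e1, ← e2, hv.integral_weakGrad hK, hw.integral_weakGrad hK]
  refine Finset.sum_congr rfl fun F hF => ?_
  rw [← T.area_mul_faceAvg hK hF, ← T.area_mul_faceAvg hK hF, h F hF]

/-- Both data of the projection, the mean gradient (by the Gauss formula) and the boundary integral,
are functions of the face averages. Thus projections of `u` and of its interpolant coincide. -/
lemma proj_congr (hT : T.Admissible A B) (hv : HasTraces T v) (hw : HasTraces T w)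
    (h : ∀ K ∈ T.cells, ∀ F ∈ T.faces K, faceAvg K F v = faceAvg K F w) :
    proj T A B v = proj T A B w := by
  refine (isProj_proj hT hv).eq_of_data hT hv hw (isProj_proj hT hw) ?_ ?_
  · exact Finset.sum_congr rfl fun K hK => hv.integral_weakGrad_congr hw (hT.right_subset hK)
      (h K (hT.right_subset hK))
  · refine Finset.sum_congr rfl fun K hK => Finset.sum_congr rfl fun F hF => ?_
    have hKc := hT.left_subset hK
    have hF' := T.outerFaces_subset A K hF
    rw [← T.area_mul_faceAvg hKc hF', ← T.area_mul_faceAvg hKc hF', h K hKc F hF']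

/-- A linear polynomial with zero mean on the boundary of the patch is bounded by its gradient. -/
lemma IsP1.abs_le_of_sum_eq_zero (hT : T.Admissible A B) (hq : IsP1 q)
    (h : ∑ K ∈ A, ∑ F ∈ T.outerFaces A K, ∫ x, q x ∂(surf F) = 0) {x : Pt d}
    (hx : x ∈ patch A) : |q x| ≤ ‖∇ q 0‖ * Metric.diam (patch A) := by
  set S := ∑ K ∈ A, ∑ F ∈ T.outerFaces A K, (surf F).real Set.univ with hS
  have hb := (T.isBounded_patch hT.left_subset).closure
  -- The zero mean allows subtracting the integral of `q`, so that only differences of values of `q`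
  -- remain.
  have e : S * q x = ∑ K ∈ A, ∑ F ∈ T.outerFaces A K, ∫ y, (q x - q y) ∂(surf F) := by
    rw [← sub_zero (S * q x), ← h, hS, Finset.sum_mul, ← Finset.sum_sub_distrib]
    refine Finset.sum_congr rfl fun K hK => ?_
    rw [Finset.sum_mul, ← Finset.sum_sub_distrib]
    refine Finset.sum_congr rfl fun F hF => ?_
    have hFf := (T.polytope K (hT.left_subset hK)).flatFace F (T.outerFaces_subset A K hF)
    have := hFf.isFiniteMeasure
    rw [integral_sub (integrable_const _)
      ((memLp_face hFf hq.contDiff.continuous 2).integrable (by norm_num)), integral_const,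
      smul_eq_mul]
  have hle : |S * q x| ≤ S * (‖∇ q 0‖ * Metric.diam (patch A)) := by
    rw [e, hS, Finset.sum_mul]
    refine (Finset.abs_sum_le_sum_abs _ _).trans (Finset.sum_le_sum fun K hK => ?_)
    rw [Finset.sum_mul]
    refine (Finset.abs_sum_le_sum_abs _ _).trans (Finset.sum_le_sum fun F hF => ?_)
    have hFf := (T.polytope K (hT.left_subset hK)).flatFace F (T.outerFaces_subset A K hF)
    have := hFf.isFiniteMeasure
    rw [mul_comm ((surf F).real Set.univ), ← Real.norm_eq_abs]
    refine norm_integral_le_of_norm_le_const ?_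
    filter_upwards [hFf.ae_mem] with y hy
    refine (hq.abs_sub_le x y).trans (mul_le_mul_of_nonneg_left ?_ (norm_nonneg _))
    have hy' : y ∈ closure (patch A) :=
      closure_mono (T.subset_patch hT.left_subset hK)
        (T.face_subset_closure (hT.left_subset hK) (T.outerFaces_subset A K hF) hy)
    rw [← Metric.diam_closure]
    exact Metric.dist_le_diam_of_mem hb (subset_closure hx) hy'
  have hSp : 0 < S := hT.area_pos
  rw [abs_mul, abs_of_pos hSp] at hle
  exact le_of_mul_le_mul_left hle hSp

/-- On a face, a linear polynomial differs from its average by at most the variation. -/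
lemma IsP1.abs_faceAvg_sub_le (hq : IsP1 q) {K F : Set (Pt d)} (hK : K ∈ T.cells)
    (hF : F ∈ T.faces K) {x : Pt d} (hx : x ∈ F) :
    |faceAvg K F q - q x| ≤ ‖∇ q 0‖ * Metric.diam F := by
  have hFf := (T.polytope K hK).flatFace F hF
  have := hFf.isFiniteMeasure
  set S := (surf F).real Set.univ with hS
  have hSp : 0 < S := hFf.surf_pos
  have e : S * (faceAvg K F q - q x) = ∫ y, (q y - q x) ∂(surf F) := by
    rw [integral_sub ((memLp_face hFf hq.contDiff.continuous 2).integrable (by norm_num))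
      (integrable_const _), integral_const, mul_sub, T.area_mul_faceAvg hK hF,
      integral_congr_ae (trace_of_contDiff hq.contDiff hK hF), smul_eq_mul]
  have hle : |S * (faceAvg K F q - q x)| ≤ S * (‖∇ q 0‖ * Metric.diam F) := by
    rw [e, mul_comm S, ← Real.norm_eq_abs]
    refine norm_integral_le_of_norm_le_const ?_
    filter_upwards [hFf.ae_mem] with y hy
    exact (hq.abs_sub_le y x).trans (mul_le_mul_of_nonneg_left
      (Metric.dist_le_diam_of_mem hFf.bounded hy hx) (norm_nonneg _))
  rw [abs_mul, abs_of_pos hSp] at hle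
  exact le_of_mul_le_mul_left hle hSp

end Proj

/-! ### The discrete bilinear form -/

section Form

variable {Ω : Set (Pt d)} {T : Mesh Ω} {Λ : Set (Pt d) → Finset (Set (Pt d))}
  {N b M : ℕ} {γ₁ κ γ₂ : ℝ}

lemma AssumptionD.outer (hd : 0 < d) (hΩ : IsPolytope Ω) (h : AssumptionD T N b M γ₁ κ γ₂ Λ)
    {K : Set (Pt d)} (hK : K ∈ T.cells) : ∃ K' ∈ Λ K, (T.outerFaces (Λ K) K').Nonempty :=
  T.exists_outerFace hd hΩ (h.subset K hK) (h.isotropic K hK).polytope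

lemma AssumptionD.admissible_cell (hd : 0 < d) (hΩ : IsPolytope Ω)
    (h : AssumptionD T N b M γ₁ κ γ₂ Λ) {K : Set (Pt d)} (hK : K ∈ T.cells) :
    T.Admissible (Λ K) {K} :=
  ⟨h.subset K hK, Finset.singleton_subset_iff.2 hK, Finset.singleton_nonempty K, h.outer hd hΩ hK⟩

lemma AssumptionD.admissible_patch (hd : 0 < d) (hΩ : IsPolytope Ω)
    (h : AssumptionD T N b M γ₁ κ γ₂ Λ) {K : Set (Pt d)} (hK : K ∈ T.cells) :
    T.Admissible (Λ K) (Λ K) :=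
  ⟨h.subset K hK, h.subset K hK, ⟨K, h.mem K hK⟩, h.outer hd hΩ hK⟩

variable {v w w' : Pt d → ℝ}

/-- Gradients of projections and face averages are constants, so the integrals reduce to volumes and
areas. -/
lemma ah_eq (hc : ∀ K ∈ T.cells, T.Admissible (Λ K) {K}) (hw : HasTraces T w)
    (hv : HasTraces T v) :
    ah T Λ w v = ∑ K ∈ T.cells,
      (volume.real K * inner ℝ (∇ (projK T Λ K w) 0) (∇ (projK T Λ K v) 0) +
        ∑ F ∈ T.faces K, (hω Λ K)⁻¹ * ((surf F).real Set.univ *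
          (faceAvg K F (w - projω T Λ K w) * faceAvg K F (v - projω T Λ K v)))) := by
  refine Finset.sum_congr rfl fun K hK => ?_
  simp only [integral_const, smul_eq_mul, projK,
    (isProj_proj (hc K hK) hw).isP1.gradient_eq, (isProj_proj (hc K hK) hv).isP1.gradient_eq,
    measureReal_restrict_apply_univ]

lemma faceAvg_sub_projω (hp : ∀ K ∈ T.cells, T.Admissible (Λ K) (Λ K)) (hw : HasTraces T w)
    {K F : Set (Pt d)} (hK : K ∈ T.cells) (hF : F ∈ T.faces K) :
    faceAvg K F (w - projω T Λ K w) = faceAvg K F w - faceAvg K F (projω T Λ K w) :=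
  hw.faceAvg_sub (hasTraces_of_contDiff T (isProj_proj (hp K hK) hw).isP1.contDiff) hK hF

lemma ah_sub_left (hc : ∀ K ∈ T.cells, T.Admissible (Λ K) {K})
    (hp : ∀ K ∈ T.cells, T.Admissible (Λ K) (Λ K)) (hw : HasTraces T w)
    (hw' : HasTraces T w') (hv : HasTraces T v) :
    ah T Λ (w - w') v = ah T Λ w v - ah T Λ w' v := by
  rw [ah_eq hc (hw.sub hw') hv, ah_eq hc hw hv, ah_eq hc hw' hv, ← Finset.sum_sub_distrib]
  refine Finset.sum_congr rfl fun K hK => ?_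
  have e1 : ∇ (projK T Λ K (w - w')) 0 = ∇ (projK T Λ K w) 0 - ∇ (projK T Λ K w') 0 := by
    rw [projK, proj_sub (hc K hK) hw hw', (isProj_proj (hc K hK) hw).isP1.gradient_sub
      (isProj_proj (hc K hK) hw').isP1]
    rfl
  have e2 : ∀ F ∈ T.faces K, faceAvg K F (w - w' - projω T Λ K (w - w')) =
      faceAvg K F (w - projω T Λ K w) - faceAvg K F (w' - projω T Λ K w') := by
    intro F hF
    have t := hasTraces_of_contDiff T (isProj_proj (hp K hK) hw).isP1.contDiff
    have t' := hasTraces_of_contDiff T (isProj_proj (hp K hK) hw').isP1.contDiff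
    rw [faceAvg_sub_projω hp (hw.sub hw') hK hF, faceAvg_sub_projω hp hw hK hF,
      faceAvg_sub_projω hp hw' hK hF, hw.faceAvg_sub hw' hK hF, projω, proj_sub (hp K hK) hw hw',
      t.faceAvg_sub t' hK hF]
    simp only [projω]
    ring
  rw [e1, Finset.sum_congr rfl fun F hF => by rw [e2 F hF], inner_sub_left]
  have : ∀ a b c e : ℝ, a + b - (c + e) = (a - c) + (b - e) := fun a b c e => by ring
  rw [this, ← mul_sub, ← Finset.sum_sub_distrib]
  congr 1
  exact Finset.sum_congr rfl fun F _ => by ring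

/-- This replaces the interpolant by the exact solution in the first argument. -/
lemma ah_congr_left (hc : ∀ K ∈ T.cells, T.Admissible (Λ K) {K})
    (hp : ∀ K ∈ T.cells, T.Admissible (Λ K) (Λ K)) (hw : HasTraces T w)
    (hw' : HasTraces T w') (hv : HasTraces T v)
    (h : ∀ K ∈ T.cells, ∀ F ∈ T.faces K, faceAvg K F w = faceAvg K F w') :
    ah T Λ w v = ah T Λ w' v := by
  rw [ah_eq hc hw hv, ah_eq hc hw' hv]
  refine Finset.sum_congr rfl fun K hK => ?_
  have e1 : projK T Λ K w = projK T Λ K w' := proj_congr (hc K hK) hw hw' h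
  have e2 : projω T Λ K w = projω T Λ K w' := proj_congr (hp K hK) hw hw' h
  rw [e1]
  congr 1
  refine Finset.sum_congr rfl fun F hF => ?_
  rw [faceAvg_sub_projω hp hw hK hF, faceAvg_sub_projω hp hw' hK hF, e2, h K hK F hF]

end Form

/-! ### The consistency error on an element -/

section Local

variable {Ω : Set (Pt d)} {T : Mesh Ω} {A : Finset (Set (Pt d))} {K : Set (Pt d)}
  {e f u : Pt d → ℝ} {g : Set (Pt d) → Pt d → ℝ} {P Q U W : Pt d → ℝ}

lemma IsProj.volume_mul_inner (hP : IsProj T A {K} e P) (hQ : IsP1 Q) :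
    volume.real K * inner ℝ (∇ P 0) (∇ Q 0) = ∫ x in K, inner ℝ (weakGrad K e x) (∇ Q x) := by
  have h := hP.grad Q hQ
  rw [hP.isP1.sum_integral_inner hQ, Finset.sum_singleton, Finset.sum_singleton] at h
  exact h

lemma IsP1.memLp (hQ : IsP1 Q) (T : Mesh Ω) (hK : K ∈ T.cells) :
    MemLp Q 2 (volume.restrict K) :=
  memLp_of_continuous_of_isBounded hQ.contDiff.continuous (T.polytope K hK).bounded 2

lemma IsP1.memLp_surf (hQ : IsP1 Q) (T : Mesh Ω) (hK : K ∈ T.cells) {F : Set (Pt d)}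
    (hF : F ∈ T.faces K) : MemLp Q 2 (surf F) :=
  memLp_face ((T.polytope K hK).flatFace F hF) hQ.contDiff.continuous 2

/-- The consistency error on an element, up to a term that cancels in the sum over the elements. -/
lemma consistency_identity (hK : K ∈ T.cells) (he : HasTraces T e) (hu : HasTraces T u)
    (hg : HasNormalDeriv K (T.faces K) u (fun x => -f x) g)
    (hP : IsProj T A {K} e P) (hU : IsProj T A {K} u U) (hQ : IsP1 Q) (hW : IsP1 W) :
    (∫ x in K, f x * P x) - volume.real K * inner ℝ (∇ U 0) (∇ P 0) +
        ∑ F ∈ T.faces K, faceAvg K F e * ∫ x, g F x ∂(surf F) =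
      (∑ F ∈ T.faces K, ∫ x, (g F x - inner ℝ (∇ Q x) (T.normal K F)) * (faceAvg K F e - W x)
          ∂(surf F)) +
        (∫ x in K, inner ℝ (weakGrad K (u - Q) x) (∇ (W - P) x)) - ∫ x in K, f x * (W - P) x := by
  have p := T.polytope K hK
  have hfin : IsFiniteMeasure (volume.restrict K) := ⟨by simpa using p.bounded.measure_lt_top⟩
  have hWP := hW.sub hP.isP1
  -- the Green formula with `W - P`
  have gr := hg.green _ hWP.contDiff
  -- The face integrand is split so that the flux of `u` is tested separately with `Q_F e`, with `W
  -- - P` and with `P`, and the constant flux of `Q` with `e` and with `W`; each piece then meets a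
  -- Green or Gauss formula.
  have eF : ∀ F ∈ T.faces K,
      ∫ x, (g F x - inner ℝ (∇ Q x) (T.normal K F)) * (faceAvg K F e - W x) ∂(surf F) =
        faceAvg K F e * (∫ x, g F x ∂(surf F)) - (∫ x, g F x * (W - P) x ∂(surf F)) -
          (∫ x, g F x * P x ∂(surf F)) -
          (inner ℝ (∇ Q 0) (T.normal K F) * ∫ x, trace K F e x ∂(surf F)) +
          inner ℝ (∇ Q 0) (T.normal K F) * ∫ x, W x ∂(surf F) := by
    intro F hF
    have := T.isFiniteMeasure_surf hK hF
    have mg := hg.memLp_face F hF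
    have i1 : Integrable (fun x => faceAvg K F e * g F x) (surf F) :=
      (mg.integrable (by norm_num)).const_mul _
    have i2 : Integrable (fun x => g F x * (W - P) x) (surf F) :=
      mg.integrable_mul (hWP.memLp_surf T hK hF)
    have i3 : Integrable (fun x => g F x * P x) (surf F) :=
      mg.integrable_mul (hP.isP1.memLp_surf T hK hF)
    have i5 : Integrable (fun x => inner ℝ (∇ Q 0) (T.normal K F) * W x) (surf F) :=
      ((hW.memLp_surf T hK hF).integrable (by norm_num)).const_mul _
    have i4 : Integrable (fun _ : Pt d => inner ℝ (∇ Q 0) (T.normal K F) * faceAvg K F e)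
      (surf F) := integrable_const _
    have : ∀ x, (g F x - inner ℝ (∇ Q x) (T.normal K F)) * (faceAvg K F e - W x) =
        faceAvg K F e * g F x - g F x * (W - P) x - g F x * P x -
          inner ℝ (∇ Q 0) (T.normal K F) * faceAvg K F e +
          inner ℝ (∇ Q 0) (T.normal K F) * W x := fun x => by
      rw [hQ.gradient_eq, Pi.sub_apply]; ring
    simp_rw [this]
    have j2 : Integrable (fun x => faceAvg K F e * g F x - g F x * (W - P) x) (surf F) := i1.sub i2
    have j3 : Integrable (fun x => faceAvg K F e * g F x - g F x * (W - P) x - g F x * P x)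
      (surf F) := j2.sub i3
    have j4 : Integrable (fun x => faceAvg K F e * g F x - g F x * (W - P) x - g F x * P x -
      inner ℝ (∇ Q 0) (T.normal K F) * faceAvg K F e) (surf F) := j3.sub i4
    rw [integral_add j4 i5, integral_sub j3 i4, integral_sub j2 i3, integral_sub i1 i2, integral_const_mul _ (g F),
      integral_const_mul _ W,
      integral_const, ← T.area_mul_faceAvg hK hF, smul_eq_mul]
    ring
  rw [Finset.sum_congr rfl eF]
  simp only [Finset.sum_add_distrib, Finset.sum_sub_distrib]
  -- The flux of `Q` is constant on each face, so only face integrals of `e` enter. The Gauss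
  -- formula and the definition of `P` turn them into the pairing of the gradients of `P` and `Q`.
  have ge : ∑ F ∈ T.faces K, inner ℝ (∇ Q 0) (T.normal K F) * ∫ x, trace K F e x ∂(surf F) =
      volume.real K * inner ℝ (∇ P 0) (∇ Q 0) := by
    rw [hP.volume_mul_inner hQ, ← he.integral_weakGrad hK]
    simp only [hQ.gradient_eq]
  have gW : ∑ F ∈ T.faces K, inner ℝ (∇ Q 0) (T.normal K F) * ∫ x, W x ∂(surf F) =
      volume.real K * inner ℝ (∇ W 0) (∇ Q 0) := by
    rw [← integral_gradient_of_contDiff hW.contDiff hK]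
    simp only [hW.gradient_eq, setIntegral_const, smul_eq_mul]
  -- Green's formula for `u` tested with `P`; against a linear polynomial the gradient of `u` may be
  -- replaced by that of its projection `U`.
  have grP := hg.green _ hP.isP1.contDiff
  rw [← hU.volume_mul_inner hP.isP1] at grP
  have eQ : ∫ x in K, inner ℝ (weakGrad K (u - Q) x) (∇ (W - P) x) =
      (∫ x in K, inner ℝ (weakGrad K u x) (∇ (W - P) x)) -
        volume.real K * inner ℝ (∇ Q 0) (∇ (W - P) 0) := by
    have : volume.real K * inner ℝ (∇ Q 0) (∇ (W - P) 0) =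
        ∫ _x in K, inner ℝ (∇ Q 0) (∇ (W - P) 0) := by
      rw [setIntegral_const, smul_eq_mul]
    simp only [hWP.gradient_eq]
    rw [this, ← integral_sub ((hu.integrable_weakGrad hK).inner_const _) (integrable_const _)]
    refine integral_congr_ae ?_
    filter_upwards [weakGrad_sub_ae p.isOpen (hu K hK).1
      (hasTraces_of_contDiff T hQ.contDiff K hK).1,
      (hasWeakGrad_of_contDiff p.bounded hQ.contDiff).weakGrad_ae p.isOpen] with x hx hx'
    rw [hx, Pi.sub_apply, hx', inner_sub_left, hQ.gradient_eq]
  rw [ge, gW, eQ, ← gr, ← grP, hW.gradient_sub hP.isP1, inner_sub_right,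
    real_inner_comm (∇ Q 0) (∇ W 0), real_inner_comm (∇ Q 0) (∇ P 0)]
  simp only [neg_mul, integral_neg]
  ring

end Local

/-! ### The energy estimate -/

section Young

variable {α : Type*} [MeasurableSpace α] {μ : Measure α} {D h : ℝ}

/-- The difference of the two sides is a positive multiple of the square of `D h x - y`. -/
lemma mul_le_young (hD : 0 < D) (hh : 0 < h) (x y : ℝ) :
    x * y ≤ D / 2 * (h * x ^ 2) + (2 * D)⁻¹ * (h⁻¹ * y ^ 2) := by
  have h1 : 0 < D * h := mul_pos hD hh
  have e : D / 2 * (h * x ^ 2) + (2 * D)⁻¹ * (h⁻¹ * y ^ 2) - x * y =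
      (2 * (D * h))⁻¹ * (D * h * x - y) ^ 2 := by
    field_simp
    ring
  have : 0 ≤ (2 * (D * h))⁻¹ * (D * h * x - y) ^ 2 := by positivity
  linarith

lemma integral_mul_le_young {a c : α → ℝ} (ha : MemLp a 2 μ) (hc : MemLp c 2 μ) (hD : 0 < D)
    (hh : 0 < h) : ∫ x, a x * c x ∂μ ≤
      D / 2 * (h * ∫ x, a x ^ 2 ∂μ) + (2 * D)⁻¹ * (h⁻¹ * ∫ x, c x ^ 2 ∂μ) := by
  simp only [← integral_const_mul]
  have i1 : Integrable (fun x => D / 2 * (h * a x ^ 2)) μ := (ha.integrable_sq.const_mul h).const_mul _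
  have i2 : Integrable (fun x => (2 * D)⁻¹ * (h⁻¹ * c x ^ 2)) μ :=
    (hc.integrable_sq.const_mul h⁻¹).const_mul _
  rw [← integral_add i1 i2]
  exact integral_mono (ha.integrable_mul hc) (i1.add i2) fun x => mul_le_young hD hh _ _

end Young

/-- The norm squared of a weighted mean is at most the weighted mean of the norms squared. -/
lemma mul_norm_sq_le_sum {ι E : Type*} [NormedAddCommGroup E] [InnerProductSpace ℝ E]
    (s : Finset ι) {c : ι → ℝ} (hc : ∀ i ∈ s, 0 ≤ c i) {p : ι → E} {G : E}
    (h : (∑ i ∈ s, c i) • G = ∑ i ∈ s, c i • p i) :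
    (∑ i ∈ s, c i) * ‖G‖ ^ 2 ≤ ∑ i ∈ s, c i * ‖p i‖ ^ 2 := by
  -- The weighted variance is nonnegative; expanding it around the mean `G` gives the inequality.
  have h1 : 0 ≤ ∑ i ∈ s, c i * ‖p i - G‖ ^ 2 :=
    Finset.sum_nonneg fun i hi => mul_nonneg (hc i hi) (sq_nonneg _)
  have h2 : ∑ i ∈ s, c i * ‖p i - G‖ ^ 2 =
      (∑ i ∈ s, c i * ‖p i‖ ^ 2) - 2 * inner ℝ (∑ i ∈ s, c i • p i) G +
        (∑ i ∈ s, c i) * ‖G‖ ^ 2 := by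
    rw [sum_inner, Finset.mul_sum, Finset.sum_mul, ← Finset.sum_sub_distrib,
      ← Finset.sum_add_distrib]
    refine Finset.sum_congr rfl fun i _ => ?_
    rw [norm_sub_sq_real, real_inner_smul_left]
    ring
  rw [h2, ← h, real_inner_smul_left, real_inner_self_eq_norm_sq] at h1
  linarith

section Estimate

variable {Ω : Set (Pt d)} {T : Mesh Ω} {A : Finset (Set (Pt d))} {K F : Set (Pt d)}
  {e f u v : Pt d → ℝ} {g : Set (Pt d) → Pt d → ℝ} {P Q W : Pt d → ℝ} {D h : ℝ}

lemma Mesh.diam_patch_pos (T : Mesh Ω) (hd : 0 < d) (hA : A ⊆ T.cells) (hK : K ∈ A) :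
    0 < Metric.diam (patch A) := by
  have : Nonempty (Fin d) := ⟨⟨0, hd⟩⟩
  have p := T.polytope K (hA hK)
  obtain ⟨x, hx⟩ := p.connected.nonempty
  refine Metric.diam_pos ?_ (T.isBounded_patch hA)
  exact ((infinite_of_mem_nhds x (p.isOpen.mem_nhds hx)).nontrivial).mono (T.subset_patch hA hK)

lemma Mesh.diam_face_le (T : Mesh Ω) (hA : A ⊆ T.cells) (hK : K ∈ A) (hF : F ∈ T.faces K) :
    Metric.diam F ≤ Metric.diam (patch A) := by
  rw [← Metric.diam_closure (s := patch A)]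
  exact Metric.diam_mono ((T.face_subset_closure (hA hK) hF).trans
    (closure_mono (T.subset_patch hA hK))) (T.isBounded_patch hA).closure

/-- Nonnegativity of the variance of the trace on the face. -/
lemma HasTraces.area_mul_faceAvg_sq_le (hv : HasTraces T v) (hK : K ∈ T.cells)
    (hF : F ∈ T.faces K) :
    (surf F).real Set.univ * faceAvg K F v ^ 2 ≤ ∫ x, trace K F v x ^ 2 ∂(surf F) := by
  have := T.isFiniteMeasure_surf hK hF
  have m := hv.memLp_trace hK hF
  have i1 : Integrable (fun x => 2 * faceAvg K F v * trace K F v x) (surf F) :=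
    (m.integrable (by norm_num)).const_mul _
  have h0 : 0 ≤ ∫ x, (trace K F v x - faceAvg K F v) ^ 2 ∂(surf F) :=
    integral_nonneg fun x => sq_nonneg _
  have e : ∀ x, (trace K F v x - faceAvg K F v) ^ 2 =
      trace K F v x ^ 2 - 2 * faceAvg K F v * trace K F v x + faceAvg K F v ^ 2 := fun x => by ring
  have i2 : Integrable (fun x => trace K F v x ^ 2 - 2 * faceAvg K F v * trace K F v x) (surf F) :=
    m.integrable_sq.sub i1
  simp_rw [e] at h0
  rw [integral_add i2 (integrable_const _), integral_sub m.integrable_sq i1, integral_const_mul,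
    integral_const, ← T.area_mul_faceAvg hK hF, smul_eq_mul] at h0
  linarith

/-- The variation of the difference of a function and a linear polynomial on a face. -/
lemma IsP1.integral_sq_le (hW : IsP1 W) (he : HasTraces T e) (hK : K ∈ T.cells)
    (hF : F ∈ T.faces K) :
    ∫ x, (faceAvg K F e - W x) ^ 2 ∂(surf F) ≤ (surf F).real Set.univ *
      (2 * faceAvg K F (e - W) ^ 2 + 2 * (‖∇ W 0‖ * Metric.diam F) ^ 2) := by
  have hFf := (T.polytope K hK).flatFace F hF
  have := hFf.isFiniteMeasure
  rw [he.faceAvg_sub (hasTraces_of_contDiff T hW.contDiff) hK hF, ← smul_eq_mul, ← integral_const]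
  have hm : MemLp (fun x => faceAvg K F e - W x) 2 (surf F) :=
    (memLp_const _).sub (hW.memLp_surf T hK hF)
  refine integral_mono_ae hm.integrable_sq (integrable_const _) ?_
  filter_upwards [hFf.ae_mem] with x hx
  have h1 := sq_le_sq' (neg_le_of_abs_le (hW.abs_faceAvg_sub_le hK hF hx))
    (le_of_abs_le (hW.abs_faceAvg_sub_le hK hF hx))
  -- The split is `Q_F e - W = Q_F (e - W) + (Q_F W - W)`: a stabilization term and the oscillation
  -- of `W` on the face.
  nlinarith [sq_nonneg (faceAvg K F e - faceAvg K F W - (faceAvg K F W - W x))]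

/-- The normal derivative term of the consistency error. -/
lemma integral_normal_le (hK : K ∈ T.cells) (hF : F ∈ T.faces K) (he : HasTraces T e)
    (hg : MemLp (g F) 2 (surf F)) (hQ : IsP1 Q) (hW : IsP1 W) (hD : 0 < D) (hh : 0 < h)
    (hFh : Metric.diam F ≤ h) {c : ℝ}
    (hc : Metric.diam F * (surf F).real Set.univ ≤ c) :
    ∫ x, (g F x - inner ℝ (∇ Q x) (T.normal K F)) * (faceAvg K F e - W x) ∂(surf F) ≤
      D / 2 * (h * ∫ x, (g F x - inner ℝ (∇ Q x) (T.normal K F)) ^ 2 ∂(surf F)) +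
        D⁻¹ * (h⁻¹ * ((surf F).real Set.univ * faceAvg K F (e - W) ^ 2) + c * ‖∇ W 0‖ ^ 2) := by
  have := T.isFiniteMeasure_surf hK hF
  have m1 : MemLp (fun x => g F x - inner ℝ (∇ Q x) (T.normal K F)) 2 (surf F) := by
    simp only [hQ.gradient_eq]
    exact hg.sub (memLp_const _)
  have m2 : MemLp (fun x => faceAvg K F e - W x) 2 (surf F) :=
    (memLp_const _).sub (hW.memLp_surf T hK hF)
  refine (integral_mul_le_young m1 m2 hD hh).trans (add_le_add le_rfl ?_)
  have h1 := hW.integral_sq_le he hK hF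
  set S := (surf F).real Set.univ
  have hS : 0 ≤ S := measureReal_nonneg
  set s := faceAvg K F (e - W)
  set G := ‖∇ W 0‖
  set δ := Metric.diam F
  have hδ : 0 ≤ δ := Metric.diam_nonneg
  -- Of the two factors `diam F` in the squared oscillation, one is spent against the weight `h⁻¹`;
  -- the other is paired with the area, and their product is at most `c`.
  have h2 : h⁻¹ * δ ≤ 1 := by rw [inv_mul_le_iff₀ hh]; simpa using hFh
  calc (2 * D)⁻¹ * (h⁻¹ * ∫ x, (faceAvg K F e - W x) ^ 2 ∂(surf F))
      ≤ (2 * D)⁻¹ * (h⁻¹ * (S * (2 * s ^ 2 + 2 * (G * δ) ^ 2))) := by gcongr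
    _ = D⁻¹ * (h⁻¹ * (S * s ^ 2) + (h⁻¹ * δ) * (δ * S) * G ^ 2) := by
        rw [mul_inv]; ring
    _ ≤ D⁻¹ * (h⁻¹ * (S * s ^ 2) + 1 * c * G ^ 2) := by gcongr
    _ = _ := by rw [one_mul]

/-- The gradient term of the consistency error. -/
lemma integral_inner_le (hK : K ∈ T.cells) (hv : HasTraces T v) (hW : IsP1 W) (hD : 0 < D) :
    ∫ x in K, inner ℝ (weakGrad K v x) (∇ W x) ≤
      D / 2 * (∫ x in K, ‖weakGrad K v x‖ ^ 2) + (2 * D)⁻¹ * (volume.real K * ‖∇ W 0‖ ^ 2) := by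
  have m1 := (hv K hK).1.hasWeakGrad.memLp_grad
  have m2 : MemLp (∇ W) 2 (volume.restrict K) := memLp_of_continuous_of_isBounded
    (continuous_gradient hW.contDiff) (T.polytope K hK).bounded 2
  have h1 := integral_mul_le_young m1.norm m2.norm hD one_pos
  have h2 : ∫ x in K, ‖∇ W x‖ ^ 2 = volume.real K * ‖∇ W 0‖ ^ 2 := by
    simp only [hW.gradient_eq, setIntegral_const, smul_eq_mul]
  rw [h2, one_mul, inv_one, one_mul] at h1
  exact (integral_mono (integrable_inner_of_memLp m1 m2) (m1.norm.integrable_mul m2.norm)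
    fun x => real_inner_le_norm _ _).trans h1

/-- The load term of the consistency error. -/
lemma neg_integral_load_le (hK : K ∈ T.cells) (hf : MemLp f 2 (volume.restrict K)) (hW : IsP1 W)
    (hD : 0 < D) (hh : 0 < h) (hWh : ∀ x ∈ K, |W x| ≤ ‖∇ W 0‖ * h) :
    -∫ x in K, f x * W x ≤
      D / 2 * (h ^ 2 * ∫ x in K, f x ^ 2) + (2 * D)⁻¹ * (volume.real K * ‖∇ W 0‖ ^ 2) := by
  have m : MemLp W 2 (volume.restrict K) := hW.memLp T hK
  have hfin : IsFiniteMeasure (volume.restrict K) :=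
    ⟨by simpa using (T.polytope K hK).bounded.measure_lt_top⟩
  -- With weight `h²` in Young's inequality, the factor `h` in the bound of `W` cancels.
  have h1 := integral_mul_le_young hf m.neg hD (sq_pos_of_pos hh)
  simp only [Pi.neg_apply, mul_neg, integral_neg, even_two.neg_pow] at h1
  refine h1.trans (add_le_add le_rfl (mul_le_mul_of_nonneg_left ?_ (by positivity)))
  have h2 : ∫ x in K, W x ^ 2 ≤ volume.real K * (‖∇ W 0‖ * h) ^ 2 := by
    rw [← smul_eq_mul, ← setIntegral_const]
    refine integral_mono_ae m.integrable_sq (integrable_const _) ?_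
    filter_upwards [ae_restrict_mem (T.polytope K hK).isOpen.measurableSet] with x hx
    exact sq_le_sq' (neg_le_of_abs_le (hWh x hx)) (le_of_abs_le (hWh x hx))
  rw [inv_mul_le_iff₀ (by positivity)]
  exact h2.trans (le_of_eq (by ring))

end Estimate

section Energy

variable {Ω : Set (Pt d)} {T : Mesh Ω} {Λ : Set (Pt d) → Finset (Set (Pt d))}
  {N b M : ℕ} {γ₁ κ γ₂ : ℝ} {e f u : Pt d → ℝ}

/-- The contribution of the element `K` to the energy of `e`. -/
def localEnergy (T : Mesh Ω) (Λ : Set (Pt d) → Finset (Set (Pt d))) (K : Set (Pt d))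
    (e : Pt d → ℝ) : ℝ :=
  volume.real K * ‖∇ (projK T Λ K e) 0‖ ^ 2 +
    ∑ F ∈ T.faces K, (hω Λ K)⁻¹ * ((surf F).real Set.univ * faceAvg K F (e - projω T Λ K e) ^ 2)

/-- The contribution of the element `K` to the error bound. -/
def localError (T : Mesh Ω) (Λ : Set (Pt d) → Finset (Set (Pt d))) (K : Set (Pt d))
    (f u : Pt d → ℝ) (g : Set (Pt d) → Pt d → ℝ) : ℝ :=
  (∑ F ∈ T.faces K, hω Λ K *
      ∫ x, (g F x - inner ℝ (∇ (projω T Λ K u) x) (T.normal K F)) ^ 2 ∂(surf F)) +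
    (∑ F ∈ T.faces K, (hω Λ K)⁻¹ * ∫ x, trace K F (u - projω T Λ K u) x ^ 2 ∂(surf F)) +
    (∫ x in K, ‖weakGrad K (u - projω T Λ K u) x‖ ^ 2) + hω Λ K ^ 2 * ∫ x in K, f x ^ 2

/-- The energy of the projection to the linear polynomials on the patch. -/
def patchEnergy (T : Mesh Ω) (Λ : Set (Pt d) → Finset (Set (Pt d))) (K : Set (Pt d))
    (e : Pt d → ℝ) : ℝ := (∑ K' ∈ Λ K, volume.real K') * ‖∇ (projω T Λ K e) 0‖ ^ 2

lemma hω_nonneg (Λ : Set (Pt d) → Finset (Set (Pt d))) (K : Set (Pt d)) : 0 ≤ hω Λ K :=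
  Metric.diam_nonneg

lemma volume_mul_le_localEnergy (T : Mesh Ω) (Λ : Set (Pt d) → Finset (Set (Pt d)))
    (K : Set (Pt d)) (e : Pt d → ℝ) :
    volume.real K * ‖∇ (projK T Λ K e) 0‖ ^ 2 ≤ localEnergy T Λ K e := by
  have := hω_nonneg Λ K
  exact le_add_of_nonneg_right (Finset.sum_nonneg fun F _ => by positivity)

lemma localEnergy_nonneg (T : Mesh Ω) (Λ : Set (Pt d) → Finset (Set (Pt d)))
    (K : Set (Pt d)) (e : Pt d → ℝ) : 0 ≤ localEnergy T Λ K e :=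
  le_trans (by positivity) (volume_mul_le_localEnergy T Λ K e)

lemma ah_self_eq (hc : ∀ K ∈ T.cells, T.Admissible (Λ K) {K}) (he : HasTraces T e) :
    ah T Λ e e = ∑ K ∈ T.cells, localEnergy T Λ K e := by
  rw [ah_eq hc he he]
  refine Finset.sum_congr rfl fun K _ => ?_
  simp only [localEnergy, real_inner_self_eq_norm_sq, ← sq]

/-- The gradient of the patch projection is the volume-weighted mean of those of the element
projections, to which convexity of the square applies. The additive constants of the projections,
normalized on different patches, do not matter. -/
lemma patchEnergy_le (hD : AssumptionD T N b M γ₁ κ γ₂ Λ)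
    (hc : ∀ K ∈ T.cells, T.Admissible (Λ K) {K})
    (hp : ∀ K ∈ T.cells, T.Admissible (Λ K) (Λ K)) (he : HasTraces T e) {K : Set (Pt d)}
    (hK : K ∈ T.cells) : patchEnergy T Λ K e ≤ ∑ K' ∈ Λ K, localEnergy T Λ K' e := by
  refine (mul_norm_sq_le_sum (Λ K) (p := fun K' => ∇ (projK T Λ K' e) 0)
    (fun _ _ => measureReal_nonneg) ?_).trans
      (Finset.sum_le_sum fun K' _ => volume_mul_le_localEnergy T Λ K' e)
  rw [projω, (isProj_proj (hp K hK) he).smul_gradient he (hD.subset K hK)]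
  refine Finset.sum_congr rfl fun K' hK' => ?_
  have hK'c := hD.subset K hK hK'
  have h := (isProj_proj (hc K' hK'c) he).smul_gradient he (Finset.singleton_subset_iff.2 hK'c)
  rw [Finset.sum_singleton, Finset.sum_singleton] at h
  exact h.symm

/-- The patches overlap finitely often, so the patch energies are bounded by the energy. -/
lemma sum_patchEnergy_le (hA : AssumptionA T N) (hD : AssumptionD T N b M γ₁ κ γ₂ Λ)
    (hc : ∀ K ∈ T.cells, T.Admissible (Λ K) {K})
    (hp : ∀ K ∈ T.cells, T.Admissible (Λ K) (Λ K)) (he : HasTraces T e) :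
    ∑ K ∈ T.cells, patchEnergy T Λ K e ≤
      ((N : ℝ) + 1) ^ M * ∑ K ∈ T.cells, localEnergy T Λ K e := by
  classical
  calc ∑ K ∈ T.cells, patchEnergy T Λ K e
      ≤ ∑ K ∈ T.cells, ∑ K' ∈ Λ K, localEnergy T Λ K' e :=
        Finset.sum_le_sum fun K hK => patchEnergy_le hD hc hp he hK
    -- After exchanging the sums, each element energy is counted once for every patch containing the
    -- element.
    _ = ∑ K' ∈ T.cells, ∑ K ∈ T.cells.filter (fun K => K' ∈ Λ K), localEnergy T Λ K' e := by
        refine Finset.sum_comm' fun K K' => ?_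
        simp only [Finset.mem_filter]
        exact ⟨fun h => ⟨h, hD.subset K h.1 h.2⟩, fun h => h.1⟩
    _ ≤ ∑ K' ∈ T.cells, ((N : ℝ) + 1) ^ M * localEnergy T Λ K' e := by
        refine Finset.sum_le_sum fun K' hK' => ?_
        rw [Finset.sum_const, nsmul_eq_mul]
        refine mul_le_mul_of_nonneg_right ?_ (localEnergy_nonneg T Λ K' e)
        have := hD.card_overlap_le T hA hK'
        have h2 : ((T.cells.filter fun K => K' ∈ Λ K).card : ℝ) ≤ (((N + 1) ^ M : ℕ) : ℝ) := by
          refine Nat.cast_le.2 (le_trans (le_of_eq ?_) this)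
          congr
        simpa using h2
    _ = _ := by rw [Finset.mul_sum]

/-- The terms of the consistency error of an element are bounded by the error terms and a small part
of the energy. -/
lemma consistency_le (hd : 0 < d) (hA : AssumptionA T N)
    (hD : AssumptionD T N b M γ₁ κ γ₂ Λ) (hγ₁ : 0 < γ₁)
    (hc : ∀ K ∈ T.cells, T.Admissible (Λ K) {K})
    (hp : ∀ K ∈ T.cells, T.Admissible (Λ K) (Λ K)) (he : HasTraces T e) (hu : HasTraces T u)
    {K : Set (Pt d)} (hK : K ∈ T.cells) (hf : MemLp f 2 (volume.restrict K))
    {g : Set (Pt d) → Pt d → ℝ} (hg : ∀ F ∈ T.faces K, MemLp (g F) 2 (surf F))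
    {t : ℝ} (ht : 0 < t) :
    (∑ F ∈ T.faces K, ∫ x, (g F x - inner ℝ (∇ (projω T Λ K u) x) (T.normal K F)) *
          (faceAvg K F e - projω T Λ K e x) ∂(surf F)) +
        (∫ x in K, inner ℝ (weakGrad K (u - projω T Λ K u) x)
          (∇ (projω T Λ K e - projK T Λ K e) x)) -
        (∫ x in K, f x * (projω T Λ K e - projK T Λ K e) x) -
        ∑ F ∈ T.faces K, (hω Λ K)⁻¹ * ((surf F).real Set.univ *
          (faceAvg K F (u - projω T Λ K u) * faceAvg K F (e - projω T Λ K e))) ≤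
      t / 2 * localError T Λ K f u g + t⁻¹ * (2 * localEnergy T Λ K e +
        (N * (2 ^ d * b / γ₁) + 2) * patchEnergy T Λ K e) := by
  have hP := isProj_proj (hc K hK) he
  have hW := isProj_proj (hp K hK) he
  have hQ := isProj_proj (hp K hK) hu
  have hΛ := hD.subset K hK
  have hmem := hD.mem K hK
  have hh : 0 < hω Λ K := T.diam_patch_pos hd hΛ hmem
  have hWP := hW.isP1.sub hP.isP1
  set m := ∑ K' ∈ Λ K, volume.real K' with hm
  set Cv : ℝ := 2 ^ d * b / γ₁ with hCv
  have hCv0 : 0 ≤ Cv := by positivity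
  have hm0 : 0 ≤ m := Finset.sum_nonneg fun _ _ => measureReal_nonneg
  -- For a face inside the patch, either normal may carry the height condition; the volume bound is
  -- the same for both.
  have hgeo : ∀ F ∈ T.faces K, Metric.diam F * (surf F).real Set.univ ≤ Cv * m := by
    intro F hF
    obtain ⟨n, hn, hiso⟩ := hD.face K hK F hF
    refine (hiso.diam_mul_area_le hγ₁ ((T.polytope K hK).flatFace F hF) hn
      (T.isBounded_patch hΛ).measure_lt_top.ne).trans ?_
    exact mul_le_mul_of_nonneg_left (T.volume_patch_le hΛ) hCv0
  have hKm : volume.real K ≤ m :=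
    Finset.single_le_sum (f := fun K' => volume.real K') (fun _ _ => measureReal_nonneg) hmem
  -- the normal derivative terms
  have b1 := Finset.sum_le_sum fun F hF => integral_normal_le (D := t) hK hF he (hg F hF) hQ.isP1
    hW.isP1 ht hh (T.diam_face_le hΛ hmem hF) (hgeo F hF)
  rw [Finset.sum_add_distrib, ← Finset.mul_sum _ _ (t / 2), ← Finset.mul_sum _ _ t⁻¹,
    Finset.sum_add_distrib, Finset.sum_const, nsmul_eq_mul] at b1
  -- the gradient and load terms
  have b2 := integral_inner_le hK
    (hu.sub (hasTraces_of_contDiff T hQ.isP1.contDiff)) hWP ht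
  -- Both projections are normalized by the same integral over the patch boundary, so their
  -- difference has zero mean there. This gives the pointwise bound needed for the load.
  have hzero : ∑ K' ∈ Λ K, ∑ F ∈ T.outerFaces (Λ K) K',
      ∫ x, (proj T (Λ K) (Λ K) e - proj T (Λ K) {K} e) x ∂(surf F) = 0 := by
    have := hW.bdry.trans hP.bdry.symm
    rw [← sub_eq_zero, ← Finset.sum_sub_distrib] at this
    rw [← this]
    refine Finset.sum_congr rfl fun K' hK' => ?_
    rw [← Finset.sum_sub_distrib]
    refine Finset.sum_congr rfl fun F hF => ?_
    have hF' := T.outerFaces_subset _ _ hF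
    have := T.isFiniteMeasure_surf (hΛ hK') hF'
    exact integral_sub ((hW.isP1.memLp_surf T (hΛ hK') hF').integrable (by norm_num))
      ((hP.isP1.memLp_surf T (hΛ hK') hF').integrable (by norm_num))
  have b3 := neg_integral_load_le hK hf hWP ht hh fun x hx =>
    hWP.abs_le_of_sum_eq_zero (hp K hK) hzero (T.subset_patch hΛ hmem hx)
  have hgr : ‖∇ (proj T (Λ K) (Λ K) e - proj T (Λ K) {K} e) 0‖ ^ 2 ≤
      2 * ‖∇ (proj T (Λ K) (Λ K) e) 0‖ ^ 2 + 2 * ‖∇ (proj T (Λ K) {K} e) 0‖ ^ 2 := by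
    rw [hW.isP1.gradient_sub hP.isP1]
    have h1 := norm_sub_le (∇ (proj T (Λ K) (Λ K) e) 0) (∇ (proj T (Λ K) {K} e) 0)
    have h2 := pow_le_pow_left₀ (norm_nonneg _) h1 2
    nlinarith [sq_nonneg (‖∇ (proj T (Λ K) (Λ K) e) 0‖ - ‖∇ (proj T (Λ K) {K} e) 0‖)]
  -- the stabilization terms
  have b4 : -∑ F ∈ T.faces K, (hω Λ K)⁻¹ * ((surf F).real Set.univ *
      (faceAvg K F (u - projω T Λ K u) * faceAvg K F (e - projω T Λ K e))) ≤
      t / 2 * (∑ F ∈ T.faces K, (hω Λ K)⁻¹ *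
        ∫ x, trace K F (u - projω T Λ K u) x ^ 2 ∂(surf F)) +
      (2 * t)⁻¹ * ∑ F ∈ T.faces K, (hω Λ K)⁻¹ *
        ((surf F).real Set.univ * faceAvg K F (e - projω T Λ K e) ^ 2) := by
    rw [← Finset.sum_neg_distrib, Finset.mul_sum, Finset.mul_sum, ← Finset.sum_add_distrib]
    refine Finset.sum_le_sum fun F hF => ?_
    have h1 := (hu.sub (hasTraces_of_contDiff T hQ.isP1.contDiff)).area_mul_faceAvg_sq_le hK hF
    have h2 := mul_le_young ht one_pos (-faceAvg K F (u - projω T Λ K u))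
      (faceAvg K F (e - projω T Λ K e))
    have hS : 0 ≤ (hω Λ K)⁻¹ * (surf F).real Set.univ := by positivity
    have h3 := mul_le_mul_of_nonneg_left h2 hS
    have h4 : t / 2 * ((hω Λ K)⁻¹ *
        ((surf F).real Set.univ * faceAvg K F (u - projω T Λ K u) ^ 2)) ≤
        t / 2 * ((hω Λ K)⁻¹ * ∫ x, trace K F (u - projω T Λ K u) x ^ 2 ∂(surf F)) := by
      gcongr
      exact h1
    rw [even_two.neg_pow, one_mul, inv_one, one_mul] at h3
    linarith
  have hcard : ((T.faces K).card : ℝ) ≤ N := Nat.cast_le.2 (hA K hK)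
  simp only [projω, projK, localError, localEnergy, patchEnergy] at b1 b2 b3 b4 ⊢
  set S := ∑ F ∈ T.faces K, (hω Λ K)⁻¹ *
    ((surf F).real Set.univ * faceAvg K F (e - proj T (Λ K) (Λ K) e) ^ 2)
  have hS0 : 0 ≤ S := Finset.sum_nonneg fun F _ => by positivity
  set w := ‖∇ (proj T (Λ K) (Λ K) e) 0‖ ^ 2
  set a := ‖∇ (proj T (Λ K) {K} e) 0‖ ^ 2
  set r := ‖∇ (proj T (Λ K) (Λ K) e - proj T (Λ K) {K} e) 0‖ ^ 2
  have hw0 : 0 ≤ w := sq_nonneg _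
  have hvol : 0 ≤ volume.real K := measureReal_nonneg
  have c1 : volume.real K * r ≤ 2 * (m * w) + 2 * (volume.real K * a) := by
    have h1 := mul_le_mul_of_nonneg_left hgr hvol
    have h2 := mul_le_mul_of_nonneg_right hKm hw0
    linarith
  have c2 : ((T.faces K).card : ℝ) * (Cv * m * w) ≤ N * Cv * (m * w) := by
    have h0 : 0 ≤ Cv * m * w := by positivity
    have := mul_le_mul_of_nonneg_right hcard h0
    linarith
  -- The stabilization energy occurs with weight `1` from the faces and `1/2` from the stabilization
  -- itself, hence at most `2`; the gradient and load terms together contribute the volume of `K`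
  -- times `r` once, split by `c1`.
  have c3 : t⁻¹ * (S + (T.faces K).card * (Cv * m * w)) + (2 * t)⁻¹ * (volume.real K * r) +
      (2 * t)⁻¹ * (volume.real K * r) + (2 * t)⁻¹ * S ≤
      t⁻¹ * (2 * (volume.real K * a + S) + (N * Cv + 2) * (m * w)) := by
    have : (2 * t)⁻¹ = t⁻¹ / 2 := by rw [mul_inv]; ring
    rw [this]
    have h : t⁻¹ * (S + (T.faces K).card * (Cv * m * w) + volume.real K * r + S / 2) ≤
        t⁻¹ * (2 * (volume.real K * a + S) + (N * Cv + 2) * (m * w)) :=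
      mul_le_mul_of_nonneg_left (by linarith) (by positivity)
    linarith
  linarith

/-- The energy of the difference of the discrete solution and the interpolant is bounded by the
consistency error. -/
theorem energy_le (hd : 0 < d) (hΩ : IsPolytope Ω) (hA : AssumptionA T N)
    (hD : AssumptionD T N b M γ₁ κ γ₂ Λ) (hγ₁ : 0 < γ₁) (hf : MemLp f 2 (volume.restrict Ω))
    (hu : IsWeakSolution Ω f u) {g : Set (Pt d) → Set (Pt d) → Pt d → ℝ}
    (hg : ∀ K ∈ T.cells, HasNormalDeriv K (T.faces K) u (fun x => -f x) (g K))
    {uh uI : Pt d → ℝ} (huh : IsDiscreteSolution T Λ f uh) (huI : IsInterpolant T u uI) :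
    ah T Λ (uh - uI) (uh - uI) ≤
      2 * (2 + (N * (2 ^ d * b / γ₁) + 2) * ((N : ℝ) + 1) ^ M) *
        ∑ K ∈ T.cells, localError T Λ K f u (g K) := by
  have hc : ∀ K ∈ T.cells, T.Admissible (Λ K) {K} := fun K hK => hD.admissible_cell hd hΩ hK
  have hp : ∀ K ∈ T.cells, T.Admissible (Λ K) (Λ K) := fun K hK => hD.admissible_patch hd hΩ hK
  have tu : HasTraces T u := hu.1.hasTraces T hΩ
  have se : MemSpace T (uh - uI) := huh.1.sub huI.1
  have te := se.hasTraces
  set e := uh - uI with he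
  -- `B` is the total weight of the energy of `e` once the patch energies are replaced by it. With
  -- Young parameter `2 B` exactly half of the energy is to be absorbed.
  set B : ℝ := 2 + (N * (2 ^ d * b / γ₁) + 2) * ((N : ℝ) + 1) ^ M with hB
  have hB0 : 0 < B := by positivity
  -- This sum vanishes although `e` is discontinuous, because it involves the fluxes only through
  -- their face integrals. Adding it removes the nonconformity error.
  have hjump : ∑ K ∈ T.cells, ∑ F ∈ T.faces K, faceAvg K F e * ∫ x, g K F x ∂(surf F) = 0 := by
    refine T.sum_faces_eq_zero (fun K F => faceAvg K F e) (fun K F => ∫ x, g K F x ∂(surf F))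
      ?_ ?_ ?_
    · intro K hK F hF hb
      simp only [faceAvg, average_eq, se.bdry K hK F hF hb, smul_zero]
    · intro K hK K' hK' hne F hF hF'
      simp only [faceAvg, average_eq, se.jump K hK K' hK' hne F hF hF']
    · intro K hK K' hK' hne F hF hF'
      exact T.integral_normalDeriv_add hΩ hf hu hg hK hK' hne hF hF'
  have hsplit : ah T Λ e e = ∑ K ∈ T.cells, ((∫ x in K, f x * projK T Λ K e x) -
      volume.real K * inner ℝ (∇ (projK T Λ K u) 0) (∇ (projK T Λ K e) 0) +
      (∑ F ∈ T.faces K, faceAvg K F e * ∫ x, g K F x ∂(surf F)) -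
      ∑ F ∈ T.faces K, (hω Λ K)⁻¹ * ((surf F).real Set.univ *
          (faceAvg K F (u - projω T Λ K u) * faceAvg K F (e - projω T Λ K e)))) := by
    -- The discrete equation handles `uh`, while `uI` is exchanged for `u`; the Galerkin part of
    -- `a_h(u, e)` then joins the load, and its stabilization part is kept apart.
    have h1 : ah T Λ e e = ah T Λ uh e - ah T Λ uI e :=
      ah_sub_left hc hp huh.1.hasTraces huI.1.hasTraces te
    rw [h1, huh.2 e se, ← ah_congr_left hc hp tu huI.1.hasTraces te huI.2, ah_eq hc tu te]
    simp only [Finset.sum_sub_distrib, Finset.sum_add_distrib]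
    rw [hjump]
    ring
  have hle : ah T Λ e e ≤ ∑ K ∈ T.cells, ((2 * B) / 2 * localError T Λ K f u (g K) +
      (2 * B)⁻¹ * (2 * localEnergy T Λ K e +
        (N * (2 ^ d * b / γ₁) + 2) * patchEnergy T Λ K e)) := by
    rw [hsplit]
    refine Finset.sum_le_sum fun K hK => ?_
    have hid := consistency_identity hK te tu (hg K hK) (isProj_proj (hc K hK) te)
      (isProj_proj (hc K hK) tu) (isProj_proj (hp K hK) tu).isP1 (isProj_proj (hp K hK) te).isP1
    have hest := consistency_le (t := 2 * B) hd hA hD hγ₁ hc hp te tu hK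
      (hf.mono_measure (Measure.restrict_mono (T.subset K hK) le_rfl)) (hg K hK).memLp_face
      (by positivity)
    simp only [projK, projω] at hest ⊢
    linarith
  rw [Finset.sum_add_distrib, ← Finset.mul_sum, ← Finset.mul_sum, Finset.sum_add_distrib,
    ← Finset.mul_sum, ← Finset.mul_sum, ← ah_self_eq hc te] at hle
  have hov := sum_patchEnergy_le hA hD hc hp te
  rw [← ah_self_eq hc te] at hov
  -- Bounded overlap turns the patch energies into energy, and the weights add up to `B`; the
  -- remaining factor is `1/2`.
  have h1 : (2 * B)⁻¹ * (2 * ah T Λ e e + (N * (2 ^ d * b / γ₁) + 2) *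
      ∑ K ∈ T.cells, patchEnergy T Λ K e) ≤ ah T Λ e e / 2 := by
    calc _ ≤ (2 * B)⁻¹ * (2 * ah T Λ e e + (N * (2 ^ d * b / γ₁) + 2) *
          (((N : ℝ) + 1) ^ M * ah T Λ e e)) := by gcongr
      _ = (2 * B)⁻¹ * (B * ah T Λ e e) := by rw [hB]; ring
      _ = _ := by field_simp
  linarith

end Energy

end VEM

end

theorem lemma4p11 (d : ℕ) (hd : d = 2 ∨ d = 3) (N b M : ℕ) (γ₁ κ γ₂ : ℝ)
    (hγ₁ : 0 < γ₁) (hκ : 0 < κ) (hγ₂ : 0 < γ₂) :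
    ∃ C > 0, ∀ (Ω : Set (VEM.Pt d)), VEM.IsPolytope Ω →
      ∀ (T : VEM.Mesh Ω) (Λ : Set (VEM.Pt d) → Finset (Set (VEM.Pt d))),
        VEM.AssumptionA T N → VEM.AssumptionD T N b M γ₁ κ γ₂ Λ →
      ∀ f : VEM.Pt d → ℝ, MemLp f 2 (volume.restrict Ω) →
      ∀ u : VEM.Pt d → ℝ, VEM.IsWeakSolution Ω f u →
      -- `g K F` is the normal derivative of `u` on the face `F` of `K`, assumed to be in `L²(F)`
      ∀ g : Set (VEM.Pt d) → Set (VEM.Pt d) → VEM.Pt d → ℝ,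
        (∀ K ∈ T.cells, VEM.HasNormalDeriv K (T.faces K) u (fun x => -f x) (g K)) →
      ∀ uh uI : VEM.Pt d → ℝ, VEM.IsDiscreteSolution T Λ f uh → VEM.IsInterpolant T u uI →
        VEM.ah T Λ (uh - uI) (uh - uI) ≤
          C * ((∑ K ∈ T.cells, ∑ F ∈ T.faces K, VEM.hω Λ K *
                ∫ x, (g K F x - inner ℝ (∇ (VEM.projω T Λ K u) x) (T.normal K F)) ^ 2
                  ∂(VEM.surf F))
            + (∑ K ∈ T.cells, ∑ F ∈ T.faces K, (VEM.hω Λ K)⁻¹ *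
                ∫ x, (VEM.trace K F (u - VEM.projω T Λ K u) x) ^ 2 ∂(VEM.surf F))
            + (∑ K ∈ T.cells, ∫ x in K, ‖VEM.weakGrad K (u - VEM.projω T Λ K u) x‖ ^ 2)
            + ∑ K ∈ T.cells, (VEM.hω Λ K) ^ 2 * ∫ x in K, (f x) ^ 2) := by
  have hd0 : 0 < d := by rcases hd with rfl | rfl <;> norm_num
  -- Twice the absorption weight `B` of `energy_le`: the error carries the factor `B`, and moving
  -- half of the energy to the left doubles it.
  refine ⟨2 * (2 + (N * (2 ^ d * b / γ₁) + 2) * ((N : ℝ) + 1) ^ M), by positivity, ?_⟩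
  intro Ω hΩ T Λ hA hD f hf u hu g hg uh uI huh huI
  refine (VEM.energy_le hd0 hΩ hA hD hγ₁ hf hu hg huh huI).trans (le_of_eq ?_)
  simp only [VEM.localError, Finset.sum_add_distrib]
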